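/- Let $X=S^1=\mathbb R/2\pi\mathbb Z$ and let either $Y=\mathbb R$, $\phi(y)=y^3/3$, or $Y=S^1$, $\phi(y)=\sin y$. For $h>0$ let $$P=hD_x+h\partial_y+\phi'(y),\qquad D=\tfrac1i\partial,$$ on $L^2(X\times Y)$, with domain $\{u\in L^2:\ (1+y^2)u,\,hD_xu,\,hD_yu\in L^2\}$ if $Y=\mathbb R$ and $\{u\in L^2:\ hD_xu,\,hD_yu\in L^2\}$ if $Y=S^1$, and let $P^*P$ be the associated self-adjoint operator (that is, $\overline P^{\,*}\,\overline P$, where $\overline P$ is the closure of $P$). Let $p(x,y;\xi,\eta)=\xi+i\eta+\phi'(y)$ be the symbol of $P$ on $T^*(X\times Y)$, let $\sigma=d\xi\wedge dx+d\eta\wedge dy$, and let $$\Sigma_+=\{\rho\in T^*(X\times Y):\ p(\rho)=0,\ \tfrac1i\{p,\overline p\}(\rho)>0\},$$ where $\{f,g\}=\partial_\xi f\,\partial_xg+\partial_\eta f\,\partial_yg-\partial_xf\,\partial_\xi g-\partial_yf\,\partial_\eta g$. For $\xi<0$ if $Y=\mathbb R$, and for $-1<\xi<1$ if $Y=S^1$,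 let $y_\pm(\xi)\in Y$ be the solutions of $\phi'(y_\pm)=-\xi$ with $\pm\phi''(y_\pm)>0$, and let $S_0(\xi)$ be the distance from $y_+(\xi)$ to $y_-(\xi)$ in $Y$ for the (degenerate) metric $(\xi+\phi'(y))^2dy^2$, viewed as a function on $\Sigma_+$ through the coordinate $\xi$. Integrals over subsets of $\Sigma_+$ of $d\sigma|_{\Sigma_+}$ are taken with respect to the positive symplectic area measure. **Theorem.** For every $c\ge1$ and every $\delta_0\in(0,1)$ there are constants $C_0,K>0$ such that the following holds in both cases. Let $h>0$ and $0<\delta\le\delta_0$ satisfy $$C_0h\le\frac{\delta^{3/2}}{\log\delta^{-1}},$$ and let $0<a<b$ satisfy $\tfrac1c\le b\le c$ and $\tfrac1c\delta^{3/2}\le a\le c\,\delta^{3/2}$. Then the spectrum of $P^*P$ in $[he^{-2b/h},he^{-2a/h}]$ consists of finitely many eigenvalues of finite multiplicity, and, counting them with multiplicity (equivalently, counting the singular values of $P$ in $[\sqrt h\,e^{-b/h},\sqrt h\,e^{-a/h}]$), $$\left|\#\Big(\mathrm{Spec}(P^*P)\cap[he^{-2b/h},he^{-2a/h}]\Big)-\frac1{2\pi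 h}\int_{S_0^{-1}([a,b])}d\sigma|_{\Sigma_+}\right|\le K\,\frac{\log\delta^{-1}}{\sqrt\delta}.$$ -/

import Mathlib

open MeasureTheory Set
open scoped ContDiff LinearPMap

noncomputable section

/-! ## The surface `X × Y` with `X = S¹` and `Y = ℝ` or `Y = S¹` -/

instance factTwoPiPos : Fact (0 < 2 * Real.pi) := ⟨Real.two_pi_pos⟩

/-- The circle `ℝ / 2πℤ`, with its Lebesgue measure of total mass `2π`. -/
abbrev S1 : Type := AddCircle (2 * Real.pi)

/-- The point of the circle represented by a real number. -/
def toS1 : ℝ →+ S1 := QuotientAddGroup.mk' _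

/-- The representative of a point of the circle in `(-π, π]`. -/
def repS1 (x : S1) : ℝ := (AddCircle.equivIoc (2 * Real.pi) (-Real.pi) x : ℝ)

/-- The data which distinguish the two model cases: the covering map `ℝ → Y`, its inverse near
`0`, the potential `φ`, and the weight `w` in the requirement `w u ∈ L²` on the domain of `P`. -/
structure Model (Y : Type) [AddCommGroup Y] where
  cover : ℝ →+ Y
  rep : Y → ℝ
  phi : Y → ℝ
  weight : Y → ℝ

/-- `Y = ℝ`, `φ(y) = y³ / 3`. -/
def lineModel : Model ℝ where
  cover := AddMonoidHom.id ℝ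
  rep := fun y => y
  phi := fun y => y ^ 3 / 3
  weight := fun y => 1 + y ^ 2

/-- `Y = S¹`, `φ(y) = sin y`. -/
def circleModel : Model S1 where
  cover := toS1
  rep := repS1
  phi := Real.sin_periodic.lift
  weight := fun _ => 1

namespace Model

variable {Y : Type} [AddCommGroup Y]

/-- The derivative `∂_y f` of a function on `Y`. -/
def dY {E : Type} [NormedAddCommGroup E] [NormedSpace ℝ E] (M : Model Y) (f : Y → E) (y : Y) : E :=
  deriv (fun s : ℝ => f (y + M.cover s)) 0

/-- `∂_y φ`. -/
def dphi (M : Model Y) : Y → ℝ := M.dY M.phi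

/-- `∂_y² φ`. -/
def ddphi (M : Model Y) : Y → ℝ := M.dY M.dphi

end Model

/-- The derivative `∂_x f` of a function on `X = S¹`. -/
def dX {E : Type} [NormedAddCommGroup E] [NormedSpace ℝ E] (f : S1 → E) (x : S1) : E :=
  deriv (fun s : ℝ => f (x + toS1 s)) 0

/-! ## The operator `P` -/

namespace Model

variable {Y : Type} [AddCommGroup Y] [TopologicalSpace Y] [MeasureSpace Y]

/-- `ψ ∈ C_c^∞(X × Y)`; smoothness is smoothness of the lift of `ψ` to `ℝ × ℝ`. -/
def IsTestFunction (M : Model Y) (ψ : S1 × Y → ℂ) : Prop :=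
  ContDiff ℝ ∞ (fun q : ℝ × ℝ => ψ (toS1 q.1, M.cover q.2)) ∧ HasCompactSupport ψ

/-- `v = ∂_x u` in the sense of distributions on `X × Y`. -/
def IsWeakDX (M : Model Y) (u v : Lp ℂ 2 (volume : Measure (S1 × Y))) : Prop :=
  ∀ ψ : S1 × Y → ℂ, M.IsTestFunction ψ →
    ∫ q, u q * dX (fun x => ψ (x, q.2)) q.1 = -∫ q, v q * ψ q

/-- `v = ∂_y u` in the sense of distributions on `X × Y`. -/
def IsWeakDY (M : Model Y) (u v : Lp ℂ 2 (volume : Measure (S1 × Y))) : Prop :=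
  ∀ ψ : S1 × Y → ℂ, M.IsTestFunction ψ →
    ∫ q, u q * M.dY (fun y => ψ (q.1, y)) q.2 = -∫ q, v q * ψ q

/-- The pairs `(u, v)` with `u, ∂_x u, ∂_y u, w u ∈ L²` and
`v = h D_x u + h ∂_y u + (∂_y φ) u`, where `D_x = ∂_x / i`. -/
def IsPPair (M : Model Y) (h : ℝ) (u v : Lp ℂ 2 (volume : Measure (S1 × Y))) : Prop :=
  MemLp (fun q : S1 × Y => (M.weight q.2 : ℂ) * u q) 2 volume ∧
  ∃ ux uy : Lp ℂ 2 (volume : Measure (S1 × Y)), M.IsWeakDX u ux ∧ M.IsWeakDY u uy ∧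
    ∀ᵐ q : S1 × Y, v q = (h : ℂ) / Complex.I * ux q + (h : ℂ) * uy q + (M.dphi q.2 : ℂ) * u q

end Model

/-- The composition `g ∘ f` of unbounded operators, on `{u ∈ D(f) ; f u ∈ D(g)}`. -/
def unboundedComp {E : Type} [AddCommGroup E] [Module ℂ E] (g f : E →ₗ.[ℂ] E) : E →ₗ.[ℂ] E :=
  g.comp (f.domRestrict ((g.domain.comap f.toFun).map f.domain.subtype)) (by
    rintro ⟨x, hx⟩
    obtain ⟨⟨y, hy, hyx⟩, hxf⟩ := hx
    have e : y = ⟨x, hxf⟩ := Subtype.ext hyx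
    subst e
    exact hy)

/-- The resolvent set of an unbounded operator `T`: those `z` for which `T - z : D(T) → H` is
bijective with bounded inverse `R`. -/
def unboundedResolventSet {H : Type} [NormedAddCommGroup H] [NormedSpace ℂ H]
    (T : H →ₗ.[ℂ] H) : Set ℂ :=
  {z | ∃ R : H →L[ℂ] H,
    (∀ v : H, ∃ hv : R v ∈ T.domain, T ⟨R v, hv⟩ - z • R v = v) ∧
    (∀ u : T.domain, R (T u - z • (u : H)) = u)}

/-- `Spec(T)` for an unbounded operator `T`. -/
def unboundedSpectrum {H : Type} [NormedAddCommGroup H] [NormedSpace ℂ H]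
    (T : H →ₗ.[ℂ] H) : Set ℂ := (unboundedResolventSet T)ᶜ

/-- `ker (T - z)`, as a subspace of `D(T)`. -/
def unboundedEigenspace {H : Type} [NormedAddCommGroup H] [NormedSpace ℂ H]
    (T : H →ₗ.[ℂ] H) (z : ℂ) : Submodule ℂ T.domain :=
  LinearMap.ker (T.toFun - z • T.domain.subtype)

/-- `Spec(T) ∩ I` for a set `I` of real numbers. -/
def spectrumIn {H : Type} [NormedAddCommGroup H] [NormedSpace ℂ H]
    (T : H →ₗ.[ℂ] H) (I : Set ℝ) : Set ℝ := {t | t ∈ I ∧ (t : ℂ) ∈ unboundedSpectrum T}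

/-- `Spec(T) ∩ I` consists of finitely many eigenvalues of finite multiplicity. -/
def HasDiscreteSpectrumIn {H : Type} [NormedAddCommGroup H] [NormedSpace ℂ H]
    (T : H →ₗ.[ℂ] H) (I : Set ℝ) : Prop :=
  (spectrumIn T I).Finite ∧ ∀ t ∈ spectrumIn T I,
    unboundedEigenspace T (t : ℂ) ≠ ⊥ ∧ FiniteDimensional ℂ (unboundedEigenspace T (t : ℂ))

/-- `#(Spec(T) ∩ I)`, the eigenvalues being counted with their multiplicities. -/
def spectrumCount {H : Type} [NormedAddCommGroup H] [NormedSpace ℂ H]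
    (T : H →ₗ.[ℂ] H) (I : Set ℝ) : ℕ :=
  ∑ᶠ t ∈ spectrumIn T I, Module.finrank ℂ (unboundedEigenspace T (t : ℂ))

namespace Model

variable {Y : Type} [AddCommGroup Y] [TopologicalSpace Y] [MeasureSpace Y]

/-- `P = h D_x + h ∂_y + ∂_y φ`, with domain
`{u ∈ L² ; w u, h D_x u, h D_y u ∈ L²}`, given through its graph. (The submodule spanned by the
pairs is the set of these pairs, because they form a linear subspace, and it is a graph, because
weak derivatives are unique.) -/
def opP (M : Model Y) (h : ℝ) :
    Lp ℂ 2 (volume : Measure (S1 × Y)) →ₗ.[ℂ] Lp ℂ 2 (volume : Measure (S1 × Y)) :=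
  (Submodule.span ℂ {q : Lp ℂ 2 (volume : Measure (S1 × Y)) × Lp ℂ 2 (volume : Measure (S1 × Y)) |
    M.IsPPair h q.1 q.2}).toLinearPMap

/-- The self-adjoint operator `P* P`, the operator `P` being replaced by its closure. -/
def opPstarP (M : Model Y) (h : ℝ) :
    Lp ℂ 2 (volume : Measure (S1 × Y)) →ₗ.[ℂ] Lp ℂ 2 (volume : Measure (S1 × Y)) :=
  unboundedComp ((M.opP h).closure†) (M.opP h).closure

end Model

/-! ## Phase space, the symbol, `Σ₊` and the action `S₀` -/

/-- Points `((x, y), (ξ, η))` of the phase space `T*(X × Y)`. -/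
abbrev Phase (Y : Type) : Type := (S1 × Y) × (ℝ × ℝ)

namespace Model

variable {Y : Type} [AddCommGroup Y]

/-- The symbol `p = ξ + i η + ∂_y φ`. -/
def symbol (M : Model Y) (ρ : Phase Y) : ℂ :=
  (ρ.2.1 : ℂ) + Complex.I * (ρ.2.2 : ℂ) + (M.dphi ρ.1.2 : ℂ)

/-- The Poisson bracket
`{f, g} = ∂_ξ f ∂_x g + ∂_η f ∂_y g - ∂_x f ∂_ξ g - ∂_y f ∂_η g`. -/
def poisson (M : Model Y) (f g : Phase Y → ℂ) (ρ : Phase Y) : ℂ :=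
  deriv (fun ξ => f (ρ.1, (ξ, ρ.2.2))) ρ.2.1 * dX (fun x => g ((x, ρ.1.2), ρ.2)) ρ.1.1
  + deriv (fun η => f (ρ.1, (ρ.2.1, η))) ρ.2.2 * M.dY (fun y => g ((ρ.1.1, y), ρ.2)) ρ.1.2
  - dX (fun x => f ((x, ρ.1.2), ρ.2)) ρ.1.1 * deriv (fun ξ => g (ρ.1, (ξ, ρ.2.2))) ρ.2.1
  - M.dY (fun y => f ((ρ.1.1, y), ρ.2)) ρ.1.2 * deriv (fun η => g (ρ.1, (ρ.2.1, η))) ρ.2.2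

/-- `Σ₊ = {ρ ; p(ρ) = 0, (1/i) {p, p̄}(ρ) > 0}`; the bracket is purely imaginary. -/
def sigmaPlus (M : Model Y) : Set (Phase Y) :=
  {ρ | M.symbol ρ = 0 ∧
    0 < (1 / Complex.I * M.poisson M.symbol (fun ρ' => (starRingEnd ℂ) (M.symbol ρ')) ρ).re}

/-- The solution `y₊(ξ)` of `∂_y φ(y) = -ξ`, `∂_y² φ(y) > 0` (where it exists). -/
def yPlus (M : Model Y) (ξ : ℝ) : Y :=
  @Classical.epsilon Y ⟨0⟩ (fun y => M.dphi y = -ξ ∧ 0 < M.ddphi y)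

/-- The solution `y₋(ξ)` of `∂_y φ(y) = -ξ`, `∂_y² φ(y) < 0` (where it exists). -/
def yMinus (M : Model Y) (ξ : ℝ) : Y :=
  @Classical.epsilon Y ⟨0⟩ (fun y => M.dphi y = -ξ ∧ M.ddphi y < 0)

/-- The Lithner-Agmon distance on `Y`, i.e. the infimum of the lengths of the curves joining
`y₀` to `y₁` for the degenerate metric `(ξ + ∂_y φ(y))² dy²`. The curves are written as
`t ↦ y₀ + g(t)`, with `g` real-valued and `C¹`. -/
def agmonDist (M : Model Y) (ξ : ℝ) (y₀ y₁ : Y) : ℝ :=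
  sInf {l : ℝ | ∃ g : ℝ → ℝ, ContDiff ℝ 1 g ∧ g 0 = 0 ∧ y₀ + M.cover (g 1) = y₁ ∧
    l = ∫ t in (0 : ℝ)..1, |ξ + M.dphi (y₀ + M.cover (g t))| * |deriv g t|}

/-- The action `S₀(ξ) = d(y₊(ξ), y₋(ξ))`. -/
def action (M : Model Y) (ξ : ℝ) : ℝ := M.agmonDist ξ (M.yPlus ξ) (M.yMinus ξ)

/-- `S₀⁻¹([a, b])`, where `S₀` is regarded as a function on `Σ₊`. -/
def actionPreimage (M : Model Y) (a b : ℝ) : Set (Phase Y) :=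
  {ρ | ρ ∈ M.sigmaPlus ∧ M.action ρ.2.1 ∈ Icc a b}

/-- The symplectic form `σ = dξ ∧ dx + dη ∧ dy` on tangent vectors `((x, y), (ξ, η))`. -/
def symplForm (v w : (ℝ × ℝ) × (ℝ × ℝ)) : ℝ :=
  (v.2.1 * w.1.1 - v.1.1 * w.2.1) + (v.2.2 * w.1.2 - v.1.2 * w.2.2)

/-- The tangent vector at time `0` of a curve in phase space. -/
def velocity (M : Model Y) (c : ℝ → Phase Y) : (ℝ × ℝ) × (ℝ × ℝ) :=
  ((deriv (fun s => repS1 ((c s).1.1 - (c 0).1.1)) 0,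
    deriv (fun s => M.rep ((c s).1.2 - (c 0).1.2)) 0),
   (deriv (fun s => (c s).2.1) 0, deriv (fun s => (c s).2.2) 0))

/-- The parametrization `(x, ξ) ↦ (x, y₊(ξ); ξ, 0)` of `Σ₊`. -/
def sigmaPlusParam (M : Model Y) (q : S1 × ℝ) : Phase Y := ((q.1, M.yPlus q.2), (q.2, 0))

/-- The symplectic area `∫_A dσ|_{Σ₊}` of `A ⊆ Σ₊`: the integral of the density
`|σ(∂_x κ, ∂_ξ κ)| dx dξ`, where `κ` is the above parametrization of `Σ₊`. -/
def symplArea (M : Model Y) (A : Set (Phase Y)) : ℝ :=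
  ∫ q in {q : S1 × ℝ | M.sigmaPlusParam q ∈ A},
    |symplForm (M.velocity (fun s => M.sigmaPlusParam (q.1 + toS1 s, q.2)))
      (M.velocity (fun s => M.sigmaPlusParam (q.1, q.2 + s)))|

end Model

end

/-! `P` commutes with translations in `x`, so Fourier series in `x` split it into the operators `P_k
= h k + h ∂_y + φ'(y)` on `L²(Y)`, one for each point `ξ = h k` of the lattice `hℤ`. Each fiber
contributes at most one eigenvalue to the window, and for the relevant modes it has size `h e^{-2
S₀(h k)/h}` up to a factor that is polynomial in `1/δ`. The count is therefore a count of lattice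
points `h k` with `S₀(h k) ∈ [a, b]`. The symplectic form restricted to `Σ₊` is `dx dξ` up to sign,
so the integral in the theorem is `2π` times the Lebesgue measure of this set of `ξ`.

In a fiber put `Φ(s) = ξ s + φ(s)` on the covering line, so that `P_k = h e^{-Φ/h} ∂ e^{Φ/h}`. The
formal kernel `e^{-Φ/h}` sits in the well of `Φ` at `y₊` and has to be cut off at the barrier `y₋`;
`S₀` is the height of the lower barrier. Three estimates follow. Upper bound: the truncated
`e^{-Φ/h}` is a quasimode (`Model.exists_quasimode`, `lineModel_upper`, `circleModel_upper`). Lower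
bound: the equation `P_k U = g` is integrated from a point where the boundary term is harmless. The
solution operator has kernel at most `h⁻¹ e^{S₀/h}` times a Gaussian, hence norm `O(h^{-1/2}
e^{S₀/h})` up to powers of `δ` (`Model.IsSolution.norm_sq_le`, `lineModel_lower`,
`circleModel_lower`). Gap: on functions vanishing at `y₊` one can integrate uphill only, and the
same argument holds with `S₀` replaced by `0`. Hence no two-dimensional subspace has Rayleigh
quotients of `P_k* P_k` below `h/B`, where `B` is of order `1/δ` (`lineModel_two_dim`,
`circleModel_two_dim`).

The passage from these inequalities to the spectrum of the closed operator goes through the bounded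
resolvent `Q = (1 + P* P)⁻¹`, read off from the graph (`exists_isGraphResolvent`, `exists_isBottom`,
`Model.exists_isFibered`, `IsFibered.spectrum_and_count`).

Replacing the eigenvalue by `h e^{-2 S₀/h}` blurs the ends of `[a, b]` by `ε = h log (2B)`, that is
`O(h log δ⁻¹)` (`Model.exists_modes`). Where `S₀` is at least of order `δ^{3/2}` one has `|dξ/dS₀| =
O(δ^{-1/2})`, so the blur misplaces `O(δ^{-1/2} ε / h) = O(log δ⁻¹ / √δ)` lattice points
(`abs_ncard_sub_volume_le`). This is the error of the theorem.

On the circle the mode `k = 0` has the exact kernel `e^{-φ/h}` and escapes the lower bound; as a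
single mode it costs at most one unit. -/

set_option linter.unusedSectionVars false

noncomputable section

/-! ## The resolvent of `A* A` through the graph of `A` -/

section GraphResolvent

open scoped InnerProductSpace

variable {H : Type} [NormedAddCommGroup H] [InnerProductSpace ℂ H]

theorem re_inner_self (x : H) : (inner ℂ x x : ℂ).re = ‖x‖ ^ 2 :=
  inner_self_eq_norm_sq (𝕜 := ℂ) x

theorem re_inner_real_smul_self (c : ℝ) (x : H) : (inner ℂ (c • x) x : ℂ).re = c * ‖x‖ ^ 2 := by
  rw [← Complex.coe_smul, inner_smul_left, Complex.conj_ofReal, Complex.re_ofReal_mul,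
    re_inner_self]

/-- `(u, v)` belongs to the graph `G` of `A`, and `u + A* v = w`. -/
def IsGraphSol (G : Submodule ℂ (H × H)) (w u v : H) : Prop :=
  (u, v) ∈ G ∧ ∀ p ∈ G, inner ℂ p.1 w = inner ℂ p.1 u + inner ℂ p.2 v

/-- `Q` is the resolvent `(1 + A* A)⁻¹`, where `G` is the graph of `A`. -/
def IsGraphResolvent (G : Submodule ℂ (H × H)) (Q : H →L[ℂ] H) : Prop :=
  ∀ w, ∃ v, IsGraphSol G w (Q w) v

/-- Both equations are tested against the difference of the two solutions, itself an element of `G`;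
subtracting leaves `‖u - u'‖² + ‖v - v'‖² = 0`. -/
theorem IsGraphSol.unique {G : Submodule ℂ (H × H)} {w u v u' v' : H}
    (h : IsGraphSol G w u v) (h' : IsGraphSol G w u' v') : u = u' ∧ v = v' := by
  have hm : (u - u', v - v') ∈ G := G.sub_mem h.1 h'.1
  have e1 := h.2 _ hm
  have e2 := h'.2 _ hm
  have e3 : inner ℂ (u - u') (u - u') + inner ℂ (v - v') (v - v') = (0 : ℂ) := by
    rw [inner_sub_right (u - u') u u', inner_sub_right (v - v') v v']
    simp only at e1 e2
    linear_combination e2 - e1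
  have e4 : ‖u - u'‖ ^ 2 + ‖v - v'‖ ^ 2 = 0 := by
    have := congrArg Complex.re e3
    rwa [Complex.add_re, re_inner_self, re_inner_self] at this
  have h1 : ‖u - u'‖ = 0 := by nlinarith [sq_nonneg ‖u - u'‖, sq_nonneg ‖v - v'‖]
  have h2 : ‖v - v'‖ = 0 := by nlinarith [sq_nonneg ‖u - u'‖, sq_nonneg ‖v - v'‖]
  exact ⟨sub_eq_zero.1 (norm_eq_zero.1 h1), sub_eq_zero.1 (norm_eq_zero.1 h2)⟩

/-- Von Neumann's construction: `(Q w, v)` is the orthogonal projection of `(w, 0)` onto the graph.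
The projection takes place in `WithLp 2 (H × H)` because `H × H` itself carries the maximum norm. -/
theorem exists_isGraphResolvent [CompleteSpace H] (G : Submodule ℂ (H × H))
    (hG : IsClosed (G : Set (H × H))) : ∃ Q : H →L[ℂ] H, IsGraphResolvent G Q := by
  let e := WithLp.prodContinuousLinearEquiv 2 ℂ H H
  let G' : Submodule ℂ (WithLp 2 (H × H)) := G.comap (e : WithLp 2 (H × H) →ₗ[ℂ] H × H)
  have hG' : IsClosed (G' : Set (WithLp 2 (H × H))) := hG.preimage e.continuous
  have : CompleteSpace G' := hG'.completeSpace_coe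
  let Q : H →L[ℂ] H := (WithLp.fstL 2 ℂ H H).comp
    (G'.starProjection.comp ((e.symm : H × H →L[ℂ] WithLp 2 (H × H)).comp
      (ContinuousLinearMap.inl ℂ H H)))
  refine ⟨Q, fun w => ⟨(G'.starProjection (e.symm (w, 0))).snd, ?_, ?_⟩⟩
  · exact G'.starProjection_apply_mem (e.symm (w, 0))
  · intro p hp
    have h1 := G'.sub_starProjection_mem_orthogonal (e.symm (w, 0))
    have h2 := (Submodule.mem_orthogonal _ _).1 h1 (e.symm p) (by
      change e (e.symm p) ∈ G
      simpa using hp)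
    rw [inner_sub_right, WithLp.prod_inner_apply, WithLp.prod_inner_apply] at h2
    have h3 : inner ℂ p.1 w + inner ℂ p.2 (0 : H)
      - (inner ℂ p.1 (Q w) + inner ℂ p.2 (G'.starProjection (e.symm (w, 0))).snd) = 0 := h2
    rw [inner_zero_right] at h3
    linear_combination h3

namespace IsGraphResolvent

variable {G : Submodule ℂ (H × H)} {Q : H →L[ℂ] H}

theorem inner_self (hQ : IsGraphResolvent G Q) (w : H) :
    ∃ v, (Q w, v) ∈ G ∧ inner ℂ (Q w) w = ((‖Q w‖ ^ 2 + ‖v‖ ^ 2 : ℝ) : ℂ) := by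
  obtain ⟨v, hv, h⟩ := hQ w
  refine ⟨v, hv, ?_⟩
  rw [h _ hv, inner_self_eq_norm_sq_to_K, inner_self_eq_norm_sq_to_K]
  push_cast
  rfl

theorem inner_comm (hQ : IsGraphResolvent G Q) (w z : H) :
    inner ℂ (Q w) z = inner ℂ w (Q z) := by
  obtain ⟨v, hv, h⟩ := hQ w
  obtain ⟨y, hy, h'⟩ := hQ z
  rw [h' _ hv, ← inner_conj_symm w, h _ hy, map_add, inner_conj_symm, inner_conj_symm]

theorem isSelfAdjoint [CompleteSpace H] (hQ : IsGraphResolvent G Q) : IsSelfAdjoint Q :=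
  ContinuousLinearMap.isSelfAdjoint_iff_isSymmetric.2 fun w z => hQ.inner_comm w z

theorem re_inner_le (hQ : IsGraphResolvent G Q) (w : H) :
    ‖Q w‖ ^ 2 ≤ (inner ℂ (Q w) w).re := by
  obtain ⟨v, -, h⟩ := hQ.inner_self w
  rw [h, Complex.ofReal_re]
  nlinarith [sq_nonneg ‖v‖]

/-- An upper bound for `Q` is a lower bound for `A`. -/
theorem le_of_inner_le (hQ : IsGraphResolvent G Q) {c : ℝ} (hc : 0 < c)
    (h : ∀ w, (inner ℂ (Q w) w).re ≤ c * ‖w‖ ^ 2) {u v : H} (huv : (u, v) ∈ G) :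
    (1 / c - 1) * ‖u‖ ^ 2 ≤ ‖v‖ ^ 2 := by
  obtain ⟨y, hy, hy'⟩ := hQ u
  have h0 := hy' _ huv
  obtain ⟨y', hy1, hy2⟩ := hQ.inner_self u
  have h3 := h u
  have e : (inner ℂ (Q u) u).re = ‖Q u‖ ^ 2 + ‖y‖ ^ 2 := by
    rw [hy' _ hy, inner_self_eq_norm_sq_to_K, inner_self_eq_norm_sq_to_K]
    norm_cast
  rw [e] at h3
  -- The equation for `Q u`, tested against `(u, v)`, expresses `‖u‖²` by `Q u` and `y`.
  -- Cauchy–Schwarz then gives `‖u‖⁴ ≤ (‖u‖² + ‖v‖²) ⟨Q u, u⟩`, and the bound on `Q` enters through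
  -- the last factor.
  have h4 : ‖u‖ ^ 2 ≤ ‖u‖ * ‖Q u‖ + ‖v‖ * ‖y‖ := by
    have : ‖(inner ℂ u u : ℂ)‖ ≤ ‖u‖ * ‖Q u‖ + ‖v‖ * ‖y‖ := by
      simp only at h0
      rw [h0]
      exact (norm_add_le _ _).trans (add_le_add (norm_inner_le_norm _ _) (norm_inner_le_norm _ _))
    rwa [inner_self_eq_norm_sq_to_K, norm_pow, RCLike.norm_ofReal, abs_norm] at this
  have h5 : (‖u‖ * ‖Q u‖ + ‖v‖ * ‖y‖) ^ 2 ≤ (‖u‖ ^ 2 + ‖v‖ ^ 2) * (‖Q u‖ ^ 2 + ‖y‖ ^ 2) := by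
    nlinarith [sq_nonneg (‖u‖ * ‖y‖ - ‖v‖ * ‖Q u‖)]
  have h6 : (‖u‖ ^ 2) ^ 2 ≤ (‖u‖ ^ 2 + ‖v‖ ^ 2) * (c * ‖u‖ ^ 2) := by
    calc (‖u‖ ^ 2) ^ 2 ≤ (‖u‖ * ‖Q u‖ + ‖v‖ * ‖y‖) ^ 2 := by gcongr
      _ ≤ _ := h5
      _ ≤ _ := by gcongr
  rcases eq_or_lt_of_le (sq_nonneg ‖u‖) with h7 | h7
  · rw [← h7]; simp
  · have h8 : ‖u‖ ^ 2 ≤ (‖u‖ ^ 2 + ‖v‖ ^ 2) * c := by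
      by_contra hcon
      push Not at hcon
      nlinarith
    rw [sub_mul, one_mul, sub_le_iff_le_add, div_mul_eq_mul_div, one_mul, div_le_iff₀ hc]
    linarith

end IsGraphResolvent

/-- The continuous function `max (x - θ) 0`. -/
def cutAbove (θ : ℝ) (x : ℝ) : ℝ := max (x - θ) 0

theorem continuous_cutAbove (θ : ℝ) : Continuous (cutAbove θ) := by
  unfold cutAbove; fun_prop

theorem reInner_cfc_nonneg [CompleteSpace H] {Q : H →L[ℂ] H} {f : ℝ → ℝ}
    (hf : ∀ x, 0 ≤ f x) (w : H) : 0 ≤ (inner ℂ (cfc f Q w) w).re := by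
  have h : (0 : H →L[ℂ] H) ≤ cfc f Q := cfc_nonneg fun x _ => hf x
  rw [ContinuousLinearMap.nonneg_iff_isPositive] at h
  exact h.re_inner_nonneg_left w

/-- The part of the spectrum of `A* A` below `s`, for an operator `A` with the property that
`‖A u‖² < s ‖u‖²` on no two-dimensional subspace, consists of at most one simple eigenvalue. -/
theorem exists_bottom [CompleteSpace H] {G : Submodule ℂ (H × H)} {Q : H →L[ℂ] H}
    (hQ : IsGraphResolvent G Q) {s τ : ℝ} (hτ : 0 ≤ τ) (hs : τ < s)
    (hG : ∀ p ∈ G, ∀ q ∈ G, ∃ c d : ℂ, (c ≠ 0 ∨ d ≠ 0) ∧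
      s * ‖c • p.1 + d • q.1‖ ^ 2 ≤ ‖c • p.2 + d • q.2‖ ^ 2) :
    (∀ w, (inner ℂ (Q w) w).re ≤ 1 / (1 + τ) * ‖w‖ ^ 2) ∨
    ∃ e : H, ∃ l : ℝ, 1 / (1 + τ) ≤ l ∧ ‖e‖ = 1 ∧ Q e = (l : ℂ) • e ∧
      ∀ w, inner ℂ e w = (0 : ℂ) → (inner ℂ (Q w) w).re ≤ 1 / (1 + τ) * ‖w‖ ^ 2 := by
  set θ : ℝ := 1 / (1 + τ) with hθ
  have hθ0 : 0 < θ := by positivity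
  have hsa := hQ.isSelfAdjoint
  -- An eigenvalue `λ < τ` of `A* A` is an eigenvalue `1/(1 + λ) > θ` of `Q`. The operator `B`
  -- replaces the spectral projection of `Q` on `(θ, ∞)`: it has the same kernel, and its function
  -- is continuous, as the functional calculus requires.
  set B : H →L[ℂ] H := cfc (cutAbove θ) Q with hB
  have hBsa : IsSelfAdjoint B := cfc_predicate _ _
  have hBsym : ∀ x y, inner ℂ (B x) y = inner ℂ x (B y) := fun x y =>
    (ContinuousLinearMap.isSelfAdjoint_iff_isSymmetric.1 hBsa) x y
  have hid : cfc (fun x : ℝ => x) Q = Q := cfc_id' ℝ Q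
  have hcc := continuous_cutAbove θ
  -- `Q ≤ θ + B`
  have h1 : ∀ w, (inner ℂ (Q w) w).re ≤ θ * ‖w‖ ^ 2 + (inner ℂ (B w) w).re := by
    intro w
    have e : cfc (fun x : ℝ => (θ + cutAbove θ x) - x) Q
        = (algebraMap ℝ (H →L[ℂ] H) θ + B) - Q := by
      rw [cfc_sub (fun x : ℝ => θ + cutAbove θ x) (fun x => x) Q (by fun_prop) (by fun_prop),
        cfc_add Q (fun _ : ℝ => θ) (cutAbove θ) (by fun_prop) (by fun_prop),
        cfc_const θ Q, hid]
    have := reInner_cfc_nonneg (Q := Q) (f := fun x : ℝ => (θ + cutAbove θ x) - x)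
      (fun x => by unfold cutAbove; linarith [le_max_left (x - θ) 0]) w
    rw [e] at this
    simp only [sub_apply, add_apply, inner_sub_left,
      inner_add_left, Complex.sub_re, Complex.add_re, Algebra.algebraMap_eq_smul_one,
      smul_apply, one_apply_eq_self] at this
    rw [re_inner_real_smul_self] at this
    linarith
  -- `Q ≥ θ` on the range of `B`
  have h2 : ∀ v, θ * ‖B v‖ ^ 2 ≤ (inner ℂ (Q (B v)) (B v)).re := by
    intro v
    have e : cfc (fun x : ℝ => cutAbove θ x * (x - θ) * cutAbove θ x) Q
        = B * (Q - algebraMap ℝ (H →L[ℂ] H) θ) * B := by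
      rw [cfc_mul (fun x : ℝ => cutAbove θ x * (x - θ)) (cutAbove θ) Q (by fun_prop) (by fun_prop),
        cfc_mul (cutAbove θ) (fun x : ℝ => x - θ) Q (by fun_prop) (by fun_prop),
        cfc_sub (fun x : ℝ => x) (fun _ => θ) Q (by fun_prop) (by fun_prop),
        cfc_const θ Q, hid]
    have := reInner_cfc_nonneg (Q := Q) (f := fun x : ℝ => cutAbove θ x * (x - θ) * cutAbove θ x)
      (fun x => by
        unfold cutAbove
        rcases le_total (x - θ) 0 with h | h
        · simp [max_eq_right h]
        · rw [max_eq_left h]; positivity) v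
    rw [e] at this
    simp only [mul_apply_eq_comp, hBsym, sub_apply, inner_sub_left,
      Complex.sub_re, Algebra.algebraMap_eq_smul_one,
      smul_apply, one_apply_eq_self] at this
    rw [re_inner_real_smul_self] at this
    linarith
  have hcomm : ∀ v, Q (B v) = B (Q v) := by
    intro v
    have : Commute Q B := (cfc_commute_cfc (fun x : ℝ => x) (cutAbove θ) Q).symm.symm |> fun h => by
      rwa [hid] at h
    exact DFunLike.congr_fun this v
  -- the range of `B` is at most one-dimensional
  have h3 : ∀ v v', ∃ c d : ℂ, (c ≠ 0 ∨ d ≠ 0) ∧ c • B v + d • B v' = 0 := by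
    intro v v'
    obtain ⟨g, hg, hg'⟩ := hQ (B v)
    obtain ⟨g', hgg, hgg'⟩ := hQ (B v')
    -- For this combination `w` the two-dimensional bound gives `⟨Q w, w⟩ ≥ (1 + s) ‖Q w‖²`, whereas
    -- `w` in the range of `B` gives `⟨Q w, w⟩ ≥ θ ‖w‖²`. If `w ≠ 0`, these yield `(1 + s) θ ≤ 1`,
    -- that is `s ≤ τ`.
    obtain ⟨c, d, hcd, hle⟩ := hG _ hg _ hgg
    refine ⟨c, d, hcd, ?_⟩
    have hw : c • B v + d • B v' = B (c • v + d • v') := by simp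
    set w := c • B v + d • B v' with hwdef
    have hsol : IsGraphSol G w (Q w) (c • g + d • g') := by
      refine ⟨?_, fun p hp => ?_⟩
      · have := G.add_mem (G.smul_mem c hg) (G.smul_mem d hgg)
        simpa [hwdef] using this
      · have a1 := hg' p hp
        have a2 := hgg' p hp
        simp only [hwdef, inner_add_right, inner_smul_right, map_add, map_smul]
        linear_combination c * a1 + d * a2
    have e1 : (inner ℂ (Q w) w).re = ‖Q w‖ ^ 2 + ‖c • g + d • g'‖ ^ 2 := by
      rw [hsol.2 _ hsol.1, inner_self_eq_norm_sq_to_K, inner_self_eq_norm_sq_to_K]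
      norm_cast
    have e2 : s * ‖Q w‖ ^ 2 ≤ ‖c • g + d • g'‖ ^ 2 := by
      simpa [hwdef] using hle
    have e3 : θ * ‖w‖ ^ 2 ≤ (inner ℂ (Q w) w).re := by rw [hw]; exact h2 _
    have e4 : (inner ℂ (Q w) w).re ≤ ‖Q w‖ * ‖w‖ :=
      (Complex.re_le_norm _).trans (norm_inner_le_norm _ _)
    by_contra hne
    have hpos : 0 < ‖w‖ := norm_pos_iff.2 hne
    have e5 : θ * ‖w‖ ≤ ‖Q w‖ := by
      have : θ * ‖w‖ * ‖w‖ ≤ ‖Q w‖ * ‖w‖ := by nlinarith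
      exact le_of_mul_le_mul_right this hpos
    have e6 : (1 + s) * ‖Q w‖ ≤ ‖w‖ := by
      have hq : 0 < ‖Q w‖ := lt_of_lt_of_le (by positivity) e5
      have : (1 + s) * ‖Q w‖ * ‖Q w‖ ≤ ‖w‖ * ‖Q w‖ := by nlinarith
      exact le_of_mul_le_mul_right this hq
    have e7 : (1 + s) * (θ * ‖w‖) ≤ ‖w‖ := le_trans (by gcongr; linarith) e6
    have e8 : (1 + s) * θ ≤ 1 := by
      have : (1 + s) * θ * ‖w‖ ≤ 1 * ‖w‖ := by linarith
      exact le_of_mul_le_mul_right this hpos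
    rw [hθ, mul_one_div, div_le_one (by linarith)] at e8
    linarith
  -- If `B = 0`, then `Q ≤ θ` everywhere. Otherwise the range of `B` is a line, and it consists of
  -- eigenvectors of `Q` because `Q` and `B` commute; on its orthogonal complement `B` vanishes.
  by_cases hB0 : ∀ v, B v = 0
  · left
    intro w
    have := h1 w
    rw [hB0 w] at this
    simpa using this
  · right
    push Not at hB0
    obtain ⟨v, hv⟩ := hB0
    have hn : (‖B v‖ : ℂ) ≠ 0 := by exact_mod_cast norm_ne_zero_iff.2 hv
    set e : H := ((‖B v‖ : ℂ)⁻¹) • B v with he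
    have heB : e = B (((‖B v‖ : ℂ)⁻¹) • v) := by simp [he]
    have hne : ‖e‖ = 1 := by
      rw [he, norm_smul, norm_inv, Complex.norm_real, norm_norm, inv_mul_cancel₀]
      exact norm_ne_zero_iff.2 hv
    have hspan : ∀ y, B y = (inner ℂ e (B y) : ℂ) • e := by
      intro y
      obtain ⟨c, d, hcd, h0⟩ := h3 (((‖B v‖ : ℂ)⁻¹) • v) y
      rw [← heB] at h0
      have hd : d ≠ 0 := by
        rintro rfl
        rcases hcd with hc | hc
        · simp only [zero_smul, add_zero, smul_eq_zero, hc, false_or] at h0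
          rw [h0] at hne
          simp at hne
        · exact hc rfl
      have h5 : B y = (-(d⁻¹ * c)) • e := by
        have : d • B y = -(c • e) := by rw [eq_neg_iff_add_eq_zero, add_comm]; exact h0
        calc B y = d⁻¹ • (d • B y) := by rw [smul_smul, inv_mul_cancel₀ hd, one_smul]
          _ = _ := by rw [this, smul_neg, smul_smul, neg_smul]
      rw [h5, inner_smul_right, inner_self_eq_norm_sq_to_K, hne]
      simp
    have hQe : Q e = (inner ℂ e (Q e) : ℂ) • e := by
      conv_lhs => rw [heB, hcomm, hspan]
      rw [← hcomm, ← heB]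
    have hre : (inner ℂ e (Q e) : ℂ) = (((inner ℂ (Q e) e).re : ℝ) : ℂ) := by
      obtain ⟨g, -, hg⟩ := hQ.inner_self e
      rw [← hQ.inner_comm, hg, Complex.ofReal_re]
    refine ⟨e, (inner ℂ (Q e) e).re, ?_, hne, ?_, ?_⟩
    · have := h2 (((‖B v‖ : ℂ)⁻¹) • v)
      rw [← heB, hne] at this
      simpa using this
    · rw [← hre]; exact hQe
    · intro w hw
      have : B w = 0 := by
        have h6 : inner ℂ e (B w) = (0 : ℂ) := by
          rw [← hBsym, hspan e, inner_smul_left, hw, mul_zero]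
        rw [hspan w, h6, zero_smul]
      have h7 := h1 w
      rw [this] at h7
      simpa using h7

end GraphResolvent
end

noncomputable section

/-! ### The bottom of the spectrum of `A* A`, truncated at `τ`. -/

section Bottom

open scoped InnerProductSpace

variable {H : Type} [NormedAddCommGroup H] [InnerProductSpace ℂ H]

/-- `μ` is the bottom of the spectrum of `A* A`, truncated at `τ`; if `μ < τ`, it is a simple
eigenvalue with normalized eigenvector `e`, and the rest of the spectrum lies above `τ`. -/
structure IsBottom (G : Submodule ℂ (H × H)) (Q : H →L[ℂ] H) (τ μ : ℝ) (e : H) : Prop where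
  nonneg : 0 ≤ μ
  le : μ ≤ τ
  bounded_below : ∀ t, 0 ≤ t → t < τ → ∀ w,
    min |1 - (1 + t) / (1 + μ)| ((τ - t) / (1 + τ)) * ‖w‖ ≤ ‖w - (1 + t) • Q w‖
  norm_eq_one : μ < τ → ‖e‖ = 1
  apply_eq : μ < τ → Q e = (1 / (1 + μ)) • e
  eq_smul : μ < τ → ∀ w, Q w = (1 / (1 + μ)) • w → w = (inner ℂ e w : ℂ) • e
  lower : ∀ p ∈ G, μ * ‖p.1‖ ^ 2 ≤ ‖p.2‖ ^ 2
  upper : ∀ r ≤ τ, (∀ p ∈ G, r * ‖p.1‖ ^ 2 ≤ ‖p.2‖ ^ 2) → r ≤ μ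

/-- Pairing with `w` and Cauchy–Schwarz. The operator `1 - (1 + t) Q` equals `(A* A - t) Q`, so
lower bounds for it lead to the resolvent at `t`. -/
theorem bounded_below_of_re_inner_le {Q : H →L[ℂ] H} {τ t : ℝ} (hτ : 0 ≤ τ) (ht : 0 ≤ t)
    {w : H} (h : (inner ℂ (Q w) w).re ≤ 1 / (1 + τ) * ‖w‖ ^ 2) :
    (τ - t) / (1 + τ) * ‖w‖ ≤ ‖w - (1 + t) • Q w‖ := by
  rcases eq_or_lt_of_le (norm_nonneg w) with hw | hw
  · rw [← hw, mul_zero]; positivity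
  have h1 : (inner ℂ (w - (1 + t) • Q w) w : ℂ).re
      = ‖w‖ ^ 2 - (1 + t) * (inner ℂ (Q w) w).re := by
    rw [inner_sub_left, Complex.sub_re, re_inner_self, ← Complex.coe_smul, inner_smul_left,
      Complex.conj_ofReal, Complex.re_ofReal_mul]
  have h2 : (inner ℂ (w - (1 + t) • Q w) w : ℂ).re ≤ ‖w - (1 + t) • Q w‖ * ‖w‖ :=
    (Complex.re_le_norm _).trans (norm_inner_le_norm _ _)
  have h3 : (τ - t) / (1 + τ) * ‖w‖ * ‖w‖ ≤ ‖w - (1 + t) • Q w‖ * ‖w‖ := by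
    refine le_trans ?_ h2
    rw [h1]
    have h4 : (τ - t) / (1 + τ) * ‖w‖ * ‖w‖ = ‖w‖ ^ 2 - (1 + t) * (1 / (1 + τ) * ‖w‖ ^ 2) := by
      have : 1 + τ ≠ 0 := by positivity
      field_simp
      ring
    rw [h4]
    gcongr
  exact le_of_mul_le_mul_right h3 hw

/-- When `exists_bottom` supplies an eigenvector with `Q e = l e`, one takes `μ = 1/l - 1` and
splits every `w` into its component along `e`, on which `Q` acts as `l`, and its orthogonal part, on
which `Q ≤ 1/(1 + τ)`. The splitting is preserved by `Q`. -/
theorem exists_isBottom [CompleteSpace H] {G : Submodule ℂ (H × H)} {Q : H →L[ℂ] H}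
    (hQ : IsGraphResolvent G Q) {s τ : ℝ} (hτ : 0 ≤ τ) (hs : τ < s)
    (hG : ∀ p ∈ G, ∀ q ∈ G, ∃ c d : ℂ, (c ≠ 0 ∨ d ≠ 0) ∧
      s * ‖c • p.1 + d • q.1‖ ^ 2 ≤ ‖c • p.2 + d • q.2‖ ^ 2) :
    ∃ μ e, IsBottom G Q τ μ e := by
  rcases exists_bottom hQ hτ hs hG with h | ⟨e, l, hl, he, hQe, h⟩
  -- No spectrum below `τ`: the truncated bottom is `τ`, and the default vector `0` is never used,
  -- since every clause about `e` presupposes `μ < τ`.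
  · refine ⟨τ, 0, hτ, le_rfl, fun t ht htτ w => ?_, fun h => absurd h (lt_irrefl _),
      fun h => absurd h (lt_irrefl _), fun h => absurd h (lt_irrefl _), ?_, fun r hr _ => hr⟩
    · exact (mul_le_mul_of_nonneg_right (min_le_right _ _) (norm_nonneg _)).trans
        (bounded_below_of_re_inner_le hτ ht (h w))
    · intro p hp
      have := hQ.le_of_inner_le (by positivity) h hp
      simpa using this
  · have hl0 : 0 < l := lt_of_lt_of_le (by positivity) hl
    have hl1 : l ≤ 1 := by
      have h1 := hQ.re_inner_le e
      rw [hQe, norm_smul, he, Complex.norm_real, Real.norm_of_nonneg hl0.le, Complex.coe_smul,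
        re_inner_real_smul_self, he] at h1
      nlinarith
    have hμl : 1 / (1 + (1 / l - 1)) = l := by field_simp; ring
    have hee : (inner ℂ e e : ℂ) = 1 := by rw [inner_self_eq_norm_sq_to_K, he]; simp
    have hdec : ∀ w, inner ℂ e (w - (inner ℂ e w : ℂ) • e) = (0 : ℂ) := by
      intro w
      rw [inner_sub_right, inner_smul_right, hee, mul_one, sub_self]
    have hperp : ∀ w, inner ℂ e w = (0 : ℂ) → inner ℂ e (Q w) = (0 : ℂ) := by
      intro w hw
      rw [← hQ.inner_comm, hQe, inner_smul_left, hw, mul_zero]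
    have hpyth : ∀ (a : ℂ) w, inner ℂ e w = (0 : ℂ) → ‖a • e + w‖ ^ 2 = ‖a‖ ^ 2 + ‖w‖ ^ 2 := by
      intro a w hw
      have : ‖a • e + w‖ * ‖a • e + w‖ = ‖a • e‖ * ‖a • e‖ + ‖w‖ * ‖w‖ :=
        norm_add_sq_eq_norm_sq_add_norm_sq_of_inner_eq_zero (𝕜 := ℂ) _ _
          (by rw [inner_smul_left, hw, mul_zero])
      rw [norm_smul, he, mul_one] at this
      nlinarith
    refine ⟨1 / l - 1, e, ?_, ?_, fun t ht htτ w => ?_, fun _ => he, fun _ => ?_, fun hlt w hw => ?_,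
      ?_, fun r hr hr' => ?_⟩
    · rw [sub_nonneg, le_div_iff₀ hl0]; linarith
    · rw [sub_le_iff_le_add, div_le_iff₀ hl0]
      rw [div_le_iff₀ (by linarith)] at hl
      linarith
    · set a : ℂ := inner ℂ e w
      set w' := w - a • e with hw'
      have hw0 : inner ℂ e w' = (0 : ℂ) := hdec w
      have e1 : w = a • e + w' := by rw [hw']; abel
      have e2 : w - (1 + t) • Q w
          = (((1 - (1 + t) * l : ℝ) : ℂ) * a) • e + (w' - (1 + t) • Q w') := by
        rw [e1, map_add, map_smul, hQe, ← Complex.coe_smul, ← Complex.coe_smul]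
        push_cast
        module
      have e3 : inner ℂ e (w' - (1 + t) • Q w') = (0 : ℂ) := by
        rw [inner_sub_right, hw0, ← Complex.coe_smul, inner_smul_right, hperp _ hw0]; simp
      have e4 := bounded_below_of_re_inner_le hτ ht (h w' hw0)
      have e5 : (1 + t) / (1 + (1 / l - 1)) = (1 + t) * l := by
        rw [div_eq_mul_one_div, hμl]
      rw [e5]
      set c := min |1 - (1 + t) * l| ((τ - t) / (1 + τ)) with hc
      have hc0 : 0 ≤ c := le_min (abs_nonneg _) (div_nonneg (by linarith) (by linarith))
      have e6 : (c * ‖w‖) ^ 2 ≤ ‖w - (1 + t) • Q w‖ ^ 2 := by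
        rw [e2, hpyth _ _ e3, mul_pow]
        conv_lhs => rw [e1, hpyth _ _ hw0]
        rw [norm_mul, Complex.norm_real, Real.norm_eq_abs, mul_pow, mul_add]
        have f1 : c ≤ |1 - (1 + t) * l| := min_le_left _ _
        have f2 : c * ‖w'‖ ≤ ‖w' - (1 + t) • Q w'‖ :=
          (mul_le_mul_of_nonneg_right (min_le_right _ _) (norm_nonneg _)).trans e4
        rw [← mul_pow c ‖w'‖]
        gcongr
      exact le_of_sq_le_sq e6 (norm_nonneg _)
    · rw [hμl, hQe, Complex.coe_smul]
    · set a : ℂ := inner ℂ e w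
      have hw0 : inner ℂ e (w - a • e) = (0 : ℂ) := hdec w
      rw [hμl] at hw
      have e1 : Q (w - a • e) = l • (w - a • e) := by
        rw [map_sub, map_smul, hQe, hw, ← Complex.coe_smul, ← Complex.coe_smul]
        module
      have e2 := h _ hw0
      rw [e1, re_inner_real_smul_self] at e2
      have e3 : 1 / (1 + τ) < l := by
        rw [div_lt_iff₀ (by linarith)]
        rw [sub_lt_iff_lt_add, div_lt_iff₀ hl0] at hlt
        linarith
      have e4 : ‖w - a • e‖ ^ 2 = 0 := by nlinarith [sq_nonneg ‖w - a • e‖]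
      have e5 : w - a • e = 0 := by simpa using e4
      exact sub_eq_zero.1 e5
    · intro p hp
      refine hQ.le_of_inner_le hl0 (fun w => ?_) hp
      set a : ℂ := inner ℂ e w
      set w' := w - a • e with hw'
      have hw0 : inner ℂ e w' = (0 : ℂ) := hdec w
      have e1 : w = a • e + w' := by rw [hw']; abel
      have e3 : (inner ℂ (Q w) w : ℂ) = ((l * ‖a‖ ^ 2 : ℝ) : ℂ) + inner ℂ (Q w') w' := by
        have g1 : inner ℂ (Q w') e = (0 : ℂ) := by
          rw [← inner_conj_symm, hperp _ hw0, map_zero]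
        conv_lhs => rw [e1]
        rw [map_add, map_smul, hQe]
        simp only [inner_add_left, inner_add_right, inner_smul_left, inner_smul_right, hw0, hee,
          g1, Complex.conj_ofReal, mul_zero, add_zero, zero_add, mul_one]
        push_cast
        rw [← Complex.mul_conj']
        ring
      rw [e3, Complex.add_re, Complex.ofReal_re]
      have e4 := h _ hw0
      conv_rhs => rw [e1, hpyth _ _ hw0]
      nlinarith [sq_nonneg ‖w'‖]
    -- The element of the graph above `Q e = l e` has `‖v‖² = l - l²`, so its Rayleigh quotient is
    -- exactly `1/l - 1` and no larger lower bound `r` is possible.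
    · obtain ⟨v, hv, hv'⟩ := hQ.inner_self e
      have h1 := hr' _ hv
      have h2 := congrArg Complex.re hv'
      rw [Complex.ofReal_re, hQe, Complex.coe_smul, re_inner_real_smul_self, he] at h2
      simp only [hQe, norm_smul, he, Complex.norm_real, Real.norm_of_nonneg hl0.le] at h1 h2
      rw [le_sub_iff_add_le, le_div_iff₀ hl0]
      nlinarith

end Bottom

/-! ## Orthogonal decompositions -/

section Fibers

open scoped InnerProductSpace

variable {H F ι : Type} [NormedAddCommGroup H] [InnerProductSpace ℂ H] [CompleteSpace H]
  [NormedAddCommGroup F] [InnerProductSpace ℂ F] [CompleteSpace F]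

/-- The adjoint of the embedding of a fiber. -/
def coord (V : ι → F →ₗᵢ[ℂ] H) (k : ι) : H →L[ℂ] F :=
  ContinuousLinearMap.adjoint (V k).toContinuousLinearMap

variable {V : ι → F →ₗᵢ[ℂ] H}

theorem inner_coord (k : ι) (f : F) (u : H) : inner ℂ f (coord V k u) = (inner ℂ (V k f) u : ℂ) := by
  rw [coord, ContinuousLinearMap.adjoint_inner_right]; rfl

theorem inner_coord_left (k : ι) (f : F) (u : H) :
    inner ℂ (coord V k u) f = (inner ℂ u (V k f) : ℂ) := by
  rw [coord, ContinuousLinearMap.adjoint_inner_left]; rfl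

theorem coord_self (k : ι) (f : F) : coord V k (V k f) = f := by
  refine ext_inner_left ℂ fun g => ?_
  rw [inner_coord, LinearIsometry.inner_map_map]

theorem coord_of_ne (hV : OrthogonalFamily ℂ (fun _ : ι => F) V) {k l : ι} (hkl : k ≠ l) (f : F) :
    coord V k (V l f) = 0 := by
  refine ext_inner_left ℂ fun g => ?_
  rw [inner_coord, hV hkl, inner_zero_right]

theorem isHilbertSum_of_total (hV : OrthogonalFamily ℂ (fun _ : ι => F) V)
    (ht : ∀ u, (∀ k, coord V k u = 0) → u = 0) : IsHilbertSum ℂ (fun _ : ι => F) V := by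
  refine IsHilbertSum.mk hV ?_
  rw [top_le_iff, Submodule.topologicalClosure_eq_top_iff, Submodule.eq_bot_iff]
  intro u hu
  refine ht u fun k => ?_
  refine ext_inner_left ℂ fun g => ?_
  rw [inner_coord, inner_zero_right]
  exact (Submodule.mem_orthogonal _ _).1 hu _
    (Submodule.mem_iSup_of_mem k (LinearMap.mem_range_self _ g))

/-- Parseval's identity, transported from the `ℓ²` sum of the fibers by the isometry which the
orthogonality and totality of the family provide. -/
theorem hasSum_norm_coord (hV : OrthogonalFamily ℂ (fun _ : ι => F) V)
    (ht : ∀ u, (∀ k, coord V k u = 0) → u = 0) (u : H) :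
    HasSum (fun k => ‖coord V k u‖ ^ 2) (‖u‖ ^ 2) := by
  classical
  have hS := isHilbertSum_of_total hV ht
  set x := hS.linearIsometryEquiv u with hx
  have hu : u = hS.linearIsometryEquiv.symm x := by rw [hx, LinearIsometryEquiv.symm_apply_apply]
  have h1 := hS.hasSum_linearIsometryEquiv_symm x
  rw [← hu] at h1
  have h2 : ∀ k, coord V k u = x k := by
    intro k
    have h3 := h1.mapL (coord V k)
    have h4 : HasSum (fun l => coord V k (V l (x l))) (x k) := by
      have := hasSum_ite_eq k (x k)
      refine this.congr_fun ?_ |> fun h => h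
      intro l
      by_cases hl : l = k
      · subst hl; simp [coord_self]
      · simp [hl, coord_of_ne hV (Ne.symm hl)]
    exact h3.unique h4
  have h5 := lp.hasSum_norm (p := 2) (by norm_num) x
  have h6 : ‖x‖ = ‖u‖ := by rw [hx, LinearIsometryEquiv.norm_map]
  rw [h6] at h5
  simpa [h2] using h5

theorem bounded_below_of_coord (hV : OrthogonalFamily ℂ (fun _ : ι => F) V)
    (ht : ∀ u, (∀ k, coord V k u = 0) → u = 0) {c : ℝ} (hc : 0 ≤ c) {u v : H}
    (h : ∀ k, c * ‖coord V k u‖ ≤ ‖coord V k v‖) : c * ‖u‖ ≤ ‖v‖ := by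
  have h1 := (hasSum_norm_coord hV ht u).mul_left (c ^ 2)
  have h2 := hasSum_norm_coord hV ht v
  have h3 : c ^ 2 * ‖u‖ ^ 2 ≤ ‖v‖ ^ 2 := hasSum_le (fun k => by
    rw [← mul_pow]; gcongr; exact h k) h1 h2
  rw [← mul_pow] at h3
  exact le_of_sq_le_sq h3 (norm_nonneg _)

/-- The part of the graph `G` in the fiber `k`. -/
def fiberGraph (G : Submodule ℂ (H × H)) (V : ι → F →ₗᵢ[ℂ] H) (k : ι) : Submodule ℂ (F × F) :=
  G.comap (LinearMap.prodMap (V k).toLinearMap (V k).toLinearMap)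

omit [CompleteSpace H] [CompleteSpace F] in
theorem mem_fiberGraph {G : Submodule ℂ (H × H)} {k : ι} {p : F × F} :
    p ∈ fiberGraph G V k ↔ (V k p.1, V k p.2) ∈ G := Iff.rfl

/-- The component of an operator in the fiber `k`. -/
def fiberOp (Q : H →L[ℂ] H) (V : ι → F →ₗᵢ[ℂ] H) (k : ι) : F →L[ℂ] F :=
  (coord V k).comp (Q.comp (V k).toContinuousLinearMap)

variable {G : Submodule ℂ (H × H)} {Q : H →L[ℂ] H}

theorem fiberOp_apply (k : ι) (f : F) : fiberOp Q V k f = coord V k (Q (V k f)) := rfl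

theorem IsGraphResolvent.fiber (hQ : IsGraphResolvent G Q)
    (hred : ∀ p ∈ G, ∀ k, (V k (coord V k p.1), V k (coord V k p.2)) ∈ G) (k : ι) :
    IsGraphResolvent (fiberGraph G V k) (fiberOp Q V k) := by
  intro w
  obtain ⟨v, hv, h⟩ := hQ (V k w)
  refine ⟨coord V k v, hred _ hv k, fun p hp => ?_⟩
  have : (inner ℂ (V k p.1) (V k w) : ℂ)
      = inner ℂ (V k p.1) (Q (V k w)) + inner ℂ (V k p.2) v := h _ hp
  rw [fiberOp_apply, inner_coord, inner_coord, ← this, LinearIsometry.inner_map_map]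

/-- The image under `V k` of the fiber solution also solves the full problem, because testing it
against `p` only sees the `k`-th component of `p`. Uniqueness of the solution concludes. -/
theorem IsGraphResolvent.apply_fiber (hQ : IsGraphResolvent G Q)
    (hred : ∀ p ∈ G, ∀ k, (V k (coord V k p.1), V k (coord V k p.2)) ∈ G) (k : ι) (f : F) :
    Q (V k f) = V k (fiberOp Q V k f) := by
  obtain ⟨v, hv, h⟩ := hQ (V k f)
  have h1 : IsGraphSol G (V k f) (V k (fiberOp Q V k f)) (V k (coord V k v)) := by
    refine ⟨hred _ hv k, fun p hp => ?_⟩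
    have := h _ (hred _ hp k)
    simp only at this
    rw [LinearIsometry.inner_map_map, inner_coord_left] at this
    rw [this, ← inner_coord_left, ← inner_coord_left, fiberOp_apply, inner_coord, inner_coord]
  exact (IsGraphSol.unique ⟨hv, h⟩ h1).1

theorem IsGraphResolvent.coord_apply (hQ : IsGraphResolvent G Q)
    (hred : ∀ p ∈ G, ∀ k, (V k (coord V k p.1), V k (coord V k p.2)) ∈ G) (k : ι) (u : H) :
    coord V k (Q u) = fiberOp Q V k (coord V k u) := by
  refine ext_inner_left ℂ fun g => ?_
  rw [inner_coord, ← hQ.inner_comm, hQ.apply_fiber hred, ← inner_coord,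
    (hQ.fiber hred k).inner_comm]

end Fibers
end

noncomputable section

/-! ### The spectrum of an orthogonal sum of fibers. -/

section Spectrum

open scoped InnerProductSpace

variable {H : Type} [NormedAddCommGroup H] [InnerProductSpace ℂ H] [CompleteSpace H]

/-- `u ∈ D(A* A)` and `A* A u = z`, in terms of the graph of `A`. -/
theorem unboundedComp_adjoint_apply_iff {A : H →ₗ.[ℂ] H} (hd : Dense (A.domain : Set H))
    (u z : H) : (∃ hu : u ∈ (unboundedComp (A†) A).domain, unboundedComp (A†) A ⟨u, hu⟩ = z) ↔
      ∃ v, IsGraphSol A.graph (u + z) u v := by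
  have hgraph : ∀ v y : H, (v, y) ∈ (A†).graph ↔
      ∀ p ∈ A.graph, inner ℂ p.1 y = (inner ℂ p.2 v : ℂ) := by
    intro v y
    rw [LinearPMap.adjoint_graph_eq_graph_adjoint hd, Submodule.mem_adjoint_iff]
    constructor
    · intro h p hp
      exact (sub_eq_zero.1 (h p.1 p.2 hp)).symm
    · intro h a b hab
      exact sub_eq_zero.2 (h _ hab).symm
  have hsol : ∀ v, IsGraphSol A.graph (u + z) u v ↔ (u, v) ∈ A.graph ∧ (v, z) ∈ (A†).graph := by
    intro v
    rw [IsGraphSol, hgraph]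
    simp only [inner_add_right, add_right_inj]
  simp only [hsol]
  constructor
  · rintro ⟨hu, rfl⟩
    have hu' := hu
    obtain ⟨⟨y, hy, hyx⟩, hxf⟩ := hu'
    have e : y = ⟨u, hxf⟩ := Subtype.ext hyx
    subst e
    refine ⟨A ⟨u, hxf⟩, A.mem_graph ⟨u, hxf⟩, ?_⟩
    exact (A†).mem_graph ⟨A ⟨u, hxf⟩, hy⟩
  · rintro ⟨v, h1, h2⟩
    obtain ⟨x, hx, hxv⟩ := A.mem_graph_iff.1 h1
    obtain ⟨y, hy, hyz⟩ := (A†).mem_graph_iff.1 h2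
    simp only at hx hxv hy hyz
    subst hx hxv
    have hm : (x : H) ∈ (unboundedComp (A†) A).domain := by
      refine ⟨⟨x, ?_, rfl⟩, x.2⟩
      change A x ∈ (A†).domain
      rw [← hy]; exact y.2
    refine ⟨hm, ?_⟩
    rw [← hyz]
    change (A†) ⟨A ⟨(x : H), _⟩, _⟩ = _
    congr 1
    exact Subtype.ext hy.symm

/-- A bounded self-adjoint operator which is bounded below is invertible. -/
theorem exists_inverse_of_bounded_below {N : H →L[ℂ] H} (hN : IsSelfAdjoint N) {c : ℝ}
    (hc : 0 < c) (h : ∀ w, c * ‖w‖ ≤ ‖N w‖) :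
    ∃ S : H →L[ℂ] H, (∀ w, N (S w) = w) ∧ ∀ w, S (N w) = w := by
  have hanti : AntilipschitzWith (Real.toNNReal c⁻¹) N :=
    ContinuousLinearMap.antilipschitz_of_bound N fun w => by
      rw [Real.coe_toNNReal _ (by positivity), inv_mul_eq_div, le_div_iff₀ hc, mul_comm]
      exact h w
  have hinj := hanti.injective
  have hcl : IsClosed (LinearMap.range (N : H →ₗ[ℂ] H) : Set H) :=
    hanti.isClosed_range N.uniformContinuous
  have hker : LinearMap.ker (N : H →ₗ[ℂ] H) = ⊥ := LinearMap.ker_eq_bot.2 hinj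
  have hrange : LinearMap.range (N : H →ₗ[ℂ] H) = ⊤ := by
    have : CompleteSpace (LinearMap.range (N : H →ₗ[ℂ] H)) := hcl.completeSpace_coe
    rw [← Submodule.orthogonal_eq_bot_iff, Submodule.eq_bot_iff]
    intro y hy
    have h1 : ∀ x, inner ℂ x (N y) = (0 : ℂ) := by
      intro x
      have h2 := (Submodule.mem_orthogonal _ _).1 hy (N x) (LinearMap.mem_range_self _ x)
      have h3 := (ContinuousLinearMap.isSelfAdjoint_iff_isSymmetric.1 hN) x y
      exact h3.symm.trans h2
    have h4 : N y = 0 := by simpa using h1 (N y)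
    exact hinj (h4.trans (map_zero N).symm)
  let E := ContinuousLinearEquiv.ofBijective N hker hrange
  refine ⟨(E.symm : H →L[ℂ] H), fun w => ?_, fun w => ?_⟩
  · exact ContinuousLinearEquiv.ofBijective_apply_symm_apply N hker hrange w
  · exact ContinuousLinearEquiv.ofBijective_symm_apply_apply N hker hrange w

variable {F ι : Type} [NormedAddCommGroup F] [InnerProductSpace ℂ F] [CompleteSpace F]
  {V : ι → F →ₗᵢ[ℂ] H} {G : Submodule ℂ (H × H)} {Q : H →L[ℂ] H}

/-- Hypotheses on an operator `T = A* A` (`G` is the graph of `A`, and `Q = (1 + T)⁻¹`) which is an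
orthogonal sum of operators whose spectra below `τ` consist of one simple eigenvalue `μ k`. -/
structure IsFibered (T : H →ₗ.[ℂ] H) (G : Submodule ℂ (H × H)) (Q : H →L[ℂ] H)
    (V : ι → F →ₗᵢ[ℂ] H) (τ : ℝ) (μ : ι → ℝ) (e : ι → F) : Prop where
  apply_iff : ∀ u z, (∃ hu : u ∈ T.domain, T ⟨u, hu⟩ = z) ↔ Q (u + z) = u
  resolvent : IsGraphResolvent G Q
  ortho : OrthogonalFamily ℂ (fun _ : ι => F) V
  total : ∀ u, (∀ k, coord V k u = 0) → u = 0
  red : ∀ p ∈ G, ∀ k, (V k (coord V k p.1), V k (coord V k p.2)) ∈ G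
  bottom : ∀ k, IsBottom (fiberGraph G V k) (fiberOp Q V k) τ (μ k) (e k)

namespace IsFibered

variable {T : H →ₗ.[ℂ] H} {τ : ℝ} {μ : ι → ℝ} {e : ι → F}

/-- With `N = 1 - (1 + t) Q = (T - t) Q` the resolvent is `N⁻¹ Q`. Invertibility of the self-adjoint
`N` needs a lower bound that is uniform in `k`, and this is what the distance `d` provides. -/
theorem mem_resolventSet (h : IsFibered T G Q V τ μ e) {t d : ℝ} (ht : 0 ≤ t) (htτ : t < τ)
    (hd : 0 < d) (hμ : ∀ k, d ≤ |μ k - t|) : (t : ℂ) ∈ unboundedResolventSet T := by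
  let N : H →L[ℂ] H := 1 - (1 + t : ℝ) • Q
  have hNa : ∀ w, N w = w - (1 + t : ℝ) • Q w := fun w => rfl
  have hN : IsSelfAdjoint N := by
    refine IsSelfAdjoint.sub (IsSelfAdjoint.one _) ?_
    exact (IsSelfAdjoint.all (1 + t : ℝ)).smul h.resolvent.isSelfAdjoint
  set c : ℝ := min (d / (1 + τ)) ((τ - t) / (1 + τ)) with hc
  have hτ : 0 < 1 + τ := by linarith
  have hc0 : 0 < c := lt_min (by positivity) (div_pos (by linarith) hτ)
  have hb : ∀ w, c * ‖w‖ ≤ ‖N w‖ := by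
    intro w
    refine bounded_below_of_coord h.ortho h.total hc0.le fun k => ?_
    rw [hNa, map_sub, ← Complex.coe_smul, map_smul, h.resolvent.coord_apply h.red,
      Complex.coe_smul]
    refine le_trans ?_ ((h.bottom k).bounded_below t ht htτ _)
    refine mul_le_mul_of_nonneg_right (min_le_min ?_ le_rfl) (norm_nonneg _)
    have h0 : 0 < 1 + μ k := by linarith [(h.bottom k).nonneg]
    have h1 : 1 - (1 + t) / (1 + μ k) = (μ k - t) / (1 + μ k) := by field_simp; ring
    rw [h1, abs_div, abs_of_pos h0]
    have := (h.bottom k).le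
    exact div_le_div₀ (abs_nonneg _) (hμ k) h0 (by linarith)
  obtain ⟨S, hS1, hS2⟩ := exists_inverse_of_bounded_below hN hc0 hb
  refine ⟨S.comp Q, fun v => ?_, fun u => ?_⟩
  · set r : H := S (Q v) with hr
    have h1 : r - (1 + t : ℝ) • Q r = Q v := by rw [← hNa, hr, hS1]
    have h2 : Q (r + (v + (t : ℂ) • r)) = r := by
      rw [map_add, map_add, map_smul, ← h1, Complex.coe_smul, add_smul, one_smul]
      abel
    obtain ⟨hu, hT⟩ := (h.apply_iff _ _).2 h2
    refine ⟨hu, ?_⟩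
    change T ⟨r, hu⟩ - (t : ℂ) • r = v
    rw [hT, add_sub_cancel_right]
  · have h1 := (h.apply_iff u (T u)).1 ⟨u.2, rfl⟩
    have h2 : Q (T u - (t : ℂ) • (u : H)) = N u := by
      rw [map_add] at h1
      rw [map_sub, map_smul, hNa, ← eq_sub_iff_add_eq'.2 h1 |>.symm, Complex.coe_smul, add_smul,
        one_smul]
      abel
    rw [ContinuousLinearMap.comp_apply, h2, hS2]

theorem apply_eq_smul_iff (h : IsFibered T G Q V τ μ e) {t : ℝ} (ht : 0 ≤ t) (u : H) :
    (∃ hu : u ∈ T.domain, T ⟨u, hu⟩ = (t : ℂ) • u) ↔ Q u = (1 / (1 + t)) • u := by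
  rw [h.apply_iff, map_add, map_smul, Complex.coe_smul]
  have h0 : (1 + t) ≠ 0 := by positivity
  have h1 : Q u + t • Q u = (1 + t) • Q u := by rw [add_smul, one_smul]
  rw [h1, one_div, eq_inv_smul_iff₀ h0]

/-- The eigenspaces are spanned by the eigenvectors of the fibers. -/
theorem map_eigenspace (h : IsFibered T G Q V τ μ e) {t : ℝ} (ht : 0 ≤ t) (htτ : t < τ)
    {K : Finset ι} (hK : ∀ k, k ∈ K ↔ μ k = t) :
    (unboundedEigenspace T (t : ℂ)).map T.domain.subtype
      = Submodule.span ℂ (Set.range fun k : K => V k (e k)) := by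
  have hmem : ∀ u : H, u ∈ (unboundedEigenspace T (t : ℂ)).map T.domain.subtype ↔
      Q u = (1 / (1 + t)) • u := by
    intro u
    rw [← h.apply_eq_smul_iff ht]
    constructor
    · rintro ⟨x, hx, rfl⟩
      refine ⟨x.2, ?_⟩
      exact sub_eq_zero.1 (LinearMap.mem_ker.1 hx)
    · rintro ⟨hu, hT⟩
      exact ⟨⟨u, hu⟩, LinearMap.mem_ker.2 (sub_eq_zero.2 hT), rfl⟩
  apply le_antisymm
  · intro u hu
    rw [hmem] at hu
    have h1 : ∀ k, fiberOp Q V k (coord V k u) = (1 / (1 + t)) • coord V k u := by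
      intro k
      rw [← h.resolvent.coord_apply h.red, hu, ← Complex.coe_smul, map_smul, Complex.coe_smul]
    have h2 : ∀ k, k ∉ K → coord V k u = 0 := by
      intro k hk
      rw [hK] at hk
      have h3 := (h.bottom k).bounded_below t ht htτ (coord V k u)
      rw [h1, smul_smul, mul_one_div, div_self (by positivity), one_smul, sub_self,
        norm_zero] at h3
      have h0 : 0 < 1 + μ k := by linarith [(h.bottom k).nonneg]
      have h4 : 0 < min |1 - (1 + t) / (1 + μ k)| ((τ - t) / (1 + τ)) := by
        refine lt_min (abs_pos.2 ?_) (div_pos (by linarith) (by linarith))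
        intro h5
        apply hk
        rw [sub_eq_zero, eq_div_iff h0.ne'] at h5
        linarith
      have h5 : ‖coord V k u‖ ≤ 0 := by
        by_contra hcon
        push Not at hcon
        nlinarith
      exact norm_le_zero_iff.1 h5
    have h3 : u = ∑ k ∈ K, V k (coord V k u) := by
      rw [← sub_eq_zero]
      refine h.total _ fun l => ?_
      rw [map_sub, map_sum]
      by_cases hl : l ∈ K
      · rw [Finset.sum_eq_single l (fun k _ hkl => coord_of_ne h.ortho (Ne.symm hkl) _)
          (fun hh => absurd hl hh), coord_self, sub_self]
      · rw [h2 l hl, Finset.sum_eq_zero fun k hk => coord_of_ne h.ortho (by rintro rfl; exact hl hk) _,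
          sub_self]
    rw [h3]
    refine Submodule.sum_mem _ fun k hk => ?_
    have hk' := (hK k).1 hk
    have h4 := (h.bottom k).eq_smul (by rw [hk']; exact htτ) (coord V k u) (by rw [h1, hk'])
    rw [h4, map_smul]
    exact Submodule.smul_mem _ _ (Submodule.subset_span ⟨⟨k, hk⟩, rfl⟩)
  · rw [Submodule.span_le]
    rintro _ ⟨⟨k, hk⟩, rfl⟩
    have hk' := (hK k).1 hk
    refine (hmem _).2 ?_
    rw [h.resolvent.apply_fiber h.red, (h.bottom k).apply_eq (by rw [hk']; exact htτ), hk',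
      ← Complex.coe_smul, map_smul, Complex.coe_smul]

theorem orthonormal (h : IsFibered T G Q V τ μ e) {K : Finset ι} (hK : ∀ k ∈ K, μ k < τ) :
    Orthonormal ℂ (fun k : K => V k (e k)) := by
  constructor
  · intro k
    rw [LinearIsometry.norm_map]
    exact (h.bottom k).norm_eq_one (hK k k.2)
  · intro k l hkl
    exact h.ortho (fun hh => hkl (Subtype.ext hh)) _ _

theorem finrank_eigenspace (h : IsFibered T G Q V τ μ e) {t : ℝ} (ht : 0 ≤ t) (htτ : t < τ)
    {K : Finset ι} (hK : ∀ k, k ∈ K ↔ μ k = t) :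
    FiniteDimensional ℂ (unboundedEigenspace T (t : ℂ)) ∧
      Module.finrank ℂ (unboundedEigenspace T (t : ℂ)) = K.card := by
  have h1 := h.map_eigenspace ht htτ hK
  have h2 := Submodule.equivMapOfInjective T.domain.subtype T.domain.subtype_injective
    (unboundedEigenspace T (t : ℂ))
  have h3 : FiniteDimensional ℂ ((unboundedEigenspace T (t : ℂ)).map T.domain.subtype) := by
    rw [h1]
    exact FiniteDimensional.span_of_finite ℂ (Set.finite_range _)
  refine ⟨h2.symm.finiteDimensional, ?_⟩
  rw [h2.finrank_eq, h1, finrank_span_eq_card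
    (h.orthonormal fun k hk => by rw [(hK k).1 hk]; exact htτ).linearIndependent]
  simp

/-- A point of the window which is no `μ k` keeps a positive distance from all of them: only
finitely many `μ k` lie in `(r, τ)`, and the others are at distance at least `min (t₀ - r) (τ -
t₁)`. Without the margin `r < t₀` the values could accumulate at `t₀` from below. The multiplicity
of an eigenvalue is the number of modes that share it, so the sum over eigenvalues is the number of
modes. -/
theorem spectrum_and_count (h : IsFibered T G Q V τ μ e) {t₀ t₁ r : ℝ} (ht₀ : 0 ≤ t₀)
    (ht₁ : t₁ < τ) (hr : r < t₀) (hfin : {k | r < μ k ∧ μ k < τ}.Finite) :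
    HasDiscreteSpectrumIn T (Icc t₀ t₁) ∧
      spectrumCount T (Icc t₀ t₁) = {k | μ k ∈ Icc t₀ t₁}.ncard := by
  classical
  have hKf : {k | μ k ∈ Icc t₀ t₁}.Finite :=
    hfin.subset fun k hk => ⟨hr.trans_le hk.1, hk.2.trans_lt ht₁⟩
  have hK : ∀ t ∈ Icc t₀ t₁, ∀ k, k ∈ hKf.toFinset.filter (fun k => μ k = t) ↔ μ k = t := by
    intro t ht k
    simp only [Finset.mem_filter, Set.Finite.mem_toFinset, mem_ofPred_eq, and_iff_right_iff_imp]
    rintro rfl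
    exact ht
  have hfr := fun t (ht : t ∈ Icc t₀ t₁) =>
    h.finrank_eigenspace (ht₀.trans ht.1) (ht.2.trans_lt ht₁) (hK t ht)
  have hspec : spectrumIn T (Icc t₀ t₁) = (hKf.toFinset.image μ : Finset ℝ) := by
    ext t
    simp only [spectrumIn, mem_ofPred_eq, Finset.coe_image, Set.Finite.coe_toFinset, mem_image]
    constructor
    · rintro ⟨ht, hs⟩
      by_contra hcon
      push Not at hcon
      apply hs
      have hS : IsClosed (μ '' {k | r < μ k ∧ μ k < τ}) := (hfin.image μ).isClosed
      have hnot : t ∈ (μ '' {k | r < μ k ∧ μ k < τ})ᶜ := by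
        rintro ⟨k, -, hk⟩
        exact hcon k (by rw [hk]; exact ht) hk
      obtain ⟨ε, hε, hball⟩ := Metric.isOpen_iff.1 hS.isOpen_compl t hnot
      have hd : 0 < min ε (min (t₀ - r) (τ - t₁)) :=
        lt_min hε (lt_min (by linarith) (by linarith))
      refine h.mem_resolventSet (ht₀.trans ht.1) (ht.2.trans_lt ht₁) hd fun k => ?_
      by_cases h1 : r < μ k ∧ μ k < τ
      · refine (min_le_left _ _).trans ?_
        by_contra hlt
        push Not at hlt
        exact hball (by rwa [Metric.mem_ball, Real.dist_eq]) ⟨k, h1, rfl⟩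
      · refine (min_le_right _ _).trans ?_
        by_cases h2 : r < μ k
        · have h3 : τ ≤ μ k := not_lt.1 fun h3 => h1 ⟨h2, h3⟩
          exact (min_le_right _ _).trans (le_trans (by linarith [ht.2]) (le_abs_self _))
        · push Not at h2
          exact (min_le_left _ _).trans (le_trans (by linarith [ht.1]) (neg_le_abs _))
    · rintro ⟨k, hk, rfl⟩
      refine ⟨hk, ?_⟩
      rintro ⟨R, -, hR⟩
      have hkτ : μ k < τ := hk.2.trans_lt ht₁
      have hQ : Q (V k (e k)) = (1 / (1 + μ k)) • V k (e k) := by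
        rw [h.resolvent.apply_fiber h.red, (h.bottom k).apply_eq hkτ,
          ← Complex.coe_smul, map_smul, Complex.coe_smul]
      obtain ⟨hu, hT⟩ := (h.apply_eq_smul_iff (h.bottom k).nonneg _).2 hQ
      have h1 := hR ⟨_, hu⟩
      rw [hT, sub_self, map_zero] at h1
      have h2 : ‖V k (e k)‖ = 1 := by
        rw [LinearIsometry.norm_map]; exact (h.bottom k).norm_eq_one hkτ
      have h3 : V k (e k) = 0 := h1.symm
      rw [h3, norm_zero] at h2
      exact zero_ne_one h2
  refine ⟨⟨by rw [hspec]; exact Finset.finite_toSet _, fun t ht => ?_⟩, ?_⟩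
  · have htI := ht.1
    refine ⟨?_, (hfr t htI).1⟩
    rw [hspec] at ht
    simp only [Finset.coe_image, Set.Finite.coe_toFinset, mem_image] at ht
    obtain ⟨k, -, hkt⟩ := ht
    intro hbot
    have h1 := (hfr t htI).2
    rw [hbot, finrank_bot] at h1
    have h2 := (hK t htI k).2 hkt
    rw [Finset.card_eq_zero.1 h1.symm] at h2
    exact absurd h2 (Finset.notMem_empty _)
  · rw [spectrumCount, hspec, finsum_mem_coe_finset, Set.ncard_eq_toFinset_card _ hKf,
      Finset.card_eq_sum_card_image μ]
    refine Finset.sum_congr rfl fun t ht => ?_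
    obtain ⟨k, hk, rfl⟩ := Finset.mem_image.1 ht
    exact (hfr _ ((Set.Finite.mem_toFinset hKf).1 hk)).2

end IsFibered

end Spectrum
end

noncomputable section

/-! ## Fourier series in the variable `x` -/

section FourierFibers

open scoped InnerProductSpace ENNReal

/-- The normalized character `(2π)^{-1/2} e^{ikx}` of the circle. -/
def chr (k : ℤ) (x : S1) : ℂ := ((Real.sqrt (2 * Real.pi))⁻¹ : ℝ) * fourier k x

theorem continuous_chr (k : ℤ) : Continuous (chr k) :=
  continuous_const.mul (fourier k).continuous

theorem chr_toS1 (k : ℤ) (s : ℝ) :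
    chr k (toS1 s) = ((Real.sqrt (2 * Real.pi))⁻¹ : ℝ) * Complex.exp (Complex.I * k * s) := by
  have h : (fourier k : C(S1, ℂ)) (toS1 s) = Complex.exp (Complex.I * k * s) := by
    have := fourier_coe_apply (T := 2 * Real.pi) (n := k) (x := s)
    refine this.trans ?_
    congr 1
    have : (Real.pi : ℂ) ≠ 0 := by exact_mod_cast Real.pi_ne_zero
    push_cast
    field_simp
  rw [chr, h]

theorem conj_chr (k : ℤ) (x : S1) : (starRingEnd ℂ) (chr k x) = chr (-k) x := by
  rw [chr, chr, map_mul, Complex.conj_ofReal, fourier_neg]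

theorem norm_chr (k : ℤ) (x : S1) : ‖chr k x‖ = (Real.sqrt (2 * Real.pi))⁻¹ := by
  rw [chr, norm_mul, Complex.norm_real, fourier_apply, Circle.norm_coe, mul_one,
    Real.norm_of_nonneg (by positivity)]

theorem integral_chr_mul_chr (k l : ℤ) :
    ∫ x : S1, (starRingEnd ℂ) (chr k x) * chr l x = if k = l then 1 else 0 := by
  have h1 := orthonormal_iff_ite.1 (orthonormal_fourier (T := 2 * Real.pi)) k l
  rw [L2.inner_def] at h1
  have h2 : ∫ x : S1, (starRingEnd ℂ) ((fourier k : C(S1, ℂ)) x) * (fourier l : C(S1, ℂ)) x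
        ∂AddCircle.haarAddCircle = if k = l then 1 else 0 := by
    rw [← h1]
    refine integral_congr_ae ?_
    filter_upwards [coeFn_fourierLp (T := 2 * Real.pi) 2 k, coeFn_fourierLp (T := 2 * Real.pi) 2 l]
      with x hx hy
    rw [hx, hy, RCLike.inner_apply, mul_comm]
  rw [AddCircle.integral_haarAddCircle] at h2
  have h3 : ∀ x : S1, (starRingEnd ℂ) (chr k x) * chr l x = ((2 * Real.pi)⁻¹ : ℝ) •
      ((starRingEnd ℂ) ((fourier k : C(S1, ℂ)) x) * (fourier l : C(S1, ℂ)) x) := by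
    intro x
    rw [chr, chr, map_mul, Complex.conj_ofReal, ← Complex.coe_smul, smul_eq_mul]
    have : ((2 * Real.pi)⁻¹ : ℝ) = (Real.sqrt (2 * Real.pi))⁻¹ * (Real.sqrt (2 * Real.pi))⁻¹ := by
      rw [← mul_inv, Real.mul_self_sqrt Real.two_pi_pos.le]
    rw [this]
    push_cast
    ring
  simp_rw [h3]
  rw [integral_smul, h2]

variable {Y : Type} [MeasureSpace Y] [SigmaFinite (volume : Measure Y)]

theorem memLp_chr_mul (k : ℤ) {f : Y → ℂ} (hf : MemLp f 2 volume) :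
    MemLp (fun q : S1 × Y => chr k q.1 * f q.2) 2 volume := by
  have h1 : MemLp (fun q : S1 × Y => f q.2) 2 volume := hf.comp_snd volume
  refine h1.of_le_mul (c := (Real.sqrt (2 * Real.pi))⁻¹) ?_ ?_
  · exact ((continuous_chr k).measurable.comp measurable_fst).aestronglyMeasurable.mul h1.1
  · refine Filter.Eventually.of_forall fun q => ?_
    rw [norm_mul, norm_chr]

/-- The function `(2π)^{-1/2} e^{ikx} f(y)`, as an element of `L²`. -/
def tensorLp (k : ℤ) (f : Lp ℂ 2 (volume : Measure Y)) : Lp ℂ 2 (volume : Measure (S1 × Y)) :=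
  (memLp_chr_mul k (Lp.memLp f)).toLp _

theorem integral_prod_vol_symm {E : Type} [NormedAddCommGroup E] [NormedSpace ℝ E]
    {g : S1 × Y → E} (hg : Integrable g volume) : ∫ q, g q = ∫ y, ∫ x, g (x, y) :=
  integral_prod_symm g hg

theorem integral_prod_vol {E : Type} [NormedAddCommGroup E] [NormedSpace ℝ E]
    {g : S1 × Y → E} (hg : Integrable g volume) : ∫ q, g q = ∫ x, ∫ y, g (x, y) :=
  integral_prod g hg

omit [SigmaFinite (volume : Measure Y)] in
theorem ae_snd {p : Y → Prop} (h : ∀ᵐ y : Y, p y) : ∀ᵐ q : S1 × Y, p q.2 :=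
  Measure.quasiMeasurePreserving_snd.ae h

theorem coeFn_tensorLp (k : ℤ) (f : Lp ℂ 2 (volume : Measure Y)) :
    ∀ᵐ q : S1 × Y, tensorLp k f q = chr k q.1 * f q.2 := MemLp.coeFn_toLp _

theorem inner_tensorLp (k l : ℤ) (f g : Lp ℂ 2 (volume : Measure Y)) :
    inner ℂ (tensorLp k f) (tensorLp l g) = if k = l then (inner ℂ f g : ℂ) else 0 := by
  have h1 : (inner ℂ (tensorLp k f) (tensorLp l g) : ℂ)
      = ∫ q : S1 × Y, ((starRingEnd ℂ) (chr k q.1) * chr l q.1) * (inner ℂ (f q.2) (g q.2)) := by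
    rw [L2.inner_def]
    refine integral_congr_ae ?_
    filter_upwards [coeFn_tensorLp k f, coeFn_tensorLp l g] with q h1 h2
    rw [h1, h2, RCLike.inner_apply, RCLike.inner_apply, map_mul]
    ring
  rw [h1, Measure.volume_eq_prod, integral_prod_mul
    (fun x : S1 => (starRingEnd ℂ) (chr k x) * chr l x)
    (fun y : Y => (inner ℂ (f y) (g y) : ℂ)), integral_chr_mul_chr, ← L2.inner_def]
  split_ifs <;> simp

/-- The embedding `f ↦ (2π)^{-1/2} e^{ikx} f(y)` of `L²(Y)` in `L²(S¹ × Y)`. -/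
def tensor (Y : Type) [MeasureSpace Y] [SigmaFinite (volume : Measure Y)] (k : ℤ) :
    Lp ℂ 2 (volume : Measure Y) →ₗᵢ[ℂ] Lp ℂ 2 (volume : Measure (S1 × Y)) :=
  LinearMap.isometryOfInner
    { toFun := tensorLp k
      map_add' := fun f g => by
        refine Lp.ext ?_
        filter_upwards [coeFn_tensorLp k (f + g), coeFn_tensorLp k f, coeFn_tensorLp k g,
          Lp.coeFn_add (tensorLp k f) (tensorLp k g), ae_snd (Lp.coeFn_add f g)]
          with q h1 h2 h3 h4 h5
        rw [h1, h4, Pi.add_apply, h2, h3, h5, Pi.add_apply, mul_add]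
      map_smul' := fun c f => by
        refine Lp.ext ?_
        filter_upwards [coeFn_tensorLp k (c • f), coeFn_tensorLp k f,
          Lp.coeFn_smul c (tensorLp k f), ae_snd (Lp.coeFn_smul c f)]
          with q h1 h2 h4 h5
        rw [h1, RingHom.id_apply, h4, Pi.smul_apply, h2, h5, Pi.smul_apply, smul_eq_mul,
          smul_eq_mul]
        ring }
    (fun f g => (inner_tensorLp k k f g).trans (if_pos rfl))

theorem coeFn_tensor (k : ℤ) (f : Lp ℂ 2 (volume : Measure Y)) :
    ∀ᵐ q : S1 × Y, tensor Y k f q = chr k q.1 * f q.2 := coeFn_tensorLp k f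

theorem orthogonalFamily_tensor :
    OrthogonalFamily ℂ (fun _ : ℤ => Lp ℂ 2 (volume : Measure Y)) (tensor Y) :=
  fun _ _ hkl f g => (inner_tensorLp _ _ f g).trans (if_neg hkl)

/-- The `k`-th Fourier coefficient of `u`, tested against `χ ∈ L²(Y)`. -/
theorem integral_coord_mul (k : ℤ) (u : Lp ℂ 2 (volume : Measure (S1 × Y))) {χ : Y → ℂ}
    (hχ : MemLp χ 2 volume) :
    ∫ y, coord (tensor Y) k u y * χ y = ∫ q : S1 × Y, u q * (chr (-k) q.1 * χ q.2) := by
  have hχ' : MemLp (fun y => (starRingEnd ℂ) (χ y)) 2 volume := hχ.star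
  have h := inner_coord (V := tensor Y) k (hχ'.toLp _) u
  rw [L2.inner_def, L2.inner_def] at h
  have e1 : ∫ y, coord (tensor Y) k u y * χ y
      = ∫ y, (inner ℂ ((hχ'.toLp _ : Lp ℂ 2 (volume : Measure Y)) y) (coord (tensor Y) k u y)) := by
    refine integral_congr_ae ?_
    filter_upwards [hχ'.coeFn_toLp] with y hy
    rw [hy, RCLike.inner_apply, Complex.conj_conj]
  rw [e1, h]
  refine integral_congr_ae ?_
  filter_upwards [coeFn_tensor k (hχ'.toLp _), ae_snd hχ'.coeFn_toLp] with q h1 h2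
  rw [h1, h2, RCLike.inner_apply, map_mul, Complex.conj_conj, conj_chr]

/-- Completeness of the Fourier basis, carried from normalized Haar measure to Lebesgue measure of
mass `2π`; the two differ by a constant factor. -/
theorem ae_eq_zero_of_fourierCoeff {g : S1 → ℂ} (hg : MemLp g 2 volume)
    (h : ∀ k, ∫ x, g x * chr k x = 0) : g =ᵐ[volume] 0 := by
  have hg' : MemLp g 2 (AddCircle.haarAddCircle : Measure S1) :=
    (memLp_haarAddCircle_iff).2 hg
  have h1 : hg'.toLp g = 0 := by
    rw [← (fourierBasis (T := 2 * Real.pi)).repr.map_eq_zero_iff]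
    ext i
    rw [fourierBasis_repr, lp.coeFn_zero, Pi.zero_apply, fourierCoeff_congr_ae hg'.coeFn_toLp,
      fourierCoeff, AddCircle.integral_haarAddCircle]
    have h2 := h (-i)
    have h3 : ∀ x : S1, g x * chr (-i) x
        = ((Real.sqrt (2 * Real.pi))⁻¹ : ℝ) • ((fourier (-i) : C(S1, ℂ)) x • g x) := by
      intro x
      rw [chr, smul_eq_mul, ← Complex.coe_smul, smul_eq_mul]
      ring
    simp_rw [h3] at h2
    rw [integral_smul, smul_eq_zero] at h2
    rcases h2 with h2 | h2
    · have : 0 < (Real.sqrt (2 * Real.pi))⁻¹ := by positivity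
      exact absurd h2 this.ne'
    · rw [h2, smul_zero]
  have h4 : g =ᵐ[AddCircle.haarAddCircle] 0 := by
    rw [← hg'.toLp_eq_toLp_iff MemLp.zero, h1]
    rfl
  rw [AddCircle.volume_eq_smul_haarAddCircle]
  exact Measure.ae_smul_measure h4 _

/-- Testing against indicators in `y` shows, for each `k`, that almost every slice `u(·, y)` has
vanishing coefficient. Since `ℤ` is countable, one null set serves all `k`; completeness on the
circle kills the remaining slices, and Fubini kills `u`. -/
theorem eq_zero_of_coord (u : Lp ℂ 2 (volume : Measure (S1 × Y)))
    (h : ∀ k, coord (tensor Y) k u = 0) : u = 0 := by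
  have hu := Lp.memLp u
  have hsq : Integrable (fun q : S1 × Y => ‖u q‖ ^ 2) (volume.prod volume) :=
    (memLp_two_iff_integrable_sq_norm hu.1).1 hu
  -- the Fourier coefficients of almost all slices vanish
  have h1 : ∀ k : ℤ, ∀ᵐ y : Y, ∫ x, u (x, y) * chr k x = 0 := by
    intro k
    have hm : AEStronglyMeasurable (fun q : S1 × Y => u q * chr k q.1) (volume.prod volume) :=
      hu.1.mul ((continuous_chr k).measurable.comp measurable_fst).aestronglyMeasurable
    have hint : ∀ s : Set Y, MeasurableSet s → volume s < ⊤ →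
        Integrable (fun q : S1 × Y => u q * (chr k q.1 * s.indicator 1 q.2)) (volume.prod volume) := by
      intro s hs hs'
      have := memLp_chr_mul (Y := Y) k (f := s.indicator 1)
        (memLp_indicator_const 2 hs (1 : ℂ) (Or.inr hs'.ne))
      exact MemLp.integrable_mul hu this
    have hrw : ∀ s : Set Y, ∀ y : Y, ∫ x, u (x, y) * (chr k x * s.indicator 1 y)
        = s.indicator (fun y => ∫ x, u (x, y) * chr k x) y := by
      intro s y
      by_cases hy : y ∈ s
      · simp [hy]
      · simp [hy]
    refine ae_eq_zero_of_forall_setIntegral_eq_of_sigmaFinite (fun s hs hs' => ?_)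
      (fun s hs hs' => ?_)
    · have := (hint s hs hs').integral_prod_right
      simp only [hrw] at this
      rwa [integrable_indicator_iff hs] at this
    · have e1 := integral_coord_mul (-k) u (χ := s.indicator 1)
        (memLp_indicator_const 2 hs (1 : ℂ) (Or.inr hs'.ne))
      have e2 : ∫ y, coord (tensor Y) (-k) u y * s.indicator 1 y = 0 := by
        rw [h]
        refine integral_eq_zero_of_ae ?_
        filter_upwards [Lp.coeFn_zero ℂ 2 (volume : Measure Y)] with y hy
        rw [hy]; simp
      rw [e2, neg_neg, integral_prod_vol_symm (hint s hs hs')] at e1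
      simp only [hrw] at e1
      rw [integral_indicator hs] at e1
      exact e1.symm
  have h2 : ∀ᵐ y : Y, ∀ k : ℤ, ∫ x, u (x, y) * chr k x = 0 := ae_all_iff.2 h1
  have hm : AEStronglyMeasurable (fun q : S1 × Y => u q) (volume.prod volume) := hu.1
  have h3 : ∀ᵐ y : Y, ∫ x, ‖u (x, y)‖ ^ 2 = 0 := by
    filter_upwards [h2, hsq.prod_left_ae, hm.prodMk_right] with y hy hy' hy''
    have hL : MemLp (fun x => u (x, y)) 2 volume := (memLp_two_iff_integrable_sq_norm hy'').2 hy'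
    have := ae_eq_zero_of_fourierCoeff hL hy
    refine integral_eq_zero_of_ae ?_
    filter_upwards [this] with x hx
    rw [hx]; simp
  have h4 : ∫ q : S1 × Y, ‖u q‖ ^ 2 = 0 := by
    rw [integral_prod_vol_symm hsq]
    exact integral_eq_zero_of_ae h3
  have h5 : (fun q : S1 × Y => ‖u q‖ ^ 2) =ᵐ[volume] 0 :=
    (integral_eq_zero_iff_of_nonneg (fun q => by positivity) hsq).1 h4
  refine Lp.ext ?_
  filter_upwards [h5, Lp.coeFn_zero ℂ 2 (volume : Measure (S1 × Y))] with q h6 h7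
  rw [h7]
  simpa using h6

end FourierFibers
end

noncomputable section

/-! ## Test functions and weak derivatives -/

theorem isOpenQuotientMap_toS1 : IsOpenQuotientMap toS1 :=
  QuotientAddGroup.isOpenQuotientMap_mk

namespace Model

variable {Y : Type} [AddCommGroup Y] [TopologicalSpace Y]

/-- `χ ∈ C_c^∞(Y)`. -/
def IsTest (M : Model Y) (χ : Y → ℂ) : Prop :=
  ContDiff ℝ ∞ (fun s : ℝ => χ (M.cover s)) ∧ HasCompactSupport χ

/-- The properties of the two models which are used in the study of `P`. -/
structure IsRegular [MeasureSpace Y] (M : Model Y) : Prop where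
  quotient : IsOpenQuotientMap M.cover
  ae_cover : ∀ p : Y → Prop, (∀ᵐ y, p y) ↔ ∀ᵐ s : ℝ, p (M.cover s)
  locallyIntegrable : ∀ f : Y → ℂ, LocallyIntegrable f volume →
    LocallyIntegrable (fun s : ℝ => f (M.cover s)) volume
  exists_push : ∀ ψ : ℝ → ℂ, ContDiff ℝ ∞ ψ → HasCompactSupport ψ → ∃ χ : Y → ℂ, M.IsTest χ ∧
    ∀ f : Y → ℂ, LocallyIntegrable f volume →
      (∫ y, f y * χ y = ∫ s, f (M.cover s) * ψ s) ∧
      (∫ y, f y * M.dY χ y = ∫ s, f (M.cover s) * deriv ψ s)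
  integral_dY : ∀ χ, M.IsTest χ → ∫ y, M.dY χ y = 0
  contDiff_phi : ContDiff ℝ ∞ fun s : ℝ => M.phi (M.cover s)
  continuous_weight : Continuous M.weight

variable {M : Model Y}

theorem dY_cover {E : Type} [NormedAddCommGroup E] [NormedSpace ℝ E] (f : Y → E) (s : ℝ) :
    M.dY f (M.cover s) = deriv (fun r => f (M.cover r)) s := by
  have h : (fun r : ℝ => f (M.cover s + M.cover r)) = fun r => (fun r => f (M.cover r)) (s + r) := by
    funext r; simp only [map_add]
  rw [dY, h, deriv_comp_const_add (fun r => f (M.cover r)), add_zero]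

theorem dX_toS1 {E : Type} [NormedAddCommGroup E] [NormedSpace ℝ E] (f : S1 → E) (s : ℝ) :
    dX f (toS1 s) = deriv (fun r => f (toS1 r)) s := by
  have h : (fun r : ℝ => f (toS1 s + toS1 r)) = fun r => (fun r => f (toS1 r)) (s + r) := by
    funext r; simp only [map_add]
  rw [dX, h, deriv_comp_const_add (fun r => f (toS1 r)), add_zero]

theorem IsRegular.continuous_dphi [MeasureSpace Y] (hM : M.IsRegular) : Continuous M.dphi := by
  refine (hM.quotient.isQuotientMap.continuous_iff).2 ?_
  have : M.dphi ∘ M.cover = deriv fun s => M.phi (M.cover s) := funext fun s => dY_cover _ s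
  rw [this]
  exact (contDiff_infty_iff_deriv.1 hM.contDiff_phi).2.continuous

theorem IsTest.continuous [MeasureSpace Y] (hM : M.IsRegular) {χ : Y → ℂ} (hχ : M.IsTest χ) :
    Continuous χ :=
  (hM.quotient.isQuotientMap.continuous_iff).2 hχ.1.continuous

theorem IsTest.dY [MeasureSpace Y] [IsTopologicalAddGroup Y] (hM : M.IsRegular) {χ : Y → ℂ}
    (hχ : M.IsTest χ) : M.IsTest (M.dY χ) := by
  constructor
  · simp only [dY_cover]
    exact (contDiff_infty_iff_deriv.1 hχ.1).2
  · refine HasCompactSupport.of_support_subset_isCompact hχ.2 fun y hy => ?_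
    by_contra hn
    apply hy
    have h1 : ∀ᶠ z in nhds y, χ z = 0 := by
      filter_upwards [(isClosed_tsupport χ).isOpen_compl.mem_nhds hn] with z hz
      exact image_eq_zero_of_notMem_tsupport hz
    have h2 : Filter.Tendsto (fun s : ℝ => y + M.cover s) (nhds 0) (nhds y) := by
      have : Continuous fun s : ℝ => y + M.cover s := continuous_const.add hM.quotient.continuous
      have := this.tendsto 0
      rwa [map_zero, add_zero] at this
    have h3 : (fun s : ℝ => χ (y + M.cover s)) =ᶠ[nhds 0] fun _ => 0 := h2.eventually h1
    rw [Model.dY, h3.deriv_eq, deriv_const]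

theorem IsTest.mul {χ η : Y → ℂ} (hχ : M.IsTest χ)
    (hη : ContDiff ℝ ∞ (fun s : ℝ => η (M.cover s))) : M.IsTest (fun y => η y * χ y) :=
  ⟨hη.mul hχ.1, hχ.2.mul_left⟩

variable [MeasureSpace Y] [BorelSpace Y] [SecondCountableTopology Y]
  [IsFiniteMeasureOnCompacts (volume : Measure Y)] [SigmaFinite (volume : Measure Y)]

theorem IsTest.memLp (hM : M.IsRegular) {χ : Y → ℂ} (hχ : M.IsTest χ) : MemLp χ 2 volume :=
  (hχ.continuous hM).memLp_of_hasCompactSupport hχ.2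

/-- Locally integrable functions are determined by their integrals against test functions. -/
theorem ae_eq_zero_of_test (hM : M.IsRegular) {f : Y → ℂ} (hf : LocallyIntegrable f volume)
    (h : ∀ χ, M.IsTest χ → ∫ y, f y * χ y = 0) : f =ᵐ[volume] 0 := by
  refine (hM.ae_cover _).2 ?_
  refine ae_eq_zero_of_integral_contDiff_smul_eq_zero (hM.locallyIntegrable f hf) fun g hg hg' => ?_
  have hψ : ContDiff ℝ ∞ fun s => (g s : ℂ) := Complex.ofRealCLM.contDiff.comp hg
  have hψ' : HasCompactSupport fun s => (g s : ℂ) := hg'.comp_left Complex.ofReal_zero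
  obtain ⟨χ, hχ, hχ'⟩ := hM.exists_push _ hψ hψ'
  have := (hχ' f hf).1
  rw [h χ hχ] at this
  rw [this]
  refine integral_congr_ae (Filter.Eventually.of_forall fun s => ?_)
  simp only [← Complex.coe_smul, smul_eq_mul]
  ring

end Model

/-! ### Test functions on the product -/

namespace Model

variable {Y : Type} [AddCommGroup Y] [TopologicalSpace Y] [IsTopologicalAddGroup Y] [T2Space Y]
  [MeasureSpace Y] [BorelSpace Y] [SecondCountableTopology Y]
  [IsFiniteMeasureOnCompacts (volume : Measure Y)] [SigmaFinite (volume : Measure Y)]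
  {M : Model Y}

theorem IsRegular.quotient_prod (hM : M.IsRegular) :
    IsOpenQuotientMap (Prod.map toS1 M.cover) := isOpenQuotientMap_toS1.prodMap hM.quotient

theorem IsTestFunction.continuous (hM : M.IsRegular) {ψ : S1 × Y → ℂ} (hψ : M.IsTestFunction ψ) :
    Continuous ψ :=
  (hM.quotient_prod.isQuotientMap.continuous_iff).2 hψ.1.continuous

/-- Handles `∂_x` and `∂_y` together: lifted to `ℝ × ℝ`, both are a Fréchet derivative applied to a
fixed direction `v`. -/
theorem IsTestFunction.continuous_deriv (hM : M.IsRegular) {ψ : S1 × Y → ℂ}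
    (hψ : M.IsTestFunction ψ) {D : S1 × Y → ℂ} (v : ℝ × ℝ)
    (hD : ∀ a b, D (toS1 a, M.cover b)
      = deriv (fun s : ℝ => ψ (toS1 (a + s * v.1), M.cover (b + s * v.2))) 0) : Continuous D := by
  refine (hM.quotient_prod.isQuotientMap.continuous_iff).2 ?_
  have h1 : D ∘ Prod.map toS1 M.cover
      = fun q => fderiv ℝ (fun q : ℝ × ℝ => ψ (toS1 q.1, M.cover q.2)) q v := by
    funext q
    change D (toS1 q.1, M.cover q.2) = _
    rw [hD]
    have h2 : HasDerivAt (fun s : ℝ => (q.1 + s * v.1, q.2 + s * v.2)) v 0 := by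
      have a1 : HasDerivAt (fun s : ℝ => q.1 + s * v.1) v.1 0 := by
        simpa using ((hasDerivAt_id (0 : ℝ)).mul_const v.1).const_add q.1
      have a2 : HasDerivAt (fun s : ℝ => q.2 + s * v.2) v.2 0 := by
        simpa using ((hasDerivAt_id (0 : ℝ)).mul_const v.2).const_add q.2
      exact a1.prodMk a2
    have h3 : HasFDerivAt (fun q : ℝ × ℝ => ψ (toS1 q.1, M.cover q.2))
        (fderiv ℝ (fun q : ℝ × ℝ => ψ (toS1 q.1, M.cover q.2)) q)
        (q.1 + (0 : ℝ) * v.1, q.2 + (0 : ℝ) * v.2) := by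
      simp only [zero_mul, add_zero]
      exact ((hψ.1.differentiable (by simp)) q).hasFDerivAt
    exact (h3.comp_hasDerivAt (0 : ℝ) h2).deriv
  rw [h1]
  exact (hψ.1.continuous_fderiv (by simp)).clm_apply continuous_const

theorem IsTestFunction.continuous_dX (hM : M.IsRegular) {ψ : S1 × Y → ℂ}
    (hψ : M.IsTestFunction ψ) : Continuous fun q : S1 × Y => dX (fun x => ψ (x, q.2)) q.1 := by
  refine hψ.continuous_deriv hM (1, 0) fun a b => ?_
  simp only [dX, mul_one, mul_zero, add_zero, map_add]

theorem IsTestFunction.continuous_dY (hM : M.IsRegular) {ψ : S1 × Y → ℂ}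
    (hψ : M.IsTestFunction ψ) : Continuous fun q : S1 × Y => M.dY (fun y => ψ (q.1, y)) q.2 := by
  refine hψ.continuous_deriv hM (0, 1) fun a b => ?_
  simp only [dY, mul_one, mul_zero, add_zero, map_add]

theorem hasCompactSupport_deriv {ψ : S1 × Y → ℂ} (hψ : HasCompactSupport ψ) {D : S1 × Y → ℂ}
    {c : S1 × Y → ℝ → S1 × Y} (hc : ∀ q, Filter.Tendsto (c q) (nhds 0) (nhds q))
    (hD : ∀ q, D q = deriv (fun s => ψ (c q s)) 0) : HasCompactSupport D := by
  refine HasCompactSupport.of_support_subset_isCompact hψ fun q hq => ?_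
  by_contra hn
  apply hq
  have h1 : ∀ᶠ z in nhds q, ψ z = 0 := by
    filter_upwards [(isClosed_tsupport ψ).isOpen_compl.mem_nhds hn] with z hz
    exact image_eq_zero_of_notMem_tsupport hz
  have h3 : (fun s : ℝ => ψ (c q s)) =ᶠ[nhds 0] fun _ => 0 := (hc q).eventually h1
  rw [hD, h3.deriv_eq, deriv_const]

theorem continuous_toS1 : Continuous toS1 := isOpenQuotientMap_toS1.continuous

theorem IsTestFunction.hasCompactSupport_dY (hM : M.IsRegular) {ψ : S1 × Y → ℂ}
    (hψ : M.IsTestFunction ψ) :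
    HasCompactSupport fun q : S1 × Y => M.dY (fun y => ψ (q.1, y)) q.2 := by
  refine hasCompactSupport_deriv hψ.2 (c := fun q s => (q.1, q.2 + M.cover s)) (fun q => ?_)
    fun q => rfl
  have h : Continuous fun s : ℝ => (q.1, q.2 + M.cover s) :=
    continuous_const.prodMk (continuous_const.add hM.quotient.continuous)
  simpa using h.tendsto 0

theorem IsTestFunction.hasCompactSupport_dX {ψ : S1 × Y → ℂ}
    (hψ : M.IsTestFunction ψ) :
    HasCompactSupport fun q : S1 × Y => dX (fun x => ψ (x, q.2)) q.1 := by
  refine hasCompactSupport_deriv hψ.2 (c := fun q s => (q.1 + toS1 s, q.2)) (fun q => ?_)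
    fun q => rfl
  have h : Continuous fun s : ℝ => (q.1 + toS1 s, q.2) :=
    (continuous_const.add continuous_toS1).prodMk continuous_const
  simpa using h.tendsto 0

theorem IsTestFunction.slice {ψ : S1 × Y → ℂ} (hψ : M.IsTestFunction ψ) (x : S1) :
    M.IsTest (fun y => ψ (x, y)) := by
  obtain ⟨a, rfl⟩ := isOpenQuotientMap_toS1.surjective x
  constructor
  · exact hψ.1.comp (contDiff_const.prodMk contDiff_id)
  · refine HasCompactSupport.of_support_subset_isCompact (hψ.2.isCompact.image continuous_snd)
      fun y hy => ⟨(toS1 a, y), subset_tsupport _ hy, rfl⟩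

theorem contDiff_chr (k : ℤ) : ContDiff ℝ ∞ fun s : ℝ => chr k (toS1 s) := by
  simp only [chr_toS1]
  exact contDiff_const.mul ((contDiff_const.mul Complex.ofRealCLM.contDiff).cexp)

theorem deriv_chr (k : ℤ) (s : ℝ) :
    deriv (fun s : ℝ => chr k (toS1 s)) s = Complex.I * k * chr k (toS1 s) := by
  simp only [chr_toS1]
  have h1 : HasDerivAt (fun s : ℝ => Complex.I * k * (s : ℂ)) (Complex.I * k) s := by
    simpa using (Complex.ofRealCLM.hasDerivAt (x := s)).const_mul (Complex.I * k)
  rw [(h1.cexp.const_mul _).deriv]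
  ring

theorem IsTest.isTestFunction {χ : Y → ℂ} (hχ : M.IsTest χ) (k : ℤ) :
    M.IsTestFunction (fun q : S1 × Y => chr k q.1 * χ q.2) := by
  constructor
  · exact ((contDiff_chr k).comp contDiff_fst).mul (hχ.1.comp contDiff_snd)
  · refine HasCompactSupport.of_support_subset_isCompact
      ((isCompact_univ (X := S1)).prod hχ.2.isCompact) fun q hq => ⟨mem_univ _, ?_⟩
    refine subset_tsupport _ fun h => hq ?_
    simp only [h, mul_zero]

theorem dY_const_mul (hc : Function.Surjective M.cover) {χ : Y → ℂ} 
    (hχ : ContDiff ℝ ∞ fun s : ℝ => χ (M.cover s)) (c : ℂ) (y : Y) :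
    M.dY (fun y => c * χ y) y = c * M.dY χ y := by
  obtain ⟨s, rfl⟩ := hc y
  rw [dY_cover, dY_cover, deriv_const_mul _ (hχ.differentiable (by simp) s)]

theorem dX_chr_mul (k : ℤ) (c : ℂ) (x : S1) :
    dX (fun x => chr k x * c) x = Complex.I * k * (chr k x * c) := by
  obtain ⟨s, rfl⟩ := isOpenQuotientMap_toS1.surjective x
  rw [dX_toS1, deriv_mul_const ((contDiff_chr k).differentiable (by simp) s), deriv_chr]
  ring

/-! ### Weak derivatives on `Y` -/

/-- `g = ∂_y f` in the sense of distributions on `Y`. -/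
def IsWeakD (M : Model Y) (f g : Lp ℂ 2 (volume : Measure Y)) : Prop :=
  ∀ χ, M.IsTest χ → ∫ y, f y * M.dY χ y = -∫ y, g y * χ y

theorem IsWeakDY.coord (hM : M.IsRegular) {u v : Lp ℂ 2 (volume : Measure (S1 × Y))}
    (h : M.IsWeakDY u v) (k : ℤ) : M.IsWeakD (coord (tensor Y) k u) (coord (tensor Y) k v) := by
  intro χ hχ
  rw [integral_coord_mul k u ((hχ.dY hM).memLp hM), integral_coord_mul k v (hχ.memLp hM)]
  rw [← h _ (hχ.isTestFunction (-k))]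
  simp only [dY_const_mul hM.quotient.surjective hχ.1]

/-- Testing against `e^{-ikx} χ(y)` turns `∂_x` into multiplication by `i k`. With the prefactor `h
/ i` of `D_x` this produces the constant `h k` of the fiber operator. -/
theorem IsWeakDX.coord (hM : M.IsRegular) {u v : Lp ℂ 2 (volume : Measure (S1 × Y))}
    (h : M.IsWeakDX u v) (k : ℤ) {χ : Y → ℂ} (hχ : M.IsTest χ) :
    ∫ y, _root_.coord (tensor Y) k v y * χ y
      = Complex.I * k * ∫ y, _root_.coord (tensor Y) k u y * χ y := by
  rw [integral_coord_mul k u (hχ.memLp hM), integral_coord_mul k v (hχ.memLp hM)]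
  have h1 := h _ (hχ.isTestFunction (-k))
  simp only [dX_chr_mul] at h1
  have h2 : ∀ q : S1 × Y, u q * (Complex.I * ((-k : ℤ) : ℂ) * (chr (-k) q.1 * χ q.2))
      = -(Complex.I * k) * (u q * (chr (-k) q.1 * χ q.2)) := by
    intro q; push_cast; ring
  simp_rw [h2] at h1
  rw [integral_const_mul] at h1
  linear_combination h1

end Model
end

noncomputable section

/-! ## The graph of the closure of `P` -/

theorem integral_dX_eq_zero {F : S1 → ℂ} (hF : ContDiff ℝ ∞ fun s : ℝ => F (toS1 s)) :
    ∫ x, dX F x = 0 := by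
  have h1 : ∫ x : S1, dX F x = ∫ s in (0 : ℝ)..0 + 2 * Real.pi, dX F (toS1 s) :=
    (AddCircle.intervalIntegral_preimage (2 * Real.pi) 0 (dX F)).symm
  rw [h1]
  simp only [Model.dX_toS1]
  have hd := contDiff_infty_iff_deriv.1 hF
  rw [intervalIntegral.integral_deriv_eq_sub (fun s _ => hd.1 s)
    (hd.2.continuous.intervalIntegrable _ _)]
  have : toS1 (0 + 2 * Real.pi) = toS1 0 := by
    rw [zero_add, map_zero]
    exact AddCircle.coe_period _
  rw [this, sub_self]

section Pairing

variable {X : Type} [MeasureSpace X]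

/-- The functional `u ↦ ∫ u η` on `L²`. -/
def pairing {η : X → ℂ} (hη : MemLp η 2 (volume : Measure X)) :
    Lp ℂ 2 (volume : Measure X) →L[ℂ] ℂ :=
  innerSL ℂ (hη.star.toLp _ : Lp ℂ 2 (volume : Measure X))

theorem pairing_apply {η : X → ℂ} (hη : MemLp η 2 (volume : Measure X))
    (u : Lp ℂ 2 (volume : Measure X)) : pairing hη u = ∫ x, u x * η x := by
  rw [pairing, innerSL_apply_apply, L2.inner_def]
  refine integral_congr_ae ?_
  filter_upwards [hη.star.coeFn_toLp] with x hx
  rw [hx, RCLike.inner_apply, Pi.star_apply, RCLike.star_def, Complex.conj_conj]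

theorem integral_linear_comb₃ {A B C : X → ℂ} (hA : Integrable A (volume : Measure X))
    (hB : Integrable B (volume : Measure X)) (hC : Integrable C (volume : Measure X))
    (a b c : ℂ) : ∫ x, (a * A x + b * B x + c * C x)
      = a * (∫ x, A x) + b * (∫ x, B x) + c * ∫ x, C x := by
  have h1 : Integrable (fun x => a * A x + b * B x) (volume : Measure X) :=
    (hA.const_mul a).add (hB.const_mul b)
  rw [integral_add h1 (hC.const_mul c), integral_add (hA.const_mul a) (hB.const_mul b),
    integral_const_mul, integral_const_mul, integral_const_mul]

end Pairing

namespace Model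

variable {Y : Type} [AddCommGroup Y] [TopologicalSpace Y] [IsTopologicalAddGroup Y] [T2Space Y]
  [LocallyCompactSpace Y] [MeasureSpace Y] [BorelSpace Y] [SecondCountableTopology Y]
  [IsFiniteMeasureOnCompacts (volume : Measure Y)] [SigmaFinite (volume : Measure Y)]
  {M : Model Y}

theorem IsTest.memLp_continuous_mul (hM : M.IsRegular) {χ : Y → ℂ} (hχ : M.IsTest χ) {a : Y → ℂ}
    (ha : Continuous a) : MemLp (fun y => a y * χ y) 2 volume :=
  (ha.mul (hχ.continuous hM)).memLp_of_hasCompactSupport hχ.2.mul_left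

/-- By Fubini it suffices to fix `y`; there the derivative of the smooth periodic function `x ↦
e^{ikx} ψ(x, y)` integrates to zero. -/
theorem isWeakDX_tensor (hM : M.IsRegular) (k : ℤ) (f : Lp ℂ 2 (volume : Measure Y)) :
    M.IsWeakDX (tensor Y k f) ((Complex.I * k) • tensor Y k f) := by
  intro ψ hψ
  have hψ2 : MemLp ψ 2 volume := (hψ.continuous hM).memLp_of_hasCompactSupport hψ.2
  have hd2 : MemLp (fun q : S1 × Y => dX (fun x => ψ (x, q.2)) q.1) 2 volume :=
    (hψ.continuous_dX hM).memLp_of_hasCompactSupport hψ.hasCompactSupport_dX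
  have hf := memLp_chr_mul k (Lp.memLp f)
  have i1 : Integrable (fun q : S1 × Y => (chr k q.1 * f q.2) * dX (fun x => ψ (x, q.2)) q.1)
    volume := hf.integrable_mul hd2
  have i2 : Integrable (fun q : S1 × Y => (chr k q.1 * f q.2) * ψ q) volume :=
    hf.integrable_mul hψ2
  have e1 : ∫ q, tensor Y k f q * dX (fun x => ψ (x, q.2)) q.1
      = ∫ q : S1 × Y, (chr k q.1 * f q.2) * dX (fun x => ψ (x, q.2)) q.1 := by
    refine integral_congr_ae ?_
    filter_upwards [coeFn_tensor k f] with q hq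
    rw [hq]
  have e2 : ∫ q, ((Complex.I * k) • tensor Y k f : Lp ℂ 2 (volume : Measure (S1 × Y))) q * ψ q
      = (Complex.I * k) * ∫ q : S1 × Y, (chr k q.1 * f q.2) * ψ q := by
    rw [← integral_const_mul]
    refine integral_congr_ae ?_
    filter_upwards [coeFn_tensor k f, Lp.coeFn_smul (Complex.I * k) (tensor Y k f)] with q hq hq'
    rw [hq', Pi.smul_apply, hq, smul_eq_mul]
    ring
  rw [e1, e2, integral_prod_vol_symm i1, integral_prod_vol_symm i2, ← integral_const_mul,
    ← integral_neg]
  refine integral_congr_ae (Filter.Eventually.of_forall fun y => ?_)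
  simp only
  obtain ⟨b, rfl⟩ := hM.quotient.surjective y
  have hs : ContDiff ℝ ∞ fun s : ℝ => ψ (toS1 s, M.cover b) :=
    hψ.1.comp (contDiff_id.prodMk contDiff_const)
  have h0 := integral_dX_eq_zero (F := fun x => chr k x * ψ (x, M.cover b))
    ((contDiff_chr k).mul hs)
  have h1 : ∀ x, dX (fun x => chr k x * ψ (x, M.cover b)) x
      = Complex.I * k * (chr k x * ψ (x, M.cover b))
        + chr k x * dX (fun x => ψ (x, M.cover b)) x := by
    intro x
    obtain ⟨s, rfl⟩ := isOpenQuotientMap_toS1.surjective x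
    rw [dX_toS1, dX_toS1, deriv_fun_mul ((contDiff_chr k).differentiable (by simp) s)
      (hs.differentiable (by simp) s), deriv_chr]
    ring
  simp_rw [h1] at h0
  have c1 : Continuous fun x : S1 => Complex.I * k * (chr k x * ψ (x, M.cover b)) :=
    continuous_const.mul ((continuous_chr k).mul
      ((hψ.continuous hM).comp (continuous_id.prodMk continuous_const)))
  have c2 : Continuous fun x : S1 => chr k x * dX (fun x => ψ (x, M.cover b)) x :=
    (continuous_chr k).mul
      ((hψ.continuous_dX hM).comp (continuous_id.prodMk continuous_const))
  have j1 : Integrable (fun x : S1 => Complex.I * k * (chr k x * ψ (x, M.cover b))) volume :=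
    c1.integrable_of_hasCompactSupport (HasCompactSupport.of_compactSpace _)
  have j2 : Integrable (fun x : S1 => chr k x * dX (fun x => ψ (x, M.cover b)) x) volume :=
    c2.integrable_of_hasCompactSupport (HasCompactSupport.of_compactSpace _)
  rw [integral_add j1 j2, integral_const_mul] at h0
  have h2 : ∀ x : S1, chr k x * f (M.cover b) * dX (fun x => ψ (x, M.cover b)) x
      = f (M.cover b) * (chr k x * dX (fun x => ψ (x, M.cover b)) x) := fun x => by ring
  have h3 : ∀ x : S1, chr k x * f (M.cover b) * ψ (x, M.cover b)
      = f (M.cover b) * (chr k x * ψ (x, M.cover b)) := fun x => by ring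
  simp_rw [h2, h3]
  rw [integral_const_mul, integral_const_mul]
  linear_combination f (M.cover b) * h0

theorem IsWeakD.tensor (hM : M.IsRegular) (k : ℤ) {f g : Lp ℂ 2 (volume : Measure Y)}
    (h : M.IsWeakD f g) : M.IsWeakDY (tensor Y k f) (tensor Y k g) := by
  intro ψ hψ
  have hψ2 : MemLp ψ 2 volume := (hψ.continuous hM).memLp_of_hasCompactSupport hψ.2
  have hd2 : MemLp (fun q : S1 × Y => M.dY (fun y => ψ (q.1, y)) q.2) 2 volume :=
    (hψ.continuous_dY hM).memLp_of_hasCompactSupport (hψ.hasCompactSupport_dY hM)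
  have i1 : Integrable (fun q : S1 × Y => (chr k q.1 * f q.2) * M.dY (fun y => ψ (q.1, y)) q.2)
    volume := (memLp_chr_mul k (Lp.memLp f)).integrable_mul hd2
  have i2 : Integrable (fun q : S1 × Y => (chr k q.1 * g q.2) * ψ q) volume :=
    (memLp_chr_mul k (Lp.memLp g)).integrable_mul hψ2
  have e1 : ∫ q, _root_.tensor Y k f q * M.dY (fun y => ψ (q.1, y)) q.2
      = ∫ q : S1 × Y, (chr k q.1 * f q.2) * M.dY (fun y => ψ (q.1, y)) q.2 := by
    refine integral_congr_ae ?_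
    filter_upwards [coeFn_tensor k f] with q hq
    rw [hq]
  have e2 : ∫ q, _root_.tensor Y k g q * ψ q = ∫ q : S1 × Y, (chr k q.1 * g q.2) * ψ q := by
    refine integral_congr_ae ?_
    filter_upwards [coeFn_tensor k g] with q hq
    rw [hq]
  rw [e1, e2, integral_prod_vol i1, integral_prod_vol i2, ← integral_neg]
  refine integral_congr_ae (Filter.Eventually.of_forall fun x => ?_)
  simp only [mul_assoc]
  rw [integral_const_mul, integral_const_mul, h _ (hψ.slice x)]
  ring

theorem isPPair_tensor (hM : M.IsRegular) (h : ℝ) (k : ℤ) {f f₁ g : Lp ℂ 2 (volume : Measure Y)}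
    (hw : MemLp (fun y => (M.weight y : ℂ) * f y) 2 volume) (hD : M.IsWeakD f f₁)
    (hg : ∀ᵐ y, g y = (h * k : ℂ) * f y + h * f₁ y + M.dphi y * f y) :
    M.IsPPair h (tensor Y k f) (tensor Y k g) := by
  refine ⟨?_, _, _, isWeakDX_tensor hM k f, hD.tensor hM k, ?_⟩
  · refine (memLp_chr_mul k hw).ae_eq ?_
    filter_upwards [coeFn_tensor k f] with q hq
    rw [hq]; ring
  · filter_upwards [coeFn_tensor k f, coeFn_tensor k f₁, coeFn_tensor k g,
      Lp.coeFn_smul (Complex.I * k) (_root_.tensor Y k f), ae_snd hg] with q h1 h2 h3 h4 h5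
    rw [h4, Pi.smul_apply, h1, h2, h3, h5, smul_eq_mul]
    have : (h : ℂ) / Complex.I * (Complex.I * k * (chr k q.1 * f q.2))
        = (h * k : ℂ) * (chr k q.1 * f q.2) := by
      field_simp
    rw [this]
    ring

/-- The operator `h k + h ∂_y + ∂_y φ` induced by `P` in the fiber `k`. -/
def fiberP (M : Model Y) (h : ℝ) (k : ℤ) (χ : Y → ℂ) (y : Y) : ℂ :=
  (h * k : ℂ) * χ y + h * M.dY χ y + M.dphi y * χ y

/-- `g = (h k + h ∂_y + ∂_y φ) f` in the sense of distributions on `Y`. -/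
def IsFiberPair (M : Model Y) (h : ℝ) (k : ℤ) (f g : Lp ℂ 2 (volume : Measure Y)) : Prop :=
  ∀ χ, M.IsTest χ →
    ∫ y, f y * (((h * k : ℂ) + M.dphi y) * χ y - h * M.dY χ y) = ∫ y, g y * χ y

theorem continuous_coe_dphi (hM : M.IsRegular) : Continuous fun y => (M.dphi y : ℂ) :=
  Complex.continuous_ofReal.comp hM.continuous_dphi

theorem IsTest.memLp_fiber (hM : M.IsRegular) (h : ℝ) (k : ℤ) {χ : Y → ℂ} (hχ : M.IsTest χ) :
    MemLp (fun y => ((h * k : ℂ) + M.dphi y) * χ y - h * M.dY χ y) 2 volume :=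
  (hχ.memLp_continuous_mul hM (continuous_const.add (continuous_coe_dphi hM))).sub
    (((hχ.dY hM).memLp hM).const_mul _)

/-- The pairs `(f, g)` with `g = (h k + h ∂_y + ∂_y φ) f` form a closed subspace. -/
theorem isFiberPair_iff (hM : M.IsRegular) (h : ℝ) (k : ℤ) (f g : Lp ℂ 2 (volume : Measure Y)) :
    M.IsFiberPair h k f g ↔ ∀ χ (hχ : M.IsTest χ),
      pairing (hχ.memLp_fiber hM h k) f = pairing (hχ.memLp hM) g := by
  simp only [IsFiberPair, pairing_apply]

theorem IsPPair.isFiberPair (hM : M.IsRegular) {h : ℝ} {u v : Lp ℂ 2 (volume : Measure (S1 × Y))}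
    (huv : M.IsPPair h u v) (k : ℤ) :
    M.IsFiberPair h k (coord (tensor Y) k u) (coord (tensor Y) k v) := by
  obtain ⟨-, ux, uy, hx, hy, hv⟩ := huv
  intro χ hχ
  have m0 := hχ.memLp hM
  have m1 := hχ.memLp_continuous_mul hM (continuous_coe_dphi hM)
  have m2 := (hχ.dY hM).memLp hM
  set f := coord (_root_.tensor Y) k u
  have i0 : Integrable (fun y => f y * χ y) volume := (Lp.memLp f).integrable_mul m0
  have i1 : Integrable (fun y => f y * (M.dphi y * χ y)) volume := (Lp.memLp f).integrable_mul m1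
  have i2 : Integrable (fun y => f y * M.dY χ y) volume := (Lp.memLp f).integrable_mul m2
  have e1 : ∫ y, f y * (((h * k : ℂ) + M.dphi y) * χ y - h * M.dY χ y)
      = (h * k) * (∫ y, f y * χ y) + (∫ y, f y * (M.dphi y * χ y)) - h * ∫ y, f y * M.dY χ y := by
    refine (integral_congr_ae (Filter.Eventually.of_forall fun y => ?_)).trans
      ((integral_linear_comb₃ i0 i1 i2 (h * k) 1 (-h)).trans (by ring))
    ring
  have n0 := memLp_chr_mul (-k) m0
  have j1 : Integrable (fun q : S1 × Y => ux q * (chr (-k) q.1 * χ q.2)) volume :=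
    (Lp.memLp ux).integrable_mul n0
  have j2 : Integrable (fun q : S1 × Y => uy q * (chr (-k) q.1 * χ q.2)) volume :=
    (Lp.memLp uy).integrable_mul n0
  have j3 : Integrable (fun q : S1 × Y => u q * (chr (-k) q.1 * (M.dphi q.2 * χ q.2))) volume :=
    (Lp.memLp u).integrable_mul (memLp_chr_mul (-k) m1)
  have e2 : ∫ y, coord (_root_.tensor Y) k v y * χ y
      = h / Complex.I * (∫ y, coord (_root_.tensor Y) k ux y * χ y)
        + h * (∫ y, coord (_root_.tensor Y) k uy y * χ y) + ∫ y, f y * (M.dphi y * χ y) := by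
    rw [integral_coord_mul k v m0, integral_coord_mul k ux m0, integral_coord_mul k uy m0,
      integral_coord_mul k u m1]
    refine (integral_congr_ae ?_).trans
      ((integral_linear_comb₃ j1 j2 j3 (h / Complex.I) h 1).trans (by ring))
    filter_upwards [hv] with q hq
    rw [hq]
    ring
  have h3 := (hy.coord hM k) χ hχ
  have h4 : (h : ℂ) / Complex.I * (Complex.I * k * ∫ y, f y * χ y) = h * k * ∫ y, f y * χ y := by
    field_simp
  rw [e1, e2, hx.coord hM k hχ, h3, h4]
  ring

/-- The domain of `P` is stable under projection to a Fourier mode. The weight and `φ'` depend on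
`y` only and so commute with taking a Fourier coefficient; each identity between locally integrable
functions is verified against test functions. -/
theorem IsPPair.reduce (hM : M.IsRegular) {h : ℝ} {u v : Lp ℂ 2 (volume : Measure (S1 × Y))}
    (huv : M.IsPPair h u v) (k : ℤ) :
    M.IsPPair h (tensor Y k (coord (tensor Y) k u)) (tensor Y k (coord (tensor Y) k v)) := by
  have hW := huv.isFiberPair hM k
  obtain ⟨hwu, ux, uy, hx, hy, hv⟩ := huv
  set f := coord (_root_.tensor Y) k u
  set g := coord (_root_.tensor Y) k v
  set f₁ := coord (_root_.tensor Y) k uy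
  have hD : M.IsWeakD f f₁ := hy.coord hM k
  have hwc : Continuous fun y => (M.weight y : ℂ) :=
    Complex.continuous_ofReal.comp hM.continuous_weight
  have lf : LocallyIntegrable (fun y => f y) volume := (Lp.memLp f).locallyIntegrable (by norm_num)
  have lf₁ : LocallyIntegrable (fun y => f₁ y) volume :=
    (Lp.memLp f₁).locallyIntegrable (by norm_num)
  have lg : LocallyIntegrable (fun y => g y) volume := (Lp.memLp g).locallyIntegrable (by norm_num)
  have lmul : ∀ a : Y → ℂ, Continuous a → LocallyIntegrable (fun y => a y * f y) volume := by
    intro a ha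
    rw [← locallyIntegrableOn_univ] at lf ⊢
    exact lf.continuousOn_mul ha.continuousOn isOpen_univ.isLocallyClosed
  refine isPPair_tensor hM h k (f₁ := f₁) ?_ hD ?_
  · have h1 : (fun y => (M.weight y : ℂ) * f y - coord (_root_.tensor Y) k (hwu.toLp _) y)
        =ᵐ[volume] 0 := by
      refine ae_eq_zero_of_test hM ((lmul _ hwc).sub
        ((Lp.memLp _).locallyIntegrable (by norm_num))) fun χ hχ => ?_
      have m0 := hχ.memLp hM
      have m1 := hχ.memLp_continuous_mul hM hwc
      have h2 : ∫ y, coord (_root_.tensor Y) k (hwu.toLp _) y * χ y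
          = ∫ y, f y * (M.weight y * χ y) := by
        rw [integral_coord_mul k _ m0, integral_coord_mul k _ m1]
        refine integral_congr_ae ?_
        filter_upwards [hwu.coeFn_toLp] with q hq
        rw [hq]; ring
      have i1 : Integrable (fun y => f y * (M.weight y * χ y)) volume :=
        (Lp.memLp f).integrable_mul m1
      have i2 : Integrable (fun y => coord (_root_.tensor Y) k (hwu.toLp _) y * χ y) volume :=
        (Lp.memLp _).integrable_mul m0
      rw [← sub_eq_zero.2 h2.symm, ← integral_sub i1 i2]
      refine integral_congr_ae (Filter.Eventually.of_forall fun y => ?_)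
      simp only
      ring
    refine (Lp.memLp (coord (_root_.tensor Y) k (hwu.toLp _))).ae_eq ?_
    filter_upwards [h1] with y hy
    exact (sub_eq_zero.1 hy).symm
  · have h1 : (fun y => g y - ((h * k : ℂ) * f y + h * f₁ y + M.dphi y * f y)) =ᵐ[volume] 0 := by
      refine ae_eq_zero_of_test hM (lg.sub (((lmul _ continuous_const).add (lf₁.smul (h : ℂ))).add
        (lmul _ (continuous_coe_dphi hM)))) fun χ hχ => ?_
      have m0 := hχ.memLp hM
      have m1 := hχ.memLp_continuous_mul hM (continuous_coe_dphi hM)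
      have m2 := (hχ.dY hM).memLp hM
      have i0 : Integrable (fun y => f y * χ y) volume := (Lp.memLp f).integrable_mul m0
      have i1 : Integrable (fun y => f y * (M.dphi y * χ y)) volume :=
        (Lp.memLp f).integrable_mul m1
      have i2 : Integrable (fun y => f y * M.dY χ y) volume := (Lp.memLp f).integrable_mul m2
      have i3 : Integrable (fun y => f₁ y * χ y) volume := (Lp.memLp f₁).integrable_mul m0
      have i4 : Integrable (fun y => g y * χ y) volume := (Lp.memLp g).integrable_mul m0
      have e1 := hW χ hχ
      have e2 : ∫ y, f y * (((h * k : ℂ) + M.dphi y) * χ y - h * M.dY χ y)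
          = (h * k) * (∫ y, f y * χ y) + (∫ y, f y * (M.dphi y * χ y)) - h * ∫ y, f y * M.dY χ y := by
        refine (integral_congr_ae (Filter.Eventually.of_forall fun y => ?_)).trans
          ((integral_linear_comb₃ i0 i1 i2 (h * k) 1 (-h)).trans (by ring))
        ring
      have e3 : ∫ y, (g y - ((h * k : ℂ) * f y + h * f₁ y + M.dphi y * f y)) * χ y
          = (∫ y, g y * χ y) - ((h * k) * (∫ y, f y * χ y) + h * (∫ y, f₁ y * χ y)
            + ∫ y, f y * (M.dphi y * χ y)) := by
        have i5 : Integrable (fun y => (h * k : ℂ) * (f y * χ y) + h * (f₁ y * χ y)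
            + 1 * (f y * (M.dphi y * χ y))) volume :=
          ((i0.const_mul _).add (i3.const_mul _)).add (i1.const_mul _)
        rw [← one_mul (∫ y, f y * (M.dphi y * χ y)), ← integral_linear_comb₃ i0 i3 i1,
          ← integral_sub i4 i5]
        refine integral_congr_ae (Filter.Eventually.of_forall fun y => ?_)
        simp only
        ring
      have e4 := hD χ hχ
      rw [e3]
      rw [e2] at e1
      linear_combination (-1 : ℂ) * e1 - h * e4
    filter_upwards [h1] with y hy
    exact sub_eq_zero.1 hy

theorem IsTest.isWeakD (hM : M.IsRegular) {χ : Y → ℂ} (hχ : M.IsTest χ) :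
    M.IsWeakD ((hχ.memLp hM).toLp _) (((hχ.dY hM).memLp hM).toLp _) := by
  intro η hη
  have h0 := hM.integral_dY _ (hη.mul hχ.1)
  have h1 : ∀ y, M.dY (fun y => χ y * η y) y = χ y * M.dY η y + M.dY χ y * η y := by
    intro y
    obtain ⟨s, rfl⟩ := hM.quotient.surjective y
    rw [dY_cover, dY_cover, dY_cover, deriv_fun_mul (hχ.1.differentiable (by simp) s)
      (hη.1.differentiable (by simp) s)]
    ring
  simp_rw [h1] at h0
  have i1 : Integrable (fun y => χ y * M.dY η y) volume :=
    (hχ.memLp hM).integrable_mul ((hη.dY hM).memLp hM)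
  have i2 : Integrable (fun y => M.dY χ y * η y) volume :=
    ((hχ.dY hM).memLp hM).integrable_mul (hη.memLp hM)
  rw [integral_add i1 i2] at h0
  have e1 : ∫ y, ((hχ.memLp hM).toLp _ : Lp ℂ 2 (volume : Measure Y)) y * M.dY η y
      = ∫ y, χ y * M.dY η y := by
    refine integral_congr_ae ?_
    filter_upwards [(hχ.memLp hM).coeFn_toLp] with y hy
    rw [hy]
  have e2 : ∫ y, (((hχ.dY hM).memLp hM).toLp _ : Lp ℂ 2 (volume : Measure Y)) y * η y
      = ∫ y, M.dY χ y * η y := by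
    refine integral_congr_ae ?_
    filter_upwards [((hχ.dY hM).memLp hM).coeFn_toLp] with y hy
    rw [hy]
  rw [e1, e2]
  linear_combination h0

theorem IsTest.memLp_fiberP (hM : M.IsRegular) (h : ℝ) (k : ℤ) {χ : Y → ℂ} (hχ : M.IsTest χ) :
    MemLp (M.fiberP h k χ) 2 volume :=
  (((hχ.memLp hM).const_mul _).add (((hχ.dY hM).memLp hM).const_mul _)).add
    (hχ.memLp_continuous_mul hM (continuous_coe_dphi hM))

theorem IsTest.isPPair (hM : M.IsRegular) (h : ℝ) (k : ℤ) {χ : Y → ℂ} (hχ : M.IsTest χ) :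
    M.IsPPair h (tensor Y k ((hχ.memLp hM).toLp _))
      (tensor Y k ((hχ.memLp_fiberP hM h k).toLp _)) := by
  refine isPPair_tensor hM h k ?_ (hχ.isWeakD hM) ?_
  · refine (hχ.memLp_continuous_mul hM
      (Complex.continuous_ofReal.comp hM.continuous_weight)).ae_eq ?_
    filter_upwards [(hχ.memLp hM).coeFn_toLp] with y hy
    rw [hy]; rfl
  · filter_upwards [(hχ.memLp hM).coeFn_toLp, ((hχ.dY hM).memLp hM).coeFn_toLp,
      (hχ.memLp_fiberP hM h k).coeFn_toLp] with y h1 h2 h3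
    rw [h1, h2, h3, fiberP]

end Model
end

noncomputable section

/-! ## The fibers of `P* P` -/

namespace Model

variable {Y : Type} [AddCommGroup Y] [TopologicalSpace Y] [IsTopologicalAddGroup Y] [T2Space Y]
  [LocallyCompactSpace Y] [MeasureSpace Y] [BorelSpace Y] [SecondCountableTopology Y]
  [IsFiniteMeasureOnCompacts (volume : Measure Y)] [SigmaFinite (volume : Measure Y)]
  {M : Model Y}

variable (M) in
/-- The graph of the closure of `P`. -/
def graphP (h : ℝ) : Submodule ℂ
    (Lp ℂ 2 (volume : Measure (S1 × Y)) × Lp ℂ 2 (volume : Measure (S1 × Y))) :=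
  (Submodule.span ℂ {q : Lp ℂ 2 (volume : Measure (S1 × Y)) × Lp ℂ 2 (volume : Measure (S1 × Y)) |
    M.IsPPair h q.1 q.2}).topologicalClosure

/-- A closed linear condition which holds for the pairs `(u, P u)` holds on `graphP`. -/
theorem graphP_le {h : ℝ} {S : Submodule ℂ
    (Lp ℂ 2 (volume : Measure (S1 × Y)) × Lp ℂ 2 (volume : Measure (S1 × Y)))}
    (hS : IsClosed (S : Set (Lp ℂ 2 (volume : Measure (S1 × Y)) ×
      Lp ℂ 2 (volume : Measure (S1 × Y)))))
    (hP : ∀ u v, M.IsPPair h u v → (u, v) ∈ S) : M.graphP h ≤ S :=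
  Submodule.topologicalClosure_minimal _ (Submodule.span_le.2 fun q hq => hP q.1 q.2 hq) hS

theorem mem_graphP_of_isPPair {h : ℝ} {u v : Lp ℂ 2 (volume : Measure (S1 × Y))}
    (huv : M.IsPPair h u v) : (u, v) ∈ M.graphP h :=
  Submodule.le_topologicalClosure _ (Submodule.subset_span huv)

/-- The distributional equation is the vanishing of continuous functionals of `(u, v)`, hence it
survives passage to the closure of the graph. -/
theorem isFiberPair_of_mem_graphP (hM : M.IsRegular) {h : ℝ}
    {p : Lp ℂ 2 (volume : Measure (S1 × Y)) × Lp ℂ 2 (volume : Measure (S1 × Y))}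
    (hp : p ∈ M.graphP h) (k : ℤ) :
    M.IsFiberPair h k (coord (tensor Y) k p.1) (coord (tensor Y) k p.2) := by
  refine (isFiberPair_iff hM h k _ _).2 fun χ hχ => ?_
  let l : (Lp ℂ 2 (volume : Measure (S1 × Y)) × Lp ℂ 2 (volume : Measure (S1 × Y))) →L[ℂ] ℂ :=
    ((pairing (hχ.memLp_fiber hM h k)).comp (coord (tensor Y) k)).comp
        (ContinuousLinearMap.fst ℂ _ _)
      - ((pairing (hχ.memLp hM)).comp (coord (tensor Y) k)).comp (ContinuousLinearMap.snd ℂ _ _)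
  have hl : M.graphP h ≤ LinearMap.ker (l : _ →ₗ[ℂ] ℂ) := by
    refine graphP_le l.isClosed_ker fun u v huv => ?_
    exact sub_eq_zero.2 ((isFiberPair_iff hM h k _ _).1 (huv.isFiberPair hM k) χ hχ)
  exact sub_eq_zero.1 (hl hp)

theorem eq_zero_of_isFiberPair (hM : M.IsRegular) {h : ℝ} {k : ℤ}
    {g : Lp ℂ 2 (volume : Measure Y)} (hg : M.IsFiberPair h k 0 g) : g = 0 := by
  have : (g : Y → ℂ) =ᵐ[volume] 0 := by
    refine ae_eq_zero_of_test hM ((Lp.memLp g).locallyIntegrable (by norm_num)) fun χ hχ => ?_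
    rw [← hg χ hχ]
    refine integral_eq_zero_of_ae ?_
    filter_upwards [Lp.coeFn_zero ℂ 2 (volume : Measure Y)] with y hy
    rw [hy]; simp
  exact Lp.ext (this.trans (Lp.coeFn_zero _ _ _).symm)

/-- This is the closability of `P`: in every mode the distributional equation determines `P u` from
`u`. It also ensures that the spans and closures used here are graphs, so that
`Submodule.toLinearPMap` returns the intended operators. -/
theorem snd_eq_zero_of_mem_graphP (hM : M.IsRegular) {h : ℝ}
    {p : Lp ℂ 2 (volume : Measure (S1 × Y)) × Lp ℂ 2 (volume : Measure (S1 × Y))}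
    (hp : p ∈ M.graphP h) (h0 : p.1 = 0) : p.2 = 0 := by
  refine eq_zero_of_coord _ fun k => ?_
  have := isFiberPair_of_mem_graphP hM hp k
  rw [h0, map_zero] at this
  exact eq_zero_of_isFiberPair hM this

theorem graph_closure_opP (hM : M.IsRegular) (h : ℝ) : (M.opP h).closure.graph = M.graphP h := by
  have h1 : (M.opP h).graph = Submodule.span ℂ {q | M.IsPPair h q.1 q.2} :=
    Submodule.toLinearPMap_graph_eq _ fun p hp h0 =>
      snd_eq_zero_of_mem_graphP hM (Submodule.le_topologicalClosure _ hp) h0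
  have h2 : (M.opP h).IsClosable := by
    refine ⟨(M.graphP h).toLinearPMap, ?_⟩
    rw [Submodule.toLinearPMap_graph_eq _ fun p hp h0 => snd_eq_zero_of_mem_graphP hM hp h0, h1]
    rfl
  rw [← h2.graph_closure_eq_closure_graph, h1]
  rfl

theorem isClosed_graphP (h : ℝ) : IsClosed (M.graphP h : Set
    (Lp ℂ 2 (volume : Measure (S1 × Y)) × Lp ℂ 2 (volume : Measure (S1 × Y)))) :=
  Submodule.isClosed_topologicalClosure _

theorem graphP_reduce (hM : M.IsRegular) (h : ℝ) : ∀ p ∈ M.graphP h, ∀ k,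
    (tensor Y k (coord (tensor Y) k p.1), tensor Y k (coord (tensor Y) k p.2)) ∈ M.graphP h := by
  intro p hp k
  let L : Lp ℂ 2 (volume : Measure (S1 × Y)) →L[ℂ] Lp ℂ 2 (volume : Measure (S1 × Y)) :=
    (tensor Y k).toContinuousLinearMap.comp (coord (tensor Y) k)
  have hl : M.graphP h ≤ (M.graphP h).comap ((L.prodMap L : _ →L[ℂ] _) : _ →ₗ[ℂ] _) :=
    graphP_le ((isClosed_graphP h).preimage (L.prodMap L).continuous)
      fun u v huv => mem_graphP_of_isPPair (huv.reduce hM k)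
  exact hl hp

theorem isFiberPair_of_mem_fiberGraph (hM : M.IsRegular) {h : ℝ} {k : ℤ}
    {p : Lp ℂ 2 (volume : Measure Y) × Lp ℂ 2 (volume : Measure Y)}
    (hp : p ∈ fiberGraph (M.graphP h) (tensor Y) k) : M.IsFiberPair h k p.1 p.2 := by
  have := isFiberPair_of_mem_graphP hM (mem_fiberGraph.1 hp) k
  rwa [coord_self, coord_self] at this

theorem IsTest.mem_fiberGraph (hM : M.IsRegular) (h : ℝ) (k : ℤ) {χ : Y → ℂ} (hχ : M.IsTest χ) :
    ((hχ.memLp hM).toLp _, (hχ.memLp_fiberP hM h k).toLp _) ∈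
      fiberGraph (M.graphP h) (tensor Y) k :=
  mem_graphP_of_isPPair (hχ.isPPair hM h k)

theorem IsTest.conj {χ : Y → ℂ} (hχ : M.IsTest χ) :
    M.IsTest fun y => (starRingEnd ℂ) (χ y) :=
  ⟨Complex.conjCLE.contDiff.comp hχ.1, hχ.2.comp_left (map_zero _)⟩

/-- The domain contains the products of characters in `x` and test functions in `y`; a vector
orthogonal to all of these has vanishing Fourier coefficients. -/
theorem dense_domain_closure_opP (hM : M.IsRegular) (h : ℝ) :
    Dense ((M.opP h).closure.domain : Set (Lp ℂ 2 (volume : Measure (S1 × Y)))) := by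
  rw [Submodule.dense_iff_topologicalClosure_eq_top,
    Submodule.topologicalClosure_eq_top_iff, Submodule.eq_bot_iff]
  intro u hu
  refine eq_zero_of_coord u fun k => ?_
  have : (coord (tensor Y) k u : Y → ℂ) =ᵐ[volume] 0 := by
    refine ae_eq_zero_of_test hM ((Lp.memLp _).locallyIntegrable (by norm_num)) fun χ hχ => ?_
    have hc := hχ.conj
    have h1 : tensor Y k ((hc.memLp hM).toLp _) ∈ (M.opP h).closure.domain := by
      have h2 := hc.mem_fiberGraph hM h k
      rw [mem_fiberGraph, ← graph_closure_opP hM h] at h2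
      exact LinearPMap.mem_domain_of_mem_graph h2
    have h3 := (Submodule.mem_orthogonal _ _).1 hu _ h1
    rw [← inner_coord, L2.inner_def] at h3
    rw [← h3]
    refine integral_congr_ae ?_
    filter_upwards [(hc.memLp hM).coeFn_toLp] with y hy
    rw [hy, RCLike.inner_apply, Complex.conj_conj]
  exact Lp.ext (this.trans (Lp.coeFn_zero _ _ _).symm)

/-- The decomposition of `P* P` into its fibers, under the hypothesis that in each fiber at most
one eigenvalue is `≤ τ`. -/
theorem exists_isFibered (hM : M.IsRegular) (h : ℝ) {s τ : ℝ} (hτ : 0 ≤ τ) (hs : τ < s)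
    (hG : ∀ k, ∀ p ∈ fiberGraph (M.graphP h) (tensor Y) k,
      ∀ q ∈ fiberGraph (M.graphP h) (tensor Y) k, ∃ c d : ℂ, (c ≠ 0 ∨ d ≠ 0) ∧
        s * ‖c • p.1 + d • q.1‖ ^ 2 ≤ ‖c • p.2 + d • q.2‖ ^ 2) :
    ∃ Q μ e, IsFibered (M.opPstarP h) (M.graphP h) Q (tensor Y) τ μ e := by
  obtain ⟨Q, hQ⟩ := exists_isGraphResolvent (M.graphP h) (isClosed_graphP h)
  have hb : ∀ k, ∃ μ e, IsBottom (fiberGraph (M.graphP h) (tensor Y) k)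
      (fiberOp Q (tensor Y) k) τ μ e := fun k =>
    exists_isBottom (hQ.fiber (graphP_reduce hM h) k) hτ hs (hG k)
  choose μ e hμ using hb
  refine ⟨Q, μ, e, fun u z => ?_, hQ, orthogonalFamily_tensor, eq_zero_of_coord,
    graphP_reduce hM h, hμ⟩
  rw [opPstarP, unboundedComp_adjoint_apply_iff (dense_domain_closure_opP hM h),
    graph_closure_opP hM h]
  constructor
  · rintro ⟨v, hv⟩
    obtain ⟨v', hv'⟩ := hQ (u + z)
    exact (hv'.unique hv).1
  · intro hu
    obtain ⟨v', hv'⟩ := hQ (u + z)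
    rw [hu] at hv'
    exact ⟨v', hv'⟩

end Model
end

noncomputable section

/-! ## Solutions of the ordinary differential equation in a fiber -/

theorem integral_eq_intervalIntegral_of_support {E : Type} [NormedAddCommGroup E] [NormedSpace ℝ E]
    {f : ℝ → E} {R : ℝ} (h : ∀ s, R ≤ |s| → f s = 0) : ∫ s, f s = ∫ s in (-R)..R, f s := by
  refine (intervalIntegral.integral_eq_integral_of_support_subset fun s hs => ?_).symm
  by_contra hn
  refine hs (h s ?_)
  by_contra hlt
  have := abs_lt.1 (not_le.1 hlt)
  exact hn ⟨this.1, this.2.le⟩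

theorem HasCompactSupport.exists_radius {E : Type} [NormedAddCommGroup E] {f : ℝ → E}
    (hf : HasCompactSupport f) : ∃ R > 0, ∀ s, R ≤ |s| → f s = 0 := by
  obtain ⟨R, hR⟩ := hf.isCompact.isBounded.subset_ball 0
  refine ⟨max R 1, lt_max_of_lt_right one_pos, fun s hs => ?_⟩
  by_contra hn
  have := hR (subset_tsupport _ hn)
  rw [Metric.mem_ball, dist_zero_right, Real.norm_eq_abs] at this
  exact absurd (this.trans_le (le_max_left _ _)) (not_lt.2 hs)

/-- Integration by parts for the primitive of a locally integrable function. -/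
theorem integral_primitive_mul_deriv {B : ℝ → ℝ} (hB : LocallyIntegrable B volume) {η : ℝ → ℝ}
    (hη : ContDiff ℝ ∞ η) (hη' : HasCompactSupport η) :
    ∫ s, (∫ t in (0 : ℝ)..s, B t) * deriv η s = -∫ s, B s * η s := by
  have hBi : ∀ a b, IntervalIntegrable B volume a b := fun a b =>
    (hB.integrableOn_isCompact isCompact_uIcc).intervalIntegrable
  obtain ⟨R, hR, hz⟩ := hη'.exists_radius
  obtain ⟨R', hR', hz'⟩ := hη'.deriv.exists_radius
  set r := max R R'
  have hr : ∀ s, r ≤ |s| → η s = 0 := fun s hs => hz s ((le_max_left _ _).trans hs)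
  have hr' : ∀ s, r ≤ |s| → deriv η s = 0 := fun s hs => hz' s ((le_max_right _ _).trans hs)
  have hr0 : 0 < r := lt_max_of_lt_left hR
  rw [integral_eq_intervalIntegral_of_support (R := r) fun s hs => by rw [hr' s hs, mul_zero],
    integral_eq_intervalIntegral_of_support (R := r) fun s hs => by rw [hr s hs, mul_zero]]
  have h0 : (0 : ℝ) ∈ uIcc (-r) r := by rw [uIcc_of_le (by linarith)]; constructor <;> linarith
  have hac := (hBi (-r) r).absolutelyContinuousOnInterval_intervalIntegral h0
  have hac' : AbsolutelyContinuousOnInterval η (-r) r :=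
    (hη.of_le (by simp)).contDiffOn.absolutelyContinuousOnInterval
  rw [hac.integral_mul_deriv_eq_deriv_mul hac', hr r (le_abs_self r),
    hr (-r) (by rw [abs_neg]; exact le_abs_self r), mul_zero, mul_zero, sub_zero, zero_sub]
  congr 1
  refine intervalIntegral.integral_congr_ae ?_
  filter_upwards [(hBi (-r) r).ae_hasDerivAt_integral] with s hs hs'
  rw [(hs (uIoc_subset_uIcc hs') 0 h0).deriv]

/-- The lemma of du Bois-Reymond: after subtraction of a multiple of a fixed bump of integral one, a
test function has integral zero, so its primitive is again a test function. The constant is the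
integral of `D` against the bump. -/
theorem exists_const_of_integral_deriv {D : ℝ → ℝ} (hD : LocallyIntegrable D volume)
    (h : ∀ η : ℝ → ℝ, ContDiff ℝ ∞ η → HasCompactSupport η → ∫ s, D s * deriv η s = 0) :
    ∃ c, ∀ᵐ s, D s = c := by
  let b : ContDiffBump (0 : ℝ) := ⟨1, 2, one_pos, by norm_num⟩
  let η₀ : ℝ → ℝ := b.normed volume
  have hη₀ : ContDiff ℝ ∞ η₀ := b.contDiff_normed
  have hη₀' : HasCompactSupport η₀ := b.hasCompactSupport_normed
  have int : ∀ η : ℝ → ℝ, Continuous η → HasCompactSupport η → Integrable (fun s => D s * η s) := by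
    intro η hη hη'
    simpa only [smul_eq_mul, mul_comm] using
      hD.integrable_smul_left_of_hasCompactSupport hη hη'
  set c := ∫ s, D s * η₀ s
  refine ⟨c, ?_⟩
  have key : ∀ᵐ s, D s - c = 0 := by
    refine ae_eq_zero_of_integral_contDiff_smul_eq_zero
      (hD.sub (continuous_const.locallyIntegrable)) fun η hη hη' => ?_
    set m := ∫ s, η s
    let θ : ℝ → ℝ := fun s => η s - m * η₀ s
    have hθ : ContDiff ℝ ∞ θ := hη.sub (contDiff_const.mul hη₀)
    have hθ' : HasCompactSupport θ := hη'.sub hη₀'.mul_left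
    have iη : Integrable η := hη.continuous.integrable_of_hasCompactSupport hη'
    have iη₀ : Integrable η₀ := hη₀.continuous.integrable_of_hasCompactSupport hη₀'
    have hθ0 : ∫ s, θ s = 0 := by
      rw [integral_sub iη (iη₀.const_mul m), integral_const_mul, b.integral_normed, mul_one, sub_self]
    obtain ⟨R, hR, hz⟩ := hθ'.exists_radius
    let E : ℝ → ℝ := fun s => ∫ t in (-R)..s, θ t
    have hE : ∀ s, HasDerivAt E (θ s) s := fun s =>
      intervalIntegral.integral_hasDerivAt_right (hθ.continuous.intervalIntegrable _ _)
        hθ.continuous.stronglyMeasurable.stronglyMeasurableAtFilter hθ.continuous.continuousAt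
    have hdE : deriv E = θ := funext fun s => (hE s).deriv
    have hEc : ContDiff ℝ ∞ E := contDiff_infty_iff_deriv.2
      ⟨fun s => (hE s).differentiableAt, hdE ▸ hθ⟩
    have hEs : HasCompactSupport E := by
      refine HasCompactSupport.intro (isCompact_Icc (a := -R) (b := R)) fun s hs => ?_
      rcases not_and_or.1 hs with h1 | h1
      · refine intervalIntegral.integral_zero_ae (Filter.Eventually.of_forall fun t ht => hz t ?_)
        rw [uIoc_of_ge (by linarith)] at ht
        exact le_abs.2 (Or.inr (by linarith [ht.2]))
      · have h2 : E s = E R + ∫ t in R..s, θ t :=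
          (intervalIntegral.integral_add_adjacent_intervals (hθ.continuous.intervalIntegrable _ _)
            (hθ.continuous.intervalIntegrable _ _)).symm
        have h3 : E R = 0 := by
          rw [← hθ0]; exact (integral_eq_intervalIntegral_of_support hz).symm
        rw [h2, h3, zero_add]
        refine intervalIntegral.integral_zero_ae (Filter.Eventually.of_forall fun t ht => hz t ?_)
        rw [uIoc_of_le (by linarith)] at ht
        exact le_abs.2 (Or.inl ht.1.le)
    have h1 := h E hEc hEs
    rw [hdE] at h1
    have h2 : ∫ s, D s * θ s = (∫ s, D s * η s) - m * c := by
      rw [← integral_const_mul, ← integral_sub (int η hη.continuous hη')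
        ((int η₀ hη₀.continuous hη₀').const_mul m)]
      refine integral_congr_ae (Filter.Eventually.of_forall fun s => ?_)
      simp only [θ]; ring
    have h3 : ∫ s, η s • (D s - c) = (∫ s, D s * η s) - c * m := by
      rw [← integral_const_mul, ← integral_sub (int η hη.continuous hη') (iη.const_mul c)]
      refine integral_congr_ae (Filter.Eventually.of_forall fun s => ?_)
      simp only [smul_eq_mul]; ring
    rw [h3]
    linarith
  filter_upwards [key] with s hs
  exact sub_eq_zero.1 hs

/-- A locally integrable function whose weak derivative is locally integrable is the primitive
of its weak derivative. -/
theorem exists_eq_primitive_of_weak_deriv {W B : ℝ → ℂ} (hW : LocallyIntegrable W volume)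
    (hB : LocallyIntegrable B volume)
    (h : ∀ η : ℝ → ℝ, ContDiff ℝ ∞ η → HasCompactSupport η →
      ∫ s, W s * (deriv η s : ℝ) = -∫ s, B s * (η s : ℝ)) :
    ∃ c : ℂ, ∀ᵐ s, W s = c + ∫ t in (0 : ℝ)..s, B t := by
  have hBi : ∀ a b, IntervalIntegrable B volume a b := fun a b =>
    (hB.integrableOn_isCompact isCompact_uIcc).intervalIntegrable
  -- The preceding lemmas concern real functions, so real and imaginary parts are treated
  -- separately, each as a real-linear functional.
  have part : ∀ L : ℂ →L[ℝ] ℝ, ∃ c, ∀ᵐ s, L (W s) = c + L (∫ t in (0 : ℝ)..s, B t) := by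
    intro L
    have loc : ∀ f : ℝ → ℂ, LocallyIntegrable f volume →
        LocallyIntegrable (fun s => L (f s)) volume := fun f hf x => by
      obtain ⟨u, hu, hi⟩ := hf x
      exact ⟨u, hu, L.integrable_comp hi⟩
    have hLB := loc B hB
    have hcont : Continuous fun s => ∫ t in (0 : ℝ)..s, L (B t) :=
      intervalIntegral.continuous_primitive (fun a b =>
        (hLB.integrableOn_isCompact isCompact_uIcc).intervalIntegrable) 0
    have mulL : ∀ (z : ℂ) (x : ℝ), L (z * x) = L z * x := fun z x => by
      rw [mul_comm, ← Complex.real_smul, map_smul, smul_eq_mul, mul_comm]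
    have int : ∀ f : ℝ → ℂ, LocallyIntegrable f volume → ∀ η : ℝ → ℝ, Continuous η →
        HasCompactSupport η → Integrable (fun s => f s * (η s : ℝ)) := by
      intro f hf η hη hη'
      have := hf.integrable_smul_left_of_hasCompactSupport hη hη'
      refine this.congr (Filter.Eventually.of_forall fun s => ?_)
      simp only [Complex.real_smul, mul_comm]
    obtain ⟨c, hc⟩ := exists_const_of_integral_deriv
      (D := fun s => L (W s) - ∫ t in (0 : ℝ)..s, L (B t))
      ((loc W hW).sub hcont.locallyIntegrable) (fun η hη hη' => by
        have hd := (contDiff_infty_iff_deriv.1 hη).2.continuous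
        have i1 := int W hW _ hd hη'.deriv
        have i2 := int B hB _ hη.continuous hη'
        have e := congrArg L (h η hη hη')
        rw [map_neg, ← L.integral_comp_comm i1, ← L.integral_comp_comm i2] at e
        simp only [mulL] at e
        have e' := integral_primitive_mul_deriv hLB hη hη'
        have j1 : Integrable (fun s => L (W s) * deriv η s) := by
          simpa only [mulL] using L.integrable_comp i1
        have j2 : Integrable (fun s => (∫ t in (0 : ℝ)..s, L (B t)) * deriv η s) :=
          (hcont.mul hd).integrable_of_hasCompactSupport hη'.deriv.mul_left
        simp only [sub_mul]
        rw [integral_sub j1 j2, e, e', sub_self])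
    refine ⟨c, ?_⟩
    filter_upwards [hc] with s hs
    rw [← L.intervalIntegral_comp_comm (hBi 0 s)]
    linarith
  obtain ⟨c₁, h₁⟩ := part Complex.reCLM
  obtain ⟨c₂, h₂⟩ := part Complex.imCLM
  refine ⟨⟨c₁, c₂⟩, ?_⟩
  filter_upwards [h₁, h₂] with s e₁ e₂
  exact Complex.ext e₁ e₂

namespace Model

variable {Y : Type} [AddCommGroup Y] [TopologicalSpace Y] [IsTopologicalAddGroup Y] [T2Space Y]
  [LocallyCompactSpace Y] [MeasureSpace Y] [BorelSpace Y] [SecondCountableTopology Y]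
  [IsFiniteMeasureOnCompacts (volume : Measure Y)] [SigmaFinite (volume : Measure Y)]
  {M : Model Y}

variable (M) in
/-- The phase `Φ(s) = ξ s + φ(s)`; the equation `(ξ + h ∂_y + φ') f = g` is
`h ∂_y (e^{Φ / h} f) = e^{Φ / h} g`. -/
def phase (ξ : ℝ) (s : ℝ) : ℝ := ξ * s + M.phi (M.cover s)

theorem contDiff_phase (hM : M.IsRegular) (ξ : ℝ) : ContDiff ℝ ∞ (M.phase ξ) :=
  (contDiff_const.mul contDiff_id).add hM.contDiff_phi

theorem deriv_phase (hM : M.IsRegular) (ξ s : ℝ) :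
    HasDerivAt (M.phase ξ) (ξ + M.dphi (M.cover s)) s := by
  have h1 : HasDerivAt (fun s => M.phi (M.cover s)) (M.dphi (M.cover s)) s := by
    rw [dphi, dY_cover]
    exact (hM.contDiff_phi.differentiable (by simp) s).hasDerivAt
  have h2 : HasDerivAt (fun s : ℝ => ξ * s) ξ s := by
    simpa using (hasDerivAt_id s).const_mul ξ
  exact h2.add h1

variable (M) in
/-- `U` is a continuous solution of `(ξ + h ∂_y + φ') U = g`. -/
structure IsSolution (h ξ : ℝ) (U g : Y → ℂ) : Prop where
  continuous : Continuous U
  intervalIntegrable : ∀ a b,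
    IntervalIntegrable (fun s => (Real.exp (M.phase ξ s / h) : ℂ) * g (M.cover s)) volume a b
  sub_eq : ∀ a b, (Real.exp (M.phase ξ b / h) : ℂ) * U (M.cover b)
    - (Real.exp (M.phase ξ a / h) : ℂ) * U (M.cover a)
      = (h : ℂ)⁻¹ * ∫ s in a..b, (Real.exp (M.phase ξ s / h) : ℂ) * g (M.cover s)

/-- With `ρ = e^{Φ/h}` the equation becomes `(ρ f)' = h⁻¹ ρ g`. On the circle `ρ` need not be
periodic, so one works on the covering line: for a test function `η` there, `ρ η` is pushed down to
`Y` and inserted in the weak equation. Thus `ρ f` is a primitive of `h⁻¹ ρ g`, and dividing by `ρ`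
gives a continuous representative. -/
theorem IsFiberPair.exists_isSolution (hM : M.IsRegular) {h : ℝ} (hh : 0 < h) {k : ℤ}
    {f g : Lp ℂ 2 (volume : Measure Y)} (hfg : M.IsFiberPair h k f g) :
    ∃ U : Y → ℂ, f =ᵐ[volume] U ∧ M.IsSolution h (h * k) U g := by
  have hh' : (h : ℂ) ≠ 0 := Complex.ofReal_ne_zero.2 hh.ne'
  have lf : LocallyIntegrable (fun y => f y) volume := (Lp.memLp f).locallyIntegrable (by norm_num)
  have lg : LocallyIntegrable (fun y => g y) volume := (Lp.memLp g).locallyIntegrable (by norm_num)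
  have cont_mul : ∀ (a : ℝ → ℂ) (F : ℝ → ℂ), Continuous a → LocallyIntegrable F volume →
      LocallyIntegrable (fun s => a s * F s) volume := by
    intro a F ha hF
    rw [← locallyIntegrableOn_univ] at hF ⊢
    exact hF.continuousOn_mul ha.continuousOn isOpen_univ.isLocallyClosed
  set Φ := M.phase (h * k)
  have hΦ : ContDiff ℝ ∞ Φ := contDiff_phase hM _
  let ρ : ℝ → ℂ := fun s => (Real.exp (Φ s / h) : ℂ)
  have hρ : ContDiff ℝ ∞ ρ :=
    Complex.ofRealCLM.contDiff.comp (Real.contDiff_exp.comp (hΦ.div_const h))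
  have lF := hM.locallyIntegrable _ lf
  have lG := hM.locallyIntegrable _ lg
  have lW := cont_mul ρ _ hρ.continuous lF
  have lB := cont_mul ρ _ hρ.continuous lG
  have lB' : LocallyIntegrable (fun s => (h : ℂ)⁻¹ * (ρ s * g (M.cover s))) volume :=
    cont_mul _ _ continuous_const lB
  have hρd : ∀ s, HasDerivAt ρ ((h : ℂ)⁻¹ * (h * k + M.dphi (M.cover s)) * ρ s) s := by
    intro s
    have := (((deriv_phase hM (h * k) s).div_const h).exp).ofReal_comp
    refine this.congr_deriv ?_
    simp only [ρ, Φ]; push_cast; field_simp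
  obtain ⟨c, hc⟩ := exists_eq_primitive_of_weak_deriv lW lB' (fun η hη hη' => by
    let ψ : ℝ → ℂ := fun s => ρ s * (η s : ℝ)
    have hηc : ContDiff ℝ ∞ fun s => ((η s : ℝ) : ℂ) := Complex.ofRealCLM.contDiff.comp hη
    have hψ : ContDiff ℝ ∞ ψ := hρ.mul hηc
    have hψ' : HasCompactSupport ψ := (hη'.comp_left Complex.ofReal_zero).mul_left
    obtain ⟨χ, hχ, hχ'⟩ := hM.exists_push ψ hψ hψ'
    have e0 := hfg χ hχ
    have m0 := hχ.memLp hM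
    have hcd : Continuous fun y => ((h * k : ℂ) + M.dphi y) :=
      continuous_const.add (continuous_coe_dphi hM)
    have m1 := hχ.memLp_continuous_mul hM hcd
    have i1 : Integrable (fun y => f y * (((h * k : ℂ) + M.dphi y) * χ y)) volume :=
      (Lp.memLp f).integrable_mul m1
    have i2 : Integrable (fun y => f y * M.dY χ y) volume :=
      (Lp.memLp f).integrable_mul ((hχ.dY hM).memLp hM)
    have e1 : ∫ y, f y * (((h * k : ℂ) + M.dphi y) * χ y - h * M.dY χ y)
        = (∫ y, (((h * k : ℂ) + M.dphi y) * f y) * χ y) - h * ∫ y, f y * M.dY χ y := by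
      rw [← integral_const_mul]
      have i1' : Integrable (fun y => (((h * k : ℂ) + M.dphi y) * f y) * χ y) volume :=
        i1.congr (Filter.Eventually.of_forall fun y => by simp only; ring)
      rw [← integral_sub i1' (i2.const_mul _)]
      refine integral_congr_ae (Filter.Eventually.of_forall fun y => ?_)
      simp only; ring
    have lf' : LocallyIntegrable (fun y => ((h * k : ℂ) + M.dphi y) * f y) volume := by
      rw [← locallyIntegrableOn_univ] at lf ⊢
      exact lf.continuousOn_mul hcd.continuousOn
        isOpen_univ.isLocallyClosed
    rw [e1, (hχ' _ lf').1, (hχ' _ lf).2, (hχ' _ lg).1] at e0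
    have hψd : ∀ s, deriv ψ s = (h : ℂ)⁻¹ * (h * k + M.dphi (M.cover s)) * ψ s
        + ρ s * (deriv η s : ℝ) := by
      intro s
      have h2 := ((hη.differentiable (by simp) s).hasDerivAt).ofReal_comp
      have h3 : HasDerivAt ψ _ s := (hρd s).mul h2
      rw [h3.deriv]
      simp only [ψ]; ring
    have lint : ∀ F : ℝ → ℂ, LocallyIntegrable F volume → ∀ ζ : ℝ → ℂ, Continuous ζ →
        HasCompactSupport ζ → Integrable (fun s => F s * ζ s) := by
      intro F hF ζ hζ hζ'
      have := hF.integrable_smul_left_of_hasCompactSupport hζ hζ'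
      refine this.congr (Filter.Eventually.of_forall fun s => ?_)
      simp only [smul_eq_mul, mul_comm]
    have j1 := lint _ (hM.locallyIntegrable _ lf') ψ hψ.continuous hψ'
    have j2 := lint _ lF (deriv ψ) (contDiff_infty_iff_deriv.1 hψ).2.continuous hψ'.deriv
    have e2 : (∫ s, ((h * k : ℂ) + M.dphi (M.cover s)) * f (M.cover s) * ψ s)
        - h * ∫ s, f (M.cover s) * deriv ψ s
        = -h * ∫ s, ρ s * f (M.cover s) * (deriv η s : ℝ) := by
      rw [← integral_const_mul, ← integral_sub j1 (j2.const_mul _), ← integral_const_mul]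
      refine integral_congr_ae (Filter.Eventually.of_forall fun s => ?_)
      simp only
      rw [hψd]
      field_simp
      ring
    rw [e2] at e0
    have e3 : ∫ s, (h : ℂ)⁻¹ * (ρ s * g (M.cover s)) * (η s : ℝ)
        = (h : ℂ)⁻¹ * ∫ s, g (M.cover s) * ψ s := by
      rw [← integral_const_mul]
      refine integral_congr_ae (Filter.Eventually.of_forall fun s => ?_)
      simp only [ψ]; ring
    rw [e3, ← e0]
    field_simp)
  have hBi : ∀ a b, IntervalIntegrable (fun s => ρ s * g (M.cover s)) volume a b := fun a b =>
    (lB.integrableOn_isCompact isCompact_uIcc).intervalIntegrable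
  simp only [intervalIntegral.integral_const_mul] at hc
  let V : ℝ → ℂ := fun s => (ρ s)⁻¹ * (c + (h : ℂ)⁻¹ * ∫ t in (0 : ℝ)..s, ρ t * g (M.cover t))
  have hρ0 : ∀ s, ρ s ≠ 0 := fun s => Complex.ofReal_ne_zero.2 (Real.exp_pos _).ne'
  have hV : Continuous V := (hρ.continuous.inv₀ hρ0).mul (continuous_const.add
    (continuous_const.mul (intervalIntegral.continuous_primitive hBi 0)))
  have hVF : ∀ᵐ s, f (M.cover s) = V s := by
    filter_upwards [hc] with s hs
    simp only [V]
    rw [← hs, inv_mul_cancel_left₀ (hρ0 s)]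
  -- The representative `V` descends to `Y`: it agrees almost everywhere with the lift of `f`, which
  -- is invariant under deck translations, and it is continuous.
  have hper : ∀ a b, M.cover a = M.cover b → V a = V b := by
    intro a b hab
    have hs := (measurePreserving_add_right volume (b - a)).quasiMeasurePreserving.ae hVF
    have : ∀ᵐ s : ℝ, V s = V (s + (b - a)) := by
      filter_upwards [hVF, hs] with s h1 h2
      rw [← h1, ← h2, map_add, map_sub, hab, sub_self, add_zero]
    have heq := Continuous.ae_eq_iff_eq volume hV
      (hV.comp (continuous_id.add continuous_const)) |>.1 this
    have := congrFun heq a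
    simpa using this
  let U : Y → ℂ := fun y => V (Function.surjInv hM.quotient.surjective y)
  have hU : ∀ s, U (M.cover s) = V s := fun s =>
    hper _ _ (Function.surjInv_eq hM.quotient.surjective _)
  refine ⟨U, ?_, ⟨?_, hBi, fun a b => ?_⟩⟩
  · refine (hM.ae_cover fun y => f y = U y).2 ?_
    filter_upwards [hVF] with s hs
    rw [hs, hU]
  · refine (hM.quotient.isQuotientMap.continuous_iff).2 ?_
    exact hV.congr fun s => (hU s).symm
  · rw [hU, hU]
    change ρ b * V b - ρ a * V a = _
    simp only [V]
    rw [mul_inv_cancel_left₀ (hρ0 b), mul_inv_cancel_left₀ (hρ0 a),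
      ← intervalIntegral.integral_interval_sub_left (hBi 0 b) (hBi 0 a)]
    ring

end Model
end

noncomputable section

/-! ## Regularity of the two models -/

theorem isRegular_lineModel : lineModel.IsRegular where
  quotient := IsOpenQuotientMap.id
  ae_cover _ := Iff.rfl
  locallyIntegrable _ hf := hf
  exists_push ψ hψ hψ' := by
    refine ⟨ψ, ⟨hψ, hψ'⟩, fun f _ => ⟨rfl, ?_⟩⟩
    refine integral_congr_ae (Filter.Eventually.of_forall fun y => ?_)
    have : lineModel.dY ψ y = deriv ψ y := Model.dY_cover (M := lineModel) ψ y
    simp only [this]; rfl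
  integral_dY χ hχ := by
    have h1 : ∀ y, lineModel.dY χ y = deriv χ y := fun y => Model.dY_cover (M := lineModel) χ y
    simp_rw [h1]
    have hc : ContDiff ℝ ∞ χ := hχ.1
    obtain ⟨R, hR, hz⟩ := HasCompactSupport.exists_radius hχ.2
    obtain ⟨R', hR', hz'⟩ := HasCompactSupport.exists_radius hχ.2.deriv
    have hd := contDiff_infty_iff_deriv.1 hc
    rw [integral_eq_intervalIntegral_of_support (R := max R R')
      fun s hs => hz' s ((le_max_right _ _).trans hs),
      intervalIntegral.integral_deriv_eq_sub (fun s _ => hd.1 s)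
        (hd.2.continuous.intervalIntegrable _ _), hz, hz, sub_self]
    · rw [abs_neg]; exact (le_max_left _ _).trans (le_abs_self _)
    · exact (le_max_left _ _).trans (le_abs_self _)
  contDiff_phi := (contDiff_id.pow 3).div_const 3
  continuous_weight := continuous_const.add (continuous_id.pow 2)

theorem toS1_eq_coe (s : ℝ) : toS1 s = (s : S1) := rfl

theorem toS1_add_int_mul (s : ℝ) (n : ℤ) : toS1 (s + n * (2 * Real.pi)) = toS1 s := by
  rw [map_add, toS1_eq_coe (n * (2 * Real.pi))]
  have : ((n * (2 * Real.pi) : ℝ) : S1) = 0 := by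
    rw [AddCircle.coe_eq_zero_iff]; exact ⟨n, by simp⟩
  rw [this, add_zero]

theorem toS1_eq_iff {a b : ℝ} : toS1 a = toS1 b ↔ ∃ n : ℤ, a = b + n * (2 * Real.pi) := by
  constructor
  · intro h
    have h0 : ((a - b : ℝ) : S1) = 0 := by
      rw [AddCircle.coe_sub]; exact sub_eq_zero.2 h
    obtain ⟨n, hn⟩ := (AddCircle.coe_eq_zero_iff _).1 h0
    exact ⟨n, by rw [zsmul_eq_mul] at hn; linarith⟩
  · rintro ⟨n, rfl⟩
    exact toS1_add_int_mul b n

/-- The periodization of a function on `ℝ`. -/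
def periodize (ψ : ℝ → ℂ) (y : S1) : ℂ :=
  ∑ᶠ n : ℤ, ψ (repS1 y + n * (2 * Real.pi))

theorem toS1_repS1 (y : S1) : toS1 (repS1 y) = y :=
  (AddCircle.equivIoc (2 * Real.pi) (-Real.pi)).symm_apply_apply y

theorem periodize_toS1 (ψ : ℝ → ℂ) (s : ℝ) :
    periodize ψ (toS1 s) = ∑ᶠ n : ℤ, ψ (s + n * (2 * Real.pi)) := by
  obtain ⟨m, hm⟩ := toS1_eq_iff.1 (toS1_repS1 (toS1 s))
  rw [periodize, hm]
  refine (finsum_comp_equiv (Equiv.addLeft m)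
    (f := fun n : ℤ => ψ (s + n * (2 * Real.pi)))).symm.trans ?_ |>.symm
  refine finsum_congr fun n => ?_
  simp only [Equiv.coe_addLeft]
  congr 1
  push_cast; ring

/-- On a bounded interval only finitely many translates contribute. -/
theorem exists_finset_periodize {ψ : ℝ → ℂ} {R : ℝ} (hz : ∀ s, R ≤ |s| → ψ s = 0) (A : ℝ) :
    ∃ J : Finset ℤ, ∀ s, |s| ≤ A → ∀ n ∉ J, ψ (s + n * (2 * Real.pi)) = 0 := by
  obtain ⟨N, hN⟩ := exists_nat_gt (R + A)
  refine ⟨Finset.Icc (-N) N, fun s hs n hn => hz _ ?_⟩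
  have h1 : (N : ℝ) ≤ |(n : ℝ)| := by
    rw [Finset.mem_Icc, not_and_or] at hn
    rcases hn with h | h
    · rw [not_le] at h
      have : (n : ℝ) < -N := by exact_mod_cast h
      exact (by linarith : (N : ℝ) ≤ -n).trans (neg_le_abs _)
    · rw [not_le] at h
      have : (N : ℝ) < n := by exact_mod_cast h
      exact this.le.trans (le_abs_self _)
  have h2 : |(n : ℝ)| ≤ |n * (2 * Real.pi)| := by
    rw [abs_mul, abs_of_pos Real.two_pi_pos]
    have := Real.pi_gt_three
    nlinarith [abs_nonneg (n : ℝ)]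
  have h3 : |n * (2 * Real.pi)| ≤ |s + n * (2 * Real.pi)| + |s| := by
    have := abs_sub (s + n * (2 * Real.pi)) s
    rwa [add_sub_cancel_left] at this
  linarith

theorem periodize_eq_sum {ψ : ℝ → ℂ} {J : Finset ℤ} {s : ℝ}
    (hJ : ∀ n ∉ J, ψ (s + n * (2 * Real.pi)) = 0) :
    periodize ψ (toS1 s) = ∑ n ∈ J, ψ (s + n * (2 * Real.pi)) := by
  rw [periodize_toS1]
  refine finsum_eq_sum_of_support_subset _ fun n hn => ?_
  by_contra h
  exact hn (hJ n h)

theorem periodize_eventuallyEq {ψ : ℝ → ℂ} (hψ : HasCompactSupport ψ) (s₀ : ℝ) :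
    ∃ J : Finset ℤ, (∀ n ∉ J, ψ (s₀ + n * (2 * Real.pi)) = 0) ∧
      (fun s => periodize ψ (toS1 s)) =ᶠ[nhds s₀] fun s => ∑ n ∈ J, ψ (s + n * (2 * Real.pi)) := by
  obtain ⟨R, -, hz⟩ := hψ.exists_radius
  obtain ⟨J, hJ⟩ := exists_finset_periodize hz (|s₀| + 1)
  refine ⟨J, hJ s₀ (by linarith), ?_⟩
  filter_upwards [(continuous_abs.tendsto s₀).eventually_lt_const (lt_add_one |s₀|)] with s hs
  exact periodize_eq_sum (hJ s hs.le)

theorem isTest_periodize {ψ : ℝ → ℂ} (hψ : ContDiff ℝ ∞ ψ) (hψ' : HasCompactSupport ψ) :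
    circleModel.IsTest (periodize ψ) := by
  refine ⟨contDiff_iff_contDiffAt.2 fun s₀ => ?_, HasCompactSupport.of_compactSpace _⟩
  obtain ⟨J, -, hJ⟩ := periodize_eventuallyEq hψ' s₀
  refine ContDiffAt.congr_of_eventuallyEq ?_ hJ
  exact (ContDiff.sum fun n _ => hψ.comp (contDiff_id.add contDiff_const)).contDiffAt

theorem dY_periodize {ψ : ℝ → ℂ} (hψ : ContDiff ℝ ∞ ψ) (hψ' : HasCompactSupport ψ) (y : S1) :
    circleModel.dY (periodize ψ) y = periodize (deriv ψ) y := by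
  obtain ⟨s, rfl⟩ := isOpenQuotientMap_toS1.surjective y
  have h1 : circleModel.dY (periodize ψ) (toS1 s) = deriv (fun s => periodize ψ (toS1 s)) s :=
    Model.dY_cover (M := circleModel) _ s
  obtain ⟨J', hJ', -⟩ := periodize_eventuallyEq hψ'.deriv s
  obtain ⟨R, -, hR⟩ := hψ'.exists_radius
  obtain ⟨K, hK⟩ := exists_finset_periodize hR (|s| + 1)
  have hK' : (fun s => periodize ψ (toS1 s)) =ᶠ[nhds s]
      fun s => ∑ n ∈ K ∪ J', ψ (s + n * (2 * Real.pi)) := by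
    filter_upwards [(continuous_abs.tendsto s).eventually_lt_const (lt_add_one |s|)] with t ht
    exact periodize_eq_sum fun n hn => hK t ht.le n fun h => hn (Finset.mem_union_left _ h)
  rw [h1, hK'.deriv_eq, periodize_eq_sum (J := K ∪ J')
    fun n hn => hJ' n fun h => hn (Finset.mem_union_right _ h)]
  have hd : ∀ n : ℤ, HasDerivAt (fun s => ψ (s + n * (2 * Real.pi)))
      (deriv ψ (s + n * (2 * Real.pi))) s := fun n =>
    (hψ.differentiable (by simp) _).hasDerivAt.comp_add_const _ _
  exact (HasDerivAt.fun_sum fun n _ => hd n).deriv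

theorem intervalIntegrable_comp_toS1 {f : S1 → ℂ} (hf : LocallyIntegrable f volume) (a b : ℝ) :
    IntervalIntegrable (fun s => f (toS1 s)) volume a b := by
  have hf' : Integrable f volume := integrableOn_univ.1 (hf.integrableOn_isCompact isCompact_univ)
  have h1 : IntervalIntegrable (fun s => f (toS1 s)) volume 0 (0 + 2 * Real.pi) := by
    rw [intervalIntegrable_iff_integrableOn_Ioc_of_le (by linarith [Real.two_pi_pos])]
    exact (AddCircle.measurePreserving_mk (2 * Real.pi) 0).integrable_comp_of_integrable hf'
  refine Function.Periodic.intervalIntegrable (fun s => ?_) Real.two_pi_pos.ne' h1 a b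
  have := toS1_add_int_mul s 1
  rw [Int.cast_one, one_mul] at this
  simp only [this]

theorem locallyIntegrable_comp_toS1 {f : S1 → ℂ} (hf : LocallyIntegrable f volume) :
    LocallyIntegrable (fun s => f (toS1 s)) volume := fun s =>
  ⟨Icc (s - 1) (s + 1), Icc_mem_nhds (by linarith) (by linarith),
    (intervalIntegrable_iff_integrableOn_Icc_of_le (by linarith)).1
      (intervalIntegrable_comp_toS1 hf _ _)⟩

/-- Unfolding: the integral over `ℝ` is cut into periods, which are all translated to `(0, 2π]`.
Only finitely many translates of the compact support contribute. -/
theorem integral_mul_periodize {ψ : ℝ → ℂ} (hψ : Continuous ψ) (hψ' : HasCompactSupport ψ)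
    {f : S1 → ℂ} (hf : LocallyIntegrable f volume) :
    ∫ y, f y * periodize ψ y = ∫ s, f (toS1 s) * ψ s := by
  have hp := Real.two_pi_pos
  obtain ⟨R, -, hz⟩ := hψ'.exists_radius
  obtain ⟨J, hJ⟩ := exists_finset_periodize hz (2 * Real.pi)
  have hint : Integrable (fun s => f (toS1 s) * ψ s) := by
    have := (locallyIntegrable_comp_toS1 hf).integrable_smul_left_of_hasCompactSupport hψ hψ'
    refine this.congr (Filter.Eventually.of_forall fun s => ?_)
    simp only [smul_eq_mul, mul_comm]
  have e1 : ∫ s, f (toS1 s) * ψ s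
      = ∑' n : ℤ, ∫ s in Ioc (n • (2 * Real.pi)) ((n + 1) • (2 * Real.pi)), f (toS1 s) * ψ s := by
    rw [← integral_iUnion (fun _ => measurableSet_Ioc)
      (pairwise_disjoint_Ioc_zsmul (2 * Real.pi)) hint.integrableOn, iUnion_Ioc_zsmul hp,
      setIntegral_univ]
  have e2 : ∀ n : ℤ, ∫ s in Ioc (n • (2 * Real.pi)) ((n + 1) • (2 * Real.pi)), f (toS1 s) * ψ s
      = ∫ s in (0 : ℝ)..0 + 2 * Real.pi, f (toS1 s) * ψ (s + n * (2 * Real.pi)) := by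
    intro n
    have h1 : n • (2 * Real.pi) ≤ (n + 1) • (2 * Real.pi) := by
      simp only [zsmul_eq_mul]; push_cast; nlinarith
    rw [← intervalIntegral.integral_of_le h1]
    have h2 := intervalIntegral.integral_comp_add_right (a := (0 : ℝ)) (b := 0 + 2 * Real.pi)
      (fun s => f (toS1 s) * ψ s) (n * (2 * Real.pi))
    simp only [toS1_add_int_mul] at h2
    rw [h2]
    simp only [zsmul_eq_mul]
    push_cast
    congr 1 <;> ring
  rw [e1]
  simp_rw [e2]
  rw [← AddCircle.intervalIntegral_preimage (2 * Real.pi) 0]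
  have hmem : ∀ s ∈ uIcc (0 : ℝ) (0 + 2 * Real.pi), |s| ≤ 2 * Real.pi := by
    intro s hs
    rw [uIcc_of_le (by linarith), zero_add] at hs
    rw [abs_of_nonneg hs.1]; exact hs.2
  rw [tsum_eq_sum (s := J) fun n hn => by
    refine (intervalIntegral.integral_congr fun s hs => ?_).trans
      (intervalIntegral.integral_zero (a := (0 : ℝ)) (b := 0 + 2 * Real.pi))
    simp only [hJ s (hmem s hs) n hn, mul_zero]]
  have hi : ∀ n ∈ J, IntervalIntegrable (fun s => f (toS1 s) * ψ (s + n * (2 * Real.pi)))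
      volume 0 (0 + 2 * Real.pi) := fun n _ =>
    (intervalIntegrable_comp_toS1 hf _ _).mul_continuousOn
      (hψ.comp (continuous_id.add continuous_const)).continuousOn
  rw [← intervalIntegral.integral_finsetSum hi]
  refine intervalIntegral.integral_congr fun s hs => ?_
  have h3 : periodize ψ (s : S1) = _ := periodize_eq_sum (hJ s (hmem s hs))
  rw [h3, Finset.mul_sum]
  rfl

theorem ae_toS1_iff (p : S1 → Prop) : (∀ᵐ y, p y) ↔ ∀ᵐ s : ℝ, p (toS1 s) := by
  constructor
  · intro h
    have h1 : ∀ n : ℤ, ∀ᵐ s ∂(volume.restrict (Ioc (n • (2 * Real.pi)) ((n + 1) • (2 * Real.pi)))),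
        p (toS1 s) := by
      intro n
      have := (AddCircle.measurePreserving_mk (2 * Real.pi) (n • (2 * Real.pi)))
        |>.quasiMeasurePreserving.ae h
      rwa [add_zsmul, one_zsmul]
    rw [← ae_restrict_iUnion_iff, iUnion_Ioc_zsmul Real.two_pi_pos, Measure.restrict_univ] at h1
    exact h1
  · intro h
    have h2 : ∀ᵐ s ∂(Measure.comap (Subtype.val : Ioc (0 : ℝ) (0 + 2 * Real.pi) → ℝ) volume),
        p (toS1 s.1) := by
      exact (ae_restrict_iff_subtype measurableSet_Ioc).1 (ae_restrict_of_ae h)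
    have h3 := (AddCircle.measurePreserving_equivIoc (T := 2 * Real.pi) (a := 0))
      |>.quasiMeasurePreserving.ae h2
    filter_upwards [h3] with y hy
    have : toS1 ((AddCircle.equivIoc (2 * Real.pi) 0 y : Ioc (0 : ℝ) (0 + 2 * Real.pi)) : ℝ) = y :=
      (AddCircle.equivIoc (2 * Real.pi) 0).symm_apply_apply y
    rwa [this] at hy

theorem circleModel_phi (s : ℝ) : circleModel.phi (toS1 s) = Real.sin s :=
  Real.sin_periodic.lift_coe s

theorem isRegular_circleModel : circleModel.IsRegular where
  quotient := isOpenQuotientMap_toS1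
  ae_cover := ae_toS1_iff
  locallyIntegrable _ hf := locallyIntegrable_comp_toS1 hf
  exists_push ψ hψ hψ' := by
    refine ⟨periodize ψ, isTest_periodize hψ hψ', fun f hf =>
      ⟨integral_mul_periodize hψ.continuous hψ' hf, ?_⟩⟩
    simp only [dY_periodize hψ hψ']
    exact integral_mul_periodize (contDiff_infty_iff_deriv.1 hψ).2.continuous hψ'.deriv hf
  integral_dY χ hχ := integral_dX_eq_zero hχ.1
  contDiff_phi := by
    have : (fun s : ℝ => circleModel.phi (circleModel.cover s)) = Real.sin :=
      funext circleModel_phi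
    rw [this]
    exact Real.contDiff_sin
  continuous_weight := continuous_const

/-! ### The derivatives of `φ` in the two models. -/

theorem lineModel_dphi (y : ℝ) : lineModel.dphi y = y ^ 2 := by
  have h : lineModel.dphi y = deriv (fun s : ℝ => s ^ 3 / 3) y := 
    Model.dY_cover (M := lineModel) lineModel.phi y
  rw [h]
  simp

theorem lineModel_ddphi (y : ℝ) : lineModel.ddphi y = 2 * y := by
  have h : lineModel.ddphi y = deriv (fun s : ℝ => lineModel.dphi s) y := 
    Model.dY_cover (M := lineModel) lineModel.dphi y
  rw [h]
  simp [lineModel_dphi]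

theorem circleModel_dphi (s : ℝ) : circleModel.dphi (toS1 s) = Real.cos s := by
  have h : circleModel.dphi (toS1 s) = deriv (fun s : ℝ => circleModel.phi (toS1 s)) s := 
    Model.dY_cover (M := circleModel) circleModel.phi s
  rw [h]
  simp [circleModel_phi]

theorem circleModel_ddphi (s : ℝ) : circleModel.ddphi (toS1 s) = -Real.sin s := by
  have h : circleModel.ddphi (toS1 s) = deriv (fun s : ℝ => circleModel.dphi (toS1 s)) s := 
    Model.dY_cover (M := circleModel) circleModel.dphi s
  rw [h]
  simp [circleModel_dphi]

end

noncomputable section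

/-! ## Lower bounds from kernel estimates -/

open scoped ENNReal

/-- Cauchy–Schwarz for the factors `k^{1/2}` and `k^{1/2} G`. -/
theorem lintegral_mul_sq_le {k G : ℝ → ℝ≥0∞} (hk : Measurable k) (hG : Measurable G) :
    (∫⁻ d, k d * G d) ^ 2 ≤ (∫⁻ d, k d) * ∫⁻ d, k d * G d ^ 2 := by
  have hs : Measurable fun d => k d ^ (1 / 2 : ℝ) := hk.pow_const _
  have h1 := ENNReal.lintegral_mul_le_Lp_mul_Lq volume Real.HolderConjugate.two_two hs.aemeasurable
    (hs.mul hG).aemeasurable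
  have e1 : ∀ x : ℝ≥0∞, (x ^ (1 / 2 : ℝ)) ^ (2 : ℝ) = x := fun x => by
    rw [← ENNReal.rpow_mul]; norm_num
  have e2 : ∀ x : ℝ≥0∞, x ^ (1 / 2 : ℝ) * x ^ (1 / 2 : ℝ) = x := fun x => by
    rw [← ENNReal.rpow_add_of_nonneg _ _ (by norm_num) (by norm_num)]; norm_num
  simp only [Pi.mul_apply, e1, ENNReal.mul_rpow_of_nonneg _ _ (zero_le_two : (0 : ℝ) ≤ 2),
    ← mul_assoc, e2] at h1
  have h2 : (∫⁻ d, k d * G d) ^ 2 ≤ ((∫⁻ d, k d) ^ (1 / 2 : ℝ)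
      * (∫⁻ d, k d * G d ^ (2 : ℝ)) ^ (1 / 2 : ℝ)) ^ 2 := by gcongr
  refine h2.trans_eq ?_
  rw [mul_pow, sq, sq, e2, e2]
  simp only [ENNReal.rpow_two]

theorem lintegral_enorm_sq {X : Type} [MeasureSpace X] (f : Lp ℂ 2 (volume : Measure X)) :
    ∫⁻ x, ‖f x‖ₑ ^ 2 = ‖f‖ₑ ^ 2 := by
  have := eLpNorm_nnreal_pow_eq_lintegral (f := f) (p := 2) (μ := (volume : Measure X)) two_ne_zero
  rw [Lp.enorm_def]
  simpa using this.symm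

theorem norm_toLp_sq {X : Type} [MeasureSpace X] {f : X → ℂ}
    (hf : MemLp f 2 (volume : Measure X)) : ‖hf.toLp f‖ ^ 2 = ∫ x, ‖f x‖ ^ 2 := by
  have h1 := congrArg Complex.re (inner_self_eq_norm_sq_to_K (𝕜 := ℂ) (hf.toLp f))
  rw [L2.inner_def] at h1
  have h2 : ∫ x, (inner ℂ (hf.toLp f x) (hf.toLp f x) : ℂ) = ((∫ x, ‖f x‖ ^ 2 : ℝ) : ℂ) := by
    rw [← integral_complex_ofReal]
    refine integral_congr_ae ?_
    filter_upwards [hf.coeFn_toLp] with x hx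
    rw [hx, inner_self_eq_norm_sq_to_K]
    simp
  rw [h2, Complex.ofReal_re] at h1
  rw [h1]
  norm_cast

namespace Model

variable {Y : Type} [AddCommGroup Y] [TopologicalSpace Y] [IsTopologicalAddGroup Y] [T2Space Y]
  [LocallyCompactSpace Y] [MeasureSpace Y] [BorelSpace Y] [SecondCountableTopology Y]
  [IsFiniteMeasureOnCompacts (volume : Measure Y)] [SigmaFinite (volume : Measure Y)]
  [(volume : Measure Y).IsAddLeftInvariant]
  {M : Model Y}

/-- Young's inequality for a convolution with an `L¹` kernel: Cauchy–Schwarz in `d`, then Tonelli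
and the translation invariance of the measure on `Y`. The kernel lives on the covering line, so on
the circle its mass is summed over all windings. -/
theorem enorm_le_of_kernel (hM : M.IsRegular) {f g : Lp ℂ 2 (volume : Measure Y)} {U : Y → ℂ}
    (hU : f =ᵐ[volume] U) {k : ℝ → ℝ≥0∞} (hk : Measurable k)
    (h : ∀ y, ‖U y‖ₑ ≤ ∫⁻ d, k d * ‖g (y + M.cover d)‖ₑ) :
    ‖f‖ₑ ≤ (∫⁻ d, k d) * ‖g‖ₑ := by
  have hg : Measurable fun y => ‖g y‖ₑ := (Lp.stronglyMeasurable g).measurable.enorm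
  have hadd : Measurable fun q : Y × ℝ => q.1 + M.cover q.2 :=
    (continuous_fst.add (hM.quotient.continuous.comp continuous_snd)).measurable
  have hgp : Measurable fun q : Y × ℝ => ‖g (q.1 + M.cover q.2)‖ₑ := hg.comp hadd
  have h1 : ‖f‖ₑ ^ 2 ≤ ((∫⁻ d, k d) * ‖g‖ₑ) ^ 2 := by
    calc ‖f‖ₑ ^ 2 = ∫⁻ y, ‖f y‖ₑ ^ 2 := (lintegral_enorm_sq f).symm
      _ = ∫⁻ y, ‖U y‖ₑ ^ 2 := lintegral_congr_ae (by filter_upwards [hU] with y hy; rw [hy])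
      _ ≤ ∫⁻ y, (∫⁻ d, k d) * ∫⁻ d, k d * ‖g (y + M.cover d)‖ₑ ^ 2 := by
          refine lintegral_mono fun y => ?_
          refine (pow_le_pow_left' (h y) 2).trans (lintegral_mul_sq_le hk ?_)
          exact hgp.comp measurable_prodMk_left
      _ = (∫⁻ d, k d) * ∫⁻ y, ∫⁻ d, k d * ‖g (y + M.cover d)‖ₑ ^ 2 := by
          rw [lintegral_const_mul]
          exact Measurable.lintegral_prod_right'
            (f := fun q : Y × ℝ => k q.2 * ‖g (q.1 + M.cover q.2)‖ₑ ^ 2)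
            ((hk.comp measurable_snd).mul (hgp.pow_const 2))
      _ = (∫⁻ d, k d) * ∫⁻ d, ∫⁻ y, k d * ‖g (y + M.cover d)‖ₑ ^ 2 := by
          rw [lintegral_lintegral_swap]
          exact ((hk.comp measurable_snd).mul (hgp.pow_const 2)).aemeasurable
      _ = (∫⁻ d, k d) * ∫⁻ d, k d * ‖g‖ₑ ^ 2 := by
          congr 1
          refine lintegral_congr fun d => ?_
          have hm : Measurable fun y => ‖g (y + M.cover d)‖ₑ ^ 2 :=
            (hgp.comp measurable_prodMk_right).pow_const 2
          rw [lintegral_const_mul _ hm,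
            lintegral_add_right_eq_self (fun y => ‖g y‖ₑ ^ 2), lintegral_enorm_sq]
      _ = ((∫⁻ d, k d) * ‖g‖ₑ) ^ 2 := by
          rw [lintegral_mul_const _ hk]; ring
  by_contra hn
  exact absurd h1 (not_le.2 (ENNReal.pow_lt_pow_left two_ne_zero (not_le.1 hn)))

theorem lintegral_gaussian {C b d₀ : ℝ} (hC : 0 ≤ C) (hb : 0 < b) :
    ∫⁻ d, ENNReal.ofReal (C * Real.exp (-b * (d - d₀) ^ 2))
      = ENNReal.ofReal (C * Real.sqrt (Real.pi / b)) := by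
  have hi : Integrable fun d : ℝ => C * Real.exp (-b * (d - d₀) ^ 2) :=
    ((integrable_exp_neg_mul_sq hb).comp_sub_right d₀).const_mul C
  rw [← ofReal_integral_eq_lintegral_ofReal hi
    (Filter.Eventually.of_forall fun d => by positivity), integral_const_mul,
    integral_sub_right_eq_self (fun d : ℝ => Real.exp (-b * d ^ 2)), integral_gaussian]

/-- A lower bound for `‖(ξ + h ∂_y + φ') f‖` from a lower bound for the variation of the phase
between `s` and a point `t` at which the solution is controlled. -/
theorem IsSolution.norm_sq_le (hM : M.IsRegular) {h ξ S κ d₀ : ℝ} (hh : 0 < h) (hκ : 0 < κ)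
    {f g : Lp ℂ 2 (volume : Measure Y)} {U : Y → ℂ} (hU : M.IsSolution h ξ U g)
    (hfU : f =ᵐ[volume] U)
    (H : ∀ s ε, 0 < ε → ∃ t,
      Real.exp ((M.phase ξ t - M.phase ξ s) / h) * ‖U (M.cover t)‖ ≤ ‖U (M.cover s)‖ / 2 + ε ∧
      ∀ r ∈ uIoc t s, M.phase ξ r - M.phase ξ s ≤ S - κ * (r - s - d₀) ^ 2) :
    κ * h / (4 * Real.pi) * Real.exp (-2 * S / h) * ‖f‖ ^ 2 ≤ ‖g‖ ^ 2 := by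
  -- The kernel of the solution operator is `h⁻¹ e^{(Φ(r) - Φ(s))/h}`; the hypothesis on the phase
  -- bounds it by this Gaussian in `d = r - s`. The `L¹` norm `h⁻¹ e^{S/h} (π h/κ)^{1/2}`, doubled
  -- and squared, is the inverse of the constant in the conclusion.
  let k₀ : ℝ → ℝ := fun d => h⁻¹ * Real.exp (S / h) * Real.exp (-(κ / h) * (d - d₀) ^ 2)
  have hk₀ : Measurable fun d => ENNReal.ofReal (k₀ d) := by
    have : Continuous k₀ := by fun_prop
    exact this.measurable.ennreal_ofReal
  have key : ∀ y, ‖U y‖ₑ ≤ ∫⁻ d, ENNReal.ofReal 2 * ENNReal.ofReal (k₀ d) * ‖g (y + M.cover d)‖ₑ := by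
    intro y
    obtain ⟨s, rfl⟩ := hM.quotient.surjective y
    simp only [mul_assoc]
    rw [lintegral_const_mul' _ _ ENNReal.ofReal_ne_top]
    set I := ∫⁻ d, ENNReal.ofReal (k₀ d) * ‖g (M.cover s + M.cover d)‖ₑ
    have h1 : ENNReal.ofReal (‖U (M.cover s)‖ / 2) ≤ I := by
      refine ENNReal.le_of_forall_pos_le_add fun ε hε _ => ?_
      obtain ⟨t, ht, hr⟩ := H s ε (by exact_mod_cast hε)
      set X := h⁻¹ * Real.exp (-(M.phase ξ s) / h)
        * ‖∫ r in t..s, (Real.exp (M.phase ξ r / h) : ℂ) * g (M.cover r)‖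
      have hX : ‖U (M.cover s)‖
          ≤ Real.exp ((M.phase ξ t - M.phase ξ s) / h) * ‖U (M.cover t)‖ + X := by
        have e0 := hU.sub_eq t s
        have e1 : U (M.cover s) = (Real.exp (-(M.phase ξ s) / h) : ℂ)
            * ((Real.exp (M.phase ξ t / h) : ℂ) * U (M.cover t)
              + (h : ℂ)⁻¹ * ∫ r in t..s, (Real.exp (M.phase ξ r / h) : ℂ) * g (M.cover r)) := by
          rw [← e0]
          have : (Real.exp (-(M.phase ξ s) / h) : ℂ) * (Real.exp (M.phase ξ s / h) : ℂ) = 1 := by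
            rw [← Complex.ofReal_mul, ← Real.exp_add, neg_div, neg_add_cancel, Real.exp_zero,
              Complex.ofReal_one]
          linear_combination (-U (M.cover s)) * this
        have e2 : ‖(Real.exp (-(M.phase ξ s) / h) : ℂ)‖ = Real.exp (-(M.phase ξ s) / h) := by
          rw [Complex.norm_real, Real.norm_of_nonneg (Real.exp_pos _).le]
        have e3 : ‖(Real.exp (M.phase ξ t / h) : ℂ)‖ = Real.exp (M.phase ξ t / h) := by
          rw [Complex.norm_real, Real.norm_of_nonneg (Real.exp_pos _).le]
        have e4 : Real.exp (-(M.phase ξ s) / h) * Real.exp (M.phase ξ t / h)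
            = Real.exp ((M.phase ξ t - M.phase ξ s) / h) := by
          rw [← Real.exp_add]; congr 1; ring
        rw [e1, norm_mul, e2]
        refine (mul_le_mul_of_nonneg_left (norm_add_le _ _) (Real.exp_pos _).le).trans_eq ?_
        rw [norm_mul, norm_mul, e3, ← e4, norm_inv, Complex.norm_real, Real.norm_of_nonneg hh.le]
        simp only [X]
        ring
      have hXI : ENNReal.ofReal X ≤ I := by
        have hc : 0 ≤ h⁻¹ * Real.exp (-(M.phase ξ s) / h) := by positivity
        calc ENNReal.ofReal X
            = ENNReal.ofReal (h⁻¹ * Real.exp (-(M.phase ξ s) / h))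
              * ‖∫ r in uIoc t s, (Real.exp (M.phase ξ r / h) : ℂ) * g (M.cover r)‖ₑ := by
              rw [ENNReal.ofReal_mul hc, intervalIntegral.norm_intervalIntegral_eq,
                ofReal_norm]
          _ ≤ ENNReal.ofReal (h⁻¹ * Real.exp (-(M.phase ξ s) / h))
              * ∫⁻ r in uIoc t s, ‖(Real.exp (M.phase ξ r / h) : ℂ) * g (M.cover r)‖ₑ :=
              mul_le_mul_right (enorm_integral_le_lintegral_enorm _) _
          _ = ∫⁻ r in uIoc t s, ENNReal.ofReal (h⁻¹ * Real.exp (-(M.phase ξ s) / h))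
              * ‖(Real.exp (M.phase ξ r / h) : ℂ) * g (M.cover r)‖ₑ := by
              rw [lintegral_const_mul' _ _ ENNReal.ofReal_ne_top]
          _ ≤ ∫⁻ r in uIoc t s, ENNReal.ofReal (k₀ (r - s)) * ‖g (M.cover r)‖ₑ := by
              refine setLIntegral_mono' measurableSet_uIoc fun r hr' => ?_
              rw [enorm_mul, ← mul_assoc]
              refine mul_le_mul_left ?_ _
              rw [← ofReal_norm, Complex.norm_real,
                Real.norm_of_nonneg (Real.exp_pos _).le, ← ENNReal.ofReal_mul hc]
              refine ENNReal.ofReal_le_ofReal ?_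
              simp only [k₀]
              rw [mul_assoc, mul_assoc, ← Real.exp_add, ← Real.exp_add]
              refine mul_le_mul_of_nonneg_left (Real.exp_le_exp.2 ?_) (by positivity)
              have := div_le_div_of_nonneg_right (hr r hr') hh.le
              calc -(M.phase ξ s) / h + M.phase ξ r / h = (M.phase ξ r - M.phase ξ s) / h := by ring
                _ ≤ _ := this
                _ = _ := by ring
          _ ≤ ∫⁻ r, ENNReal.ofReal (k₀ (r - s)) * ‖g (M.cover r)‖ₑ := setLIntegral_le_lintegral _ _
          _ = I := by
              rw [← lintegral_add_left_eq_self _ s]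
              simp only [add_sub_cancel_left, map_add, I]
      -- The boundary term is absorbed: half of `‖U(s)‖` goes to the left, which costs the factor
      -- `2` of the kernel. On the circle the half is needed, on the line the `ε`.
      have h2 : ‖U (M.cover s)‖ / 2 ≤ ε + X := by linarith
      calc ENNReal.ofReal (‖U (M.cover s)‖ / 2) ≤ ENNReal.ofReal (ε + X) :=
            ENNReal.ofReal_le_ofReal h2
        _ ≤ ENNReal.ofReal ε + ENNReal.ofReal X := ENNReal.ofReal_add_le
        _ ≤ I + ε := by
            rw [add_comm, ENNReal.ofReal_coe_nnreal]
            exact add_le_add_left hXI _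
    calc ‖U (M.cover s)‖ₑ = ENNReal.ofReal 2 * ENNReal.ofReal (‖U (M.cover s)‖ / 2) := by
          rw [← ofReal_norm, ← ENNReal.ofReal_mul (by norm_num)]
          congr 1; ring
      _ ≤ ENNReal.ofReal 2 * I := mul_le_mul_right h1 _
  have h3 := enorm_le_of_kernel hM hfU (hk₀.const_mul (ENNReal.ofReal 2)) key
  have hC : 0 ≤ h⁻¹ * Real.exp (S / h) := by positivity
  rw [lintegral_const_mul _ hk₀, lintegral_gaussian hC (div_pos hκ hh),
    ← ENNReal.ofReal_mul (by norm_num), ← ofReal_norm,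
    ← ofReal_norm, ← ENNReal.ofReal_mul (by positivity),
    ENNReal.ofReal_le_ofReal_iff (by positivity)] at h3
  have h4 := pow_le_pow_left₀ (norm_nonneg _) h3 2
  have h5 : (2 * (h⁻¹ * Real.exp (S / h) * Real.sqrt (Real.pi / (κ / h))) * ‖g‖) ^ 2
      = 4 * Real.pi / (κ * h) * Real.exp (S / h) ^ 2 * ‖g‖ ^ 2 := by
    rw [mul_pow, mul_pow, mul_pow, mul_pow, Real.sq_sqrt (by positivity)]
    field_simp
    ring
  rw [h5] at h4
  have h6 : Real.exp (-2 * S / h) * Real.exp (S / h) ^ 2 = 1 := by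
    rw [← Real.exp_nat_mul, ← Real.exp_add, ← Real.exp_zero]; congr 1; push_cast; ring
  calc κ * h / (4 * Real.pi) * Real.exp (-2 * S / h) * ‖f‖ ^ 2
      ≤ κ * h / (4 * Real.pi) * Real.exp (-2 * S / h)
        * (4 * Real.pi / (κ * h) * Real.exp (S / h) ^ 2 * ‖g‖ ^ 2) :=
        mul_le_mul_of_nonneg_left h4 (by positivity)
    _ = (Real.exp (-2 * S / h) * Real.exp (S / h) ^ 2) * ‖g‖ ^ 2 := by
        field_simp
    _ = ‖g‖ ^ 2 := by rw [h6, one_mul]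

end Model
end

noncomputable section

/-! ## Quasimodes -/

namespace Model

variable {Y : Type} [AddCommGroup Y] [TopologicalSpace Y] [MeasureSpace Y]

/-- Functions on `ℝ` which are supported in `[α, β]` descend to test functions on `Y`. -/
def Descends (M : Model Y) (α β : ℝ) : Prop :=
  ∀ ψ : ℝ → ℂ, ContDiff ℝ ∞ ψ → (∀ s ∉ Icc α β, ψ s = 0) → ∃ χ, M.IsTest χ ∧
    ∫ y, ‖χ y‖ ^ 2 = ∫ s in α..β, ‖ψ s‖ ^ 2 ∧
    ∀ (h : ℝ) (k : ℤ), ∫ y, ‖M.fiberP h k χ y‖ ^ 2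
      = ∫ s in α..β, ‖((h * k : ℂ) + M.dphi (M.cover s)) * ψ s + h * deriv ψ s‖ ^ 2

end Model

theorem deriv_eq_zero_of_notMem_Icc {ψ : ℝ → ℂ} {α β : ℝ} (hψ : ∀ s ∉ Icc α β, ψ s = 0) {s : ℝ}
    (hs : s ∉ Icc α β) : deriv ψ s = 0 := by
  have : ψ =ᶠ[nhds s] fun _ => 0 := by
    filter_upwards [isClosed_Icc.isOpen_compl.mem_nhds hs] with t ht using hψ t ht
  rw [this.deriv_eq, deriv_const]

theorem descends_lineModel {α β : ℝ} (hαβ : α ≤ β) : lineModel.Descends α β := by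
  intro ψ hψ hs
  refine ⟨ψ, ⟨hψ, HasCompactSupport.intro isCompact_Icc hs⟩, ?_, fun h k => ?_⟩
  · rw [intervalIntegral.integral_of_le hαβ, ← integral_Icc_eq_integral_Ioc,
      setIntegral_eq_integral_of_forall_compl_eq_zero]
    intro s h
    rw [hs s h]; simp
  · rw [intervalIntegral.integral_of_le hαβ, ← integral_Icc_eq_integral_Ioc,
      setIntegral_eq_integral_of_forall_compl_eq_zero]
    · refine integral_congr_ae (Filter.Eventually.of_forall fun y => ?_)
      have : lineModel.dY ψ y = deriv ψ y := Model.dY_cover (M := lineModel) ψ y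
      simp only [Model.fiberP, this]
      congr 2
      change _ = ((h * k : ℂ) + lineModel.dphi y) * ψ y + h * deriv ψ y
      ring
    · intro s h
      rw [hs s h, deriv_eq_zero_of_notMem_Icc hs h]; simp

theorem periodize_eq_self {ψ : ℝ → ℂ} {α : ℝ} (hψ : ∀ s ∉ Icc α (α + 2 * Real.pi), ψ s = 0) {s : ℝ}
    (hs : s ∈ Ioo α (α + 2 * Real.pi)) : periodize ψ (toS1 s) = ψ s := by
  have hp := Real.two_pi_pos
  rw [periodize_eq_sum (J := {0})]
  · simp
  · intro n hn
    refine hψ _ fun hm => ?_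
    have hn' : n ≠ 0 := by simpa using hn
    rcases lt_or_gt_of_ne hn' with h | h
    · have : (n : ℝ) ≤ -1 := by exact_mod_cast Int.le_sub_one_of_lt h
      nlinarith [hm.1, hs.2]
    · have : (1 : ℝ) ≤ n := by exact_mod_cast h
      nlinarith [hm.2, hs.1]

/-- On the open period only the translate `n = 0` meets the support, so the periodization coincides
with `ψ` there; the cut point is a null set. -/
theorem descends_circleModel (α : ℝ) : circleModel.Descends α (α + 2 * Real.pi) := by
  intro ψ hψ hs
  have hp := Real.two_pi_pos
  have hc : HasCompactSupport ψ := HasCompactSupport.intro isCompact_Icc hs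
  have key : ∀ (F : S1 → ℝ) (G : ℝ → ℝ),
      (∀ s ∈ Ioo α (α + 2 * Real.pi), F (toS1 s) = G s) →
      ∫ y, F y = ∫ s in α..α + 2 * Real.pi, G s := by
    intro F G h
    rw [← AddCircle.intervalIntegral_preimage (2 * Real.pi) α,
      intervalIntegral.integral_of_le (by linarith), intervalIntegral.integral_of_le (by linarith),
      integral_Ioc_eq_integral_Ioo, integral_Ioc_eq_integral_Ioo]
    exact setIntegral_congr_fun measurableSet_Ioo h
  refine ⟨periodize ψ, isTest_periodize hψ hc, key _ _ fun s h => ?_, fun h k =>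
    key _ _ fun s h => ?_⟩
  · rw [periodize_eq_self hs h]
  · rw [Model.fiberP, dY_periodize hψ hc, periodize_eq_self hs h,
      periodize_eq_self (fun s h => deriv_eq_zero_of_notMem_Icc hs h) h]
    congr 2
    change _ = ((_ : ℂ) + circleModel.dphi (toS1 s)) * _ + _
    ring

theorem exists_bound_deriv_smoothTransition :
    ∃ L > 0, ∀ x, |deriv Real.smoothTransition x| ≤ L := by
  have hc : Continuous (deriv Real.smoothTransition) :=
    (Real.smoothTransition.contDiff (n := 1)).continuous_deriv le_rfl
  obtain ⟨C, hC⟩ := isCompact_Icc (a := (0 : ℝ)) (b := 1) |>.exists_bound_of_continuousOn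
    hc.continuousOn
  refine ⟨max C 1, lt_max_of_lt_right one_pos, fun x => ?_⟩
  by_cases hx : x ∈ Icc (0 : ℝ) 1
  · exact (hC x hx).trans (le_max_left _ _)
  · have : deriv Real.smoothTransition x = 0 := by
      rcases not_and_or.1 hx with h | h
      · have : Real.smoothTransition =ᶠ[nhds x] fun _ => 0 := by
          filter_upwards [Iio_mem_nhds (not_le.1 h)] with t ht
            using Real.smoothTransition.zero_of_nonpos (le_of_lt ht)
        rw [this.deriv_eq, deriv_const]
      · have : Real.smoothTransition =ᶠ[nhds x] fun _ => 1 := by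
          filter_upwards [Ioi_mem_nhds (not_le.1 h)] with t ht
            using Real.smoothTransition.one_of_one_le (le_of_lt ht)
        rw [this.deriv_eq, deriv_const]
    rw [this, abs_zero]
    exact zero_le_one.trans (le_max_right _ _)

/-- Such a point is a global maximum, which settles the endpoint `x = 1` together with the points
beyond it. -/
theorem deriv_smoothTransition_of_one_le {x : ℝ} (hx : 1 ≤ x) :
    deriv Real.smoothTransition x = 0 := by
  refine IsLocalMax.deriv_eq_zero (Filter.Eventually.of_forall fun y => ?_)
  rw [Real.smoothTransition.one_of_one_le hx]
  exact Real.smoothTransition.le_one y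

/-- A smooth cutoff function. -/
theorem exists_cutoff : ∃ L > 0, ∀ α β w : ℝ, 0 < w → α + 2 * w ≤ β → ∃ ζ : ℝ → ℝ, ContDiff ℝ ∞ ζ ∧
    (∀ s ∉ Icc α β, ζ s = 0) ∧ (∀ s ∈ Icc (α + w) (β - w), ζ s = 1 ∧ deriv ζ s = 0) ∧
    ∀ s, |deriv ζ s| ≤ L / w := by
  obtain ⟨L, hL, hL'⟩ := exists_bound_deriv_smoothTransition
  refine ⟨2 * L, by positivity, fun α β w hw hαβ => ?_⟩
  have hT : ContDiff ℝ ∞ Real.smoothTransition := Real.smoothTransition.contDiff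
  let T₁ : ℝ → ℝ := fun s => Real.smoothTransition ((s - α) / w)
  let T₂ : ℝ → ℝ := fun s => Real.smoothTransition ((β - s) / w)
  have d₁ : ∀ s, HasDerivAt T₁ (deriv Real.smoothTransition ((s - α) / w) * w⁻¹) s := by
    intro s
    have h1 : HasDerivAt (fun s => (s - α) / w) w⁻¹ s := by
      simpa using ((hasDerivAt_id s).sub_const α).div_const w
    exact (hT.differentiable (by simp) _).hasDerivAt.comp s h1
  have d₂ : ∀ s, HasDerivAt T₂ (deriv Real.smoothTransition ((β - s) / w) * (-w⁻¹)) s := by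
    intro s
    have h1 : HasDerivAt (fun s => (β - s) / w) (-w⁻¹) s := by
      simpa [neg_div] using ((hasDerivAt_id s).const_sub β).div_const w
    exact (hT.differentiable (by simp) _).hasDerivAt.comp s h1
  have dζ : ∀ s, deriv (fun s => T₁ s * T₂ s) s
      = deriv Real.smoothTransition ((s - α) / w) * w⁻¹ * T₂ s
        + T₁ s * (deriv Real.smoothTransition ((β - s) / w) * (-w⁻¹)) := fun s =>
    ((d₁ s).mul (d₂ s)).deriv
  refine ⟨fun s => T₁ s * T₂ s, ?_, fun s hs => ?_, fun s hs => ?_, fun s => ?_⟩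
  · exact (hT.comp ((contDiff_id.sub contDiff_const).div_const w)).mul
      (hT.comp ((contDiff_const.sub contDiff_id).div_const w))
  · rcases not_and_or.1 hs with h | h
    · have : T₁ s = 0 := Real.smoothTransition.zero_of_nonpos
        (div_nonpos_of_nonpos_of_nonneg (by linarith) hw.le)
      simp only [this, zero_mul]
    · have : T₂ s = 0 := Real.smoothTransition.zero_of_nonpos
        (div_nonpos_of_nonpos_of_nonneg (by linarith) hw.le)
      simp only [this, mul_zero]
  · have h1 : 1 ≤ (s - α) / w := by rw [le_div_iff₀ hw]; linarith [hs.1]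
    have h2 : 1 ≤ (β - s) / w := by rw [le_div_iff₀ hw]; linarith [hs.2]
    constructor
    · simp only [T₁, T₂, Real.smoothTransition.one_of_one_le h1,
        Real.smoothTransition.one_of_one_le h2, mul_one]
    · rw [dζ, deriv_smoothTransition_of_one_le h1, deriv_smoothTransition_of_one_le h2]
      simp
  · have b1 : |T₁ s| ≤ 1 := abs_le.2 ⟨by linarith [Real.smoothTransition.nonneg ((s - α) / w)],
      Real.smoothTransition.le_one _⟩
    have b2 : |T₂ s| ≤ 1 := abs_le.2 ⟨by linarith [Real.smoothTransition.nonneg ((β - s) / w)],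
      Real.smoothTransition.le_one _⟩
    have hw' : |w⁻¹| = w⁻¹ := abs_of_pos (inv_pos.2 hw)
    rw [dζ]
    refine (abs_add_le _ _).trans ?_
    rw [abs_mul, abs_mul, abs_mul, abs_mul, abs_neg, hw']
    have e1 : |deriv Real.smoothTransition ((s - α) / w)| * w⁻¹ * |T₂ s| ≤ L * w⁻¹ * 1 := by
      gcongr; exact hL' _
    have e2 : |T₁ s| * (|deriv Real.smoothTransition ((β - s) / w)| * w⁻¹) ≤ 1 * (L * w⁻¹) := by
      gcongr; exact hL' _
    have e3 : 2 * L / w = L * w⁻¹ * 1 + 1 * (L * w⁻¹) := by ring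
    rw [e3]
    exact add_le_add e1 e2

namespace Model

variable {Y : Type} [AddCommGroup Y] [TopologicalSpace Y] [IsTopologicalAddGroup Y] [T2Space Y]
  [LocallyCompactSpace Y] [MeasureSpace Y] [BorelSpace Y] [SecondCountableTopology Y]
  [IsFiniteMeasureOnCompacts (volume : Measure Y)] [SigmaFinite (volume : Measure Y)]
  {M : Model Y}

/-- Quasimodes: if the phase exceeds its value at `s₀` by `S - h` near the ends of an interval
which descends to `Y`, then `P` is small, of the order `e^{-S / h}`, on some function. -/
theorem exists_quasimode : ∃ C > 0, ∀ {Y : Type} [AddCommGroup Y] [TopologicalSpace Y]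
    [IsTopologicalAddGroup Y] [T2Space Y] [LocallyCompactSpace Y] [MeasureSpace Y] [BorelSpace Y]
    [SecondCountableTopology Y] [IsFiniteMeasureOnCompacts (volume : Measure Y)]
    [SigmaFinite (volume : Measure Y)] {M : Model Y}, M.IsRegular →
    ∀ {α β w s₀ S h : ℝ} {k : ℤ}, M.Descends α β → 0 < w → 0 < h →
    α + w ≤ s₀ → s₀ + w ≤ β - w →
    (∀ s ∈ Icc α (α + w), S - h ≤ M.phase (h * k) s - M.phase (h * k) s₀) →
    (∀ s ∈ Icc (β - w) β, S - h ≤ M.phase (h * k) s - M.phase (h * k) s₀) →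
    (∀ s ∈ Icc s₀ (s₀ + w), M.phase (h * k) s - M.phase (h * k) s₀ ≤ 2 * h) →
    ∃ p ∈ fiberGraph (M.graphP h) (tensor Y) k, p.1 ≠ 0 ∧
      ‖p.2‖ ^ 2 ≤ C * (h / w) ^ 2 * Real.exp (-2 * S / h) * ‖p.1‖ ^ 2 := by
  obtain ⟨L, hL, hcut⟩ := exists_cutoff
  -- The numerator is `h² (L/w)² e² e^{-2S/h}` integrated over two strips of width `w`; the
  -- denominator is at least `w e⁻⁴`. The quotient is `2 L² e⁶ (h/w)² e^{-2S/h}`.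
  refine ⟨2 * L ^ 2 * Real.exp 6, by positivity, ?_⟩
  intro Y _ _ _ _ _ _ _ _ _ _ M hM α β w s₀ S h k hD hw hh hα hβ h₁ h₂ h₃
  obtain ⟨ζ, hζ, hζ0, hζ1, hζL⟩ := hcut α β w hw (by linarith)
  set Φ := M.phase (h * k)
  have hΦ : ContDiff ℝ ∞ Φ := contDiff_phase hM _
  let ρ : ℝ → ℝ := fun s => Real.exp (-(Φ s - Φ s₀) / h)
  have hρ : ContDiff ℝ ∞ ρ := Real.contDiff_exp.comp ((hΦ.sub contDiff_const).neg.div_const h)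
  have hρd : ∀ s, HasDerivAt ρ (ρ s * (-(h * k + M.dphi (M.cover s)) / h)) s := fun s =>
    (((deriv_phase hM (h * k) s).sub_const _).neg.div_const h).exp
  let ψ : ℝ → ℂ := fun s => ((ζ s * ρ s : ℝ) : ℂ)
  have hψ : ContDiff ℝ ∞ ψ := Complex.ofRealCLM.contDiff.comp (hζ.mul hρ)
  obtain ⟨χ, hχ, e1, e2⟩ := hD ψ hψ fun s hs => by
    simp only [ψ, hζ0 s hs, zero_mul, Complex.ofReal_zero]
  -- The exponential `ρ` is annihilated by the fiber operator, so only the derivative of the cutoff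
  -- remains, and it lives near the two ends, where `ρ` is small.
  have hPψ : ∀ s, ‖((h * k : ℂ) + M.dphi (M.cover s)) * ψ s + h * deriv ψ s‖ ^ 2
      = h ^ 2 * (deriv ζ s ^ 2 * ρ s ^ 2) := by
    intro s
    have h4 : HasDerivAt ψ _ s :=
      (((hζ.differentiable (by simp) s).hasDerivAt.mul (hρd s))).ofReal_comp
    rw [h4.deriv]
    have h5 : ((h * k : ℂ) + M.dphi (M.cover s)) * ψ s + h * ((deriv ζ s * ρ s
        + ζ s * (ρ s * (-(h * k + M.dphi (M.cover s)) / h)) : ℝ) : ℂ)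
        = ((h * (deriv ζ s * ρ s) : ℝ) : ℂ) := by
      simp only [ψ]
      have : (h : ℂ) ≠ 0 := Complex.ofReal_ne_zero.2 hh.ne'
      push_cast
      field_simp
      ring
    rw [h5, Complex.norm_real, Real.norm_eq_abs, sq_abs]
    ring
  have hχ2 := norm_toLp_sq (hχ.memLp hM)
  have hP2 := norm_toLp_sq (hχ.memLp_fiberP hM h k)
  rw [e1] at hχ2
  rw [e2 h k] at hP2
  simp only [hPψ] at hP2
  have hψ2 : ∀ s, ‖ψ s‖ ^ 2 = (ζ s * ρ s) ^ 2 := fun s => by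
    simp only [ψ]; rw [Complex.norm_real, Real.norm_eq_abs, sq_abs]
  simp only [hψ2] at hχ2
  have cζ := hζ.continuous
  have cρ := hρ.continuous
  have cd := (contDiff_infty_iff_deriv.1 hζ).2.continuous
  have lower : w * Real.exp (-4) ≤ ∫ s in α..β, (ζ s * ρ s) ^ 2 := by
    have c1 : Continuous fun s => (ζ s * ρ s) ^ 2 := (cζ.mul cρ).pow 2
    calc w * Real.exp (-4) = ∫ s in s₀..s₀ + w, Real.exp (-4) := by simp
      _ ≤ ∫ s in s₀..s₀ + w, (ζ s * ρ s) ^ 2 := by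
          refine intervalIntegral.integral_mono_on (by linarith) (by simp)
            (c1.intervalIntegrable _ _) fun s hs => ?_
          rw [(hζ1 s ⟨by linarith [hs.1], by linarith [hs.2]⟩).1, one_mul, ← Real.exp_nat_mul]
          refine Real.exp_le_exp.2 ?_
          have h6 := div_le_div_of_nonneg_right (h₃ s hs) hh.le
          rw [mul_div_cancel_right₀ _ hh.ne'] at h6
          push_cast
          rw [neg_div]
          linarith
      _ ≤ ∫ s in α..β, (ζ s * ρ s) ^ 2 :=
          intervalIntegral.integral_mono_interval (by linarith) (by linarith) (by linarith)
            (Filter.Eventually.of_forall fun s => sq_nonneg _) (c1.intervalIntegrable _ _)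
  have upper : ∫ s in α..β, h ^ 2 * (deriv ζ s ^ 2 * ρ s ^ 2)
      ≤ h ^ 2 * ((L / w) ^ 2 * (Real.exp 2 * Real.exp (-2 * S / h)) * (2 * w)) := by
    rw [intervalIntegral.integral_const_mul]
    refine mul_le_mul_of_nonneg_left ?_ (sq_nonneg h)
    have c2 : Continuous fun s => deriv ζ s ^ 2 * ρ s ^ 2 := (cd.pow 2).mul (cρ.pow 2)
    have bnd : ∀ s, S - h ≤ Φ s - Φ s₀ → deriv ζ s ^ 2 * ρ s ^ 2
        ≤ (L / w) ^ 2 * (Real.exp 2 * Real.exp (-2 * S / h)) := by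
      intro s hs
      have b1 : deriv ζ s ^ 2 ≤ (L / w) ^ 2 := by
        rw [← sq_abs]; exact pow_le_pow_left₀ (abs_nonneg _) (hζL s) 2
      have b2 : ρ s ^ 2 ≤ Real.exp 2 * Real.exp (-2 * S / h) := by
        simp only [ρ]
        rw [← Real.exp_nat_mul, ← Real.exp_add]
        refine Real.exp_le_exp.2 ?_
        have h6 := div_le_div_of_nonneg_right hs hh.le
        rw [sub_div, div_self hh.ne'] at h6
        have h7 : -2 * S / h = -2 * (S / h) := by ring
        push_cast
        rw [h7, neg_div]
        linarith
      exact mul_le_mul b1 b2 (by positivity) (by positivity)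
    have i1 := intervalIntegral.integral_add_adjacent_intervals
      (c2.intervalIntegrable (μ := volume) α (α + w)) (c2.intervalIntegrable (α + w) (β - w))
    have i2 := intervalIntegral.integral_add_adjacent_intervals
      (c2.intervalIntegrable (μ := volume) α (β - w)) (c2.intervalIntegrable (β - w) β)
    have m0 : ∫ s in (α + w)..(β - w), deriv ζ s ^ 2 * ρ s ^ 2 = 0 := by
      refine (intervalIntegral.integral_congr fun s hs => ?_).trans
        (intervalIntegral.integral_zero (a := α + w) (b := β - w))
      rw [uIcc_of_le (by linarith)] at hs
      simp only [(hζ1 s hs).2]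
      ring
    have m1 : ∫ s in α..(α + w), deriv ζ s ^ 2 * ρ s ^ 2
        ≤ (L / w) ^ 2 * (Real.exp 2 * Real.exp (-2 * S / h)) * w := by
      refine (intervalIntegral.integral_mono_on (by linarith) (c2.intervalIntegrable _ _)
        (intervalIntegrable_const) fun s hs => bnd s (h₁ s hs)).trans_eq ?_
      rw [intervalIntegral.integral_const, smul_eq_mul, add_sub_cancel_left, mul_comm]
    have m2 : ∫ s in (β - w)..β, deriv ζ s ^ 2 * ρ s ^ 2
        ≤ (L / w) ^ 2 * (Real.exp 2 * Real.exp (-2 * S / h)) * w := by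
      refine (intervalIntegral.integral_mono_on (by linarith) (c2.intervalIntegrable _ _)
        (intervalIntegrable_const) fun s hs => bnd s (h₂ s hs)).trans_eq ?_
      rw [intervalIntegral.integral_const, smul_eq_mul, sub_sub_cancel, mul_comm]
    linarith
  rw [← hχ2] at lower
  rw [← hP2] at upper
  refine ⟨_, hχ.mem_fiberGraph hM h k, fun h0 => ?_, ?_⟩
  · simp only at h0
    rw [h0, norm_zero] at lower
    have := mul_pos hw (Real.exp_pos (-4))
    norm_num at lower
    linarith
  · refine upper.trans ?_
    have e6 : Real.exp 6 * Real.exp (-4) = Real.exp 2 := by rw [← Real.exp_add]; norm_num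
    calc h ^ 2 * ((L / w) ^ 2 * (Real.exp 2 * Real.exp (-2 * S / h)) * (2 * w))
        = 2 * L ^ 2 * Real.exp 6 * (h / w) ^ 2 * Real.exp (-2 * S / h) * (w * Real.exp (-4)) := by
          rw [← e6]; field_simp
      _ ≤ _ := mul_le_mul_of_nonneg_left lower (by positivity)

end Model
end

noncomputable section

/-! ## The fibers in the case `Y = ℝ` -/

namespace Model

variable {Y : Type} [AddCommGroup Y] [TopologicalSpace Y] [IsTopologicalAddGroup Y] [T2Space Y]
  [LocallyCompactSpace Y] [MeasureSpace Y] [BorelSpace Y] [SecondCountableTopology Y]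
  [IsFiniteMeasureOnCompacts (volume : Measure Y)] [SigmaFinite (volume : Measure Y)]
  [(volume : Measure Y).IsOpenPosMeasure] {M : Model Y}

/-- A lower bound for the solutions which vanish at a point is a lower bound on a subspace of
codimension one. -/
theorem exists_comb_norm_sq_le (hM : M.IsRegular) {h : ℝ} (hh : 0 < h) {k : ℤ} {r : ℝ} (y₀ : Y)
    (H : ∀ (f g : Lp ℂ 2 (volume : Measure Y)) (U : Y → ℂ), f =ᵐ[volume] U →
      M.IsSolution h (h * k) U g → U y₀ = 0 → r * ‖f‖ ^ 2 ≤ ‖g‖ ^ 2) :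
    ∀ p ∈ fiberGraph (M.graphP h) (tensor Y) k, ∀ q ∈ fiberGraph (M.graphP h) (tensor Y) k,
      ∃ c d : ℂ, (c ≠ 0 ∨ d ≠ 0) ∧ r * ‖c • p.1 + d • q.1‖ ^ 2 ≤ ‖c • p.2 + d • q.2‖ ^ 2 := by
  intro p hp q hq
  obtain ⟨U₁, hU₁, s₁⟩ := (isFiberPair_of_mem_fiberGraph hM hp).exists_isSolution hM hh
  obtain ⟨U₂, hU₂, s₂⟩ := (isFiberPair_of_mem_fiberGraph hM hq).exists_isSolution hM hh
  have key : ∀ c d : ℂ, c * U₁ y₀ + d * U₂ y₀ = 0 →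
      r * ‖c • p.1 + d • q.1‖ ^ 2 ≤ ‖c • p.2 + d • q.2‖ ^ 2 := by
    intro c d hcd
    have hmem : c • p + d • q ∈ fiberGraph (M.graphP h) (tensor Y) k :=
      Submodule.add_mem _ (Submodule.smul_mem _ c hp) (Submodule.smul_mem _ d hq)
    have hpair := isFiberPair_of_mem_fiberGraph hM hmem
    rw [Prod.fst_add, Prod.snd_add, Prod.smul_fst, Prod.smul_fst, Prod.smul_snd,
      Prod.smul_snd] at hpair
    obtain ⟨U, hU, s⟩ := hpair.exists_isSolution hM hh
    refine H _ _ U hU s ?_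
    have heq : U = fun y => c * U₁ y + d * U₂ y := by
      refine (Continuous.ae_eq_iff_eq volume s.continuous ((continuous_const.mul s₁.continuous).add
        (continuous_const.mul s₂.continuous))).1 ?_
      filter_upwards [hU, hU₁, hU₂, Lp.coeFn_add (c • p.1) (d • q.1), Lp.coeFn_smul c p.1,
        Lp.coeFn_smul d q.1] with y h0 h1 h2 h3 h4 h5
      rw [← h0, h3, Pi.add_apply, h4, h5, Pi.smul_apply, Pi.smul_apply, h1, h2, smul_eq_mul,
        smul_eq_mul]
      rfl
    rw [heq]; exact hcd
  by_cases h0 : U₁ y₀ = 0 ∧ U₂ y₀ = 0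
  · exact ⟨1, 0, Or.inl one_ne_zero, key 1 0 (by rw [h0.1]; ring)⟩
  · refine ⟨U₂ y₀, -U₁ y₀, ?_, key _ _ (by ring)⟩
    by_contra hn
    rw [not_or, not_not, not_not] at hn
    exact h0 ⟨neg_eq_zero.1 hn.2, hn.1⟩

end Model

theorem lineModel_phase (ξ s : ℝ) : lineModel.phase ξ s = ξ * s + s ^ 3 / 3 := rfl

/-- Otherwise `|f| > 1` almost everywhere on a half-line, which contradicts `f ∈ L²`. -/
theorem exists_le_norm_le_one {f : Lp ℂ 2 (volume : Measure ℝ)} {U : ℝ → ℂ}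
    (hU : f =ᵐ[volume] U) (R : ℝ) : ∃ t ≤ R, ‖U t‖ ≤ 1 := by
  by_contra hn
  push Not at hn
  have h1 : (⊤ : ENNReal) ≤ ‖f‖ₑ ^ 2 := by
    calc (⊤ : ENNReal) = volume (Iic R) := Real.volume_Iic.symm
      _ = ∫⁻ _ in Iic R, 1 := by rw [setLIntegral_one]
      _ ≤ ∫⁻ t in Iic R, ‖f t‖ₑ ^ 2 := by
          refine setLIntegral_mono_ae' measurableSet_Iic ?_
          filter_upwards [hU] with t ht hR
          rw [ht]
          refine one_le_pow_of_one_le' ?_ 2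
          rw [← ofReal_norm, ← ENNReal.ofReal_one]
          exact ENNReal.ofReal_le_ofReal (hn t hR).le
      _ ≤ ∫⁻ t, ‖f t‖ₑ ^ 2 := setLIntegral_le_lintegral _ _
      _ = ‖f‖ₑ ^ 2 := lintegral_enorm_sq f
  exact absurd h1 (not_le.2 (ENNReal.pow_lt_top enorm_lt_top))

/-- The cubic phase tends to `-∞` on the left while an `L²` solution is at most `1` at points
arbitrarily far to the left, so the boundary term there can be made arbitrarily small. -/
theorem lineModel_exists_control {f : Lp ℂ 2 (volume : Measure ℝ)} {U : ℝ → ℂ}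
    (hU : f =ᵐ[volume] U) {h : ℝ} (hh : 0 < h) (ξ s : ℝ) {ε : ℝ} (hε : 0 < ε) :
    ∃ t ≤ s, Real.exp ((lineModel.phase ξ t - lineModel.phase ξ s) / h) * ‖U t‖ ≤ ε := by
  set A := |lineModel.phase ξ s + h * Real.log ε|
  -- For `u = -t` the summand `3` gives `u² ≤ u³/3`, and then `u ≥ |ξ| + 3 + A` gives `Φ(t) ≤ |ξ| u
  -- - u² ≤ -A`.
  obtain ⟨t, ht, ht1⟩ := exists_le_norm_le_one hU (min s (-(|ξ| + 3 + A)))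
  refine ⟨t, ht.trans (min_le_left _ _), ?_⟩
  have hA : 0 ≤ A := abs_nonneg _
  have htA : |ξ| + 3 + A ≤ -t := by linarith [ht.trans (min_le_right _ _)]
  have hξ := neg_abs_le ξ
  have hξ' := abs_nonneg ξ
  have h1 : lineModel.phase ξ t ≤ -A := by
    rw [lineModel_phase]
    set u := -t
    have ht' : t = -u := by simp [u]
    rw [ht']
    have h3 : ξ * -u ≤ |ξ| * u := by nlinarith
    have h4 : u ^ 2 ≤ u ^ 3 / 3 := by nlinarith [sq_nonneg u]
    nlinarith
  have h2 : (lineModel.phase ξ t - lineModel.phase ξ s) / h ≤ Real.log ε := by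
    rw [div_le_iff₀ hh]
    have := neg_abs_le (lineModel.phase ξ s + h * Real.log ε)
    linarith
  calc Real.exp ((lineModel.phase ξ t - lineModel.phase ξ s) / h) * ‖U t‖
      ≤ Real.exp (Real.log ε) * 1 := by gcongr
    _ = ε := by rw [mul_one, Real.exp_log hε]

/-- The phase has its well at `y₊ = m` and its barrier at `y₋ = -m`. For a solution vanishing at
`m`, a point `s ≥ -m` is reached from `m` and a point `s ≤ -m` from `-∞`; both paths climb, with a
quadratic gain, so the estimate holds with action `0`. The vanishing condition has codimension one.
-/
theorem lineModel_two_dim {h m : ℝ} (hh : 0 < h) (hm : 0 < m) {k : ℤ} (hk : h * k = -m ^ 2) :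
    ∀ p ∈ fiberGraph (lineModel.graphP h) (tensor ℝ) k,
    ∀ q ∈ fiberGraph (lineModel.graphP h) (tensor ℝ) k, ∃ c d : ℂ, (c ≠ 0 ∨ d ≠ 0) ∧
      m / 3 * h / (4 * Real.pi) * ‖c • p.1 + d • q.1‖ ^ 2 ≤ ‖c • p.2 + d • q.2‖ ^ 2 := by
  refine Model.exists_comb_norm_sq_le isRegular_lineModel hh m fun f g U hfU hU h0 => ?_
  rw [hk] at hU
  have := hU.norm_sq_le isRegular_lineModel hh (κ := m / 3) (S := 0) (d₀ := 0) (by positivity) hfU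
    fun s ε hε => ?_
  · simpa using this
  · simp only [lineModel_phase, sub_zero, zero_sub]
    rcases le_total (-m) s with hs | hs
    · refine ⟨m, ?_, fun r hr => ?_⟩
      · change _ * ‖U m‖ ≤ _
        rw [h0, norm_zero, mul_zero]; positivity
      · rcases le_total m s with hs' | hs'
        · rw [uIoc_of_le hs'] at hr
          have h1 : 0 ≤ (s - r) ^ 2 * (2 * m / 3 + (s - r) / 3) :=
            mul_nonneg (sq_nonneg _) (by linarith [hr.2])
          have h2 : 0 ≤ (s - r) * ((r - m) * (r + m) + (r - m) * (s - r)) :=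
            mul_nonneg (by linarith [hr.2]) (by nlinarith [hr.1, hr.2])
          linarith
        · rw [uIoc_of_ge hs'] at hr
          have h1 : 0 ≤ (r - s) * (m ^ 2 - (s ^ 2 + s * r + r ^ 2) / 3 - m / 3 * (r - s)) := by
            refine mul_nonneg (by linarith [hr.1]) ?_
            nlinarith [mul_nonneg (sub_nonneg.2 hr.2) (neg_le_iff_add_nonneg'.1 hs),
              mul_nonneg (sub_nonneg.2 hr.1.le) (sub_nonneg.2 hr.2),
              mul_nonneg (sub_nonneg.2 hr.1.le) (neg_le_iff_add_nonneg'.1 hs),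
              mul_nonneg (sub_nonneg.2 hs') (neg_le_iff_add_nonneg'.1 hs)]
          linarith
    · obtain ⟨t, ht, ht'⟩ := lineModel_exists_control hfU hh (-m ^ 2) s hε
      refine ⟨t, ht'.trans (by linarith [norm_nonneg (U (lineModel.cover s))]), fun r hr => ?_⟩
      rw [uIoc_of_le ht] at hr
      have h1 : 0 ≤ (s - r) * ((s - m) * (s + m)) :=
        mul_nonneg (by linarith [hr.2]) (mul_nonneg_of_nonpos_of_nonpos (by linarith) (by linarith))
      have h2 : 0 ≤ (s - r) ^ 2 * (-s - m / 3 + (s - r) / 3) :=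
        mul_nonneg (sq_nonneg _) (by linarith [hr.2])
      linarith

/-- Every point is reached from `-∞`. For `r ≤ s` and `d = s - r` one has `Φ(r) - Φ(s) ≤ m² d -
d³/12`, and `4/3 m³` exceeds the right-hand side by `(d - 2m)² (d + 4m)/12`. This is the Gaussian
decay, centered at `d = 2m`, the distance from barrier to well. A larger `ξ` only improves the
bound. -/
theorem lineModel_lower {h m : ℝ} (hh : 0 < h) (hm : 0 < m) {k : ℤ} (hk : -m ^ 2 ≤ h * k) :
    ∀ p ∈ fiberGraph (lineModel.graphP h) (tensor ℝ) k,
      m / 3 * h / (4 * Real.pi) * Real.exp (-2 * (4 / 3 * m ^ 3) / h) * ‖p.1‖ ^ 2 ≤ ‖p.2‖ ^ 2 := by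
  intro p hp
  have hM := isRegular_lineModel
  obtain ⟨U, hfU, hU⟩ := (Model.isFiberPair_of_mem_fiberGraph hM hp).exists_isSolution hM hh
  refine hU.norm_sq_le hM hh (κ := m / 3) (d₀ := -(2 * m)) (by positivity) hfU fun s ε hε => ?_
  obtain ⟨t, ht, ht'⟩ := lineModel_exists_control hfU hh (h * k) s hε
  refine ⟨t, ht'.trans (by linarith [norm_nonneg (U (lineModel.cover s))]), fun r hr => ?_⟩
  rw [uIoc_of_le ht] at hr
  simp only [lineModel_phase]
  have h1 : 0 ≤ (s - r) * (h * k + m ^ 2) := mul_nonneg (by linarith [hr.2]) (by linarith)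
  have h2 : 0 ≤ (s - r - 2 * m) ^ 2 * (s - r) := mul_nonneg (sq_nonneg _) (by linarith [hr.2])
  have h3 : 0 ≤ (s - r) * (s + r) ^ 2 := mul_nonneg (by linarith [hr.2]) (sq_nonneg _)
  linarith

/-- The quasimode lives between the barrier `-m` and the point `2m`, where the phase is as high as
at the barrier: `Φ(-m) = Φ(2m) = Φ(m) + 4/3 m³`. -/
theorem lineModel_upper : ∃ C > 0, ∀ {h m : ℝ}, 0 < h → 0 < m → h ≤ m ^ 3 → ∀ {k : ℤ},
    h * k = -m ^ 2 → ∃ p ∈ fiberGraph (lineModel.graphP h) (tensor ℝ) k, p.1 ≠ 0 ∧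
      ‖p.2‖ ^ 2 ≤ C * (h * m) * Real.exp (-2 * (4 / 3 * m ^ 3) / h) * ‖p.1‖ ^ 2 := by
  obtain ⟨C, hC, H⟩ := Model.exists_quasimode
  refine ⟨C, hC, fun {h m} hh hm hhm {k} hk => ?_⟩
  -- The scale on which the phase varies by `O(h)` near its critical points, where `|Φ''| = 2m`; it
  -- makes `(h/w)²` equal to `h m`. The condition `h ≤ m³` says that `w ≤ m`.
  set w := Real.sqrt (h / m)
  have hw : 0 < w := Real.sqrt_pos.2 (div_pos hh hm)
  have hw2 : m * w ^ 2 = h := by rw [Real.sq_sqrt (by positivity)]; field_simp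
  have hwm : w ≤ m := by
    refine Real.sqrt_le_iff.2 ⟨hm.le, ?_⟩
    rw [div_le_iff₀ hm]; linarith
  have hhw : (h / w) ^ 2 = h * m := by
    rw [div_pow, div_eq_iff (by positivity)]
    nlinarith
  rw [← hhw]
  refine H isRegular_lineModel (descends_lineModel (α := -m) (β := 2 * m + w) (by linarith)) hw hh
    (s₀ := m) (by linarith) (by linarith) ?_ ?_ ?_ <;> intro s hs <;>
    simp only [lineModel_phase, hk]
  · obtain ⟨e, rfl⟩ : ∃ e, s = -m + e := ⟨s + m, by ring⟩
    have he : 0 ≤ e := by linarith [hs.1]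
    have he' : e ≤ w := by linarith [hs.2]
    have : m * e ^ 2 ≤ m * w ^ 2 := by gcongr
    have : 0 ≤ e ^ 3 := by positivity
    linarith
  · obtain ⟨e, rfl⟩ : ∃ e, s = 2 * m + e := ⟨s - 2 * m, by ring⟩
    have he : 0 ≤ e := by linarith [hs.1]
    have : 0 ≤ 3 * m ^ 2 * e + 2 * m * e ^ 2 + e ^ 3 / 3 := by positivity
    linarith
  · obtain ⟨e, rfl⟩ : ∃ e, s = m + e := ⟨s - m, by ring⟩
    have he : 0 ≤ e := by linarith [hs.1]
    have he' : e ≤ w := by linarith [hs.2]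
    have : m * e ^ 2 ≤ m * w ^ 2 := by gcongr
    have : e ^ 2 * e ≤ w ^ 2 * m := mul_le_mul (by gcongr) (by linarith) he (sq_nonneg _)
    linarith

end

noncomputable section

/-! ## The fibers in the case `Y = S¹` -/

open Real in
-- The difference is `2 sin((α + v)/2) sin((α - v)/2)`, and concavity of the sine bounds each factor
-- below by the chord on `[0, α]`.
theorem cos_sub_cos_ge {α v : ℝ} (hα : 0 < α) (hα' : α < π) (hv : -α ≤ v) (hv' : v ≤ α) :
    sin α ^ 2 / (2 * α ^ 2) * (α ^ 2 - v ^ 2) ≤ cos v - cos α := by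
  have hs : 0 < sin α := sin_pos_of_pos_of_lt_pi hα hα'
  have key : ∀ x, 0 ≤ x → x ≤ α → x / α * sin α ≤ sin x := by
    intro x hx hx'
    have h1 := strictConcaveOn_sin_Icc.concaveOn.2 (left_mem_Icc.2 pi_pos.le)
      (mem_Icc.2 ⟨hα.le, hα'.le⟩) (sub_nonneg.2 ((div_le_one hα).2 hx'))
      (div_nonneg hx hα.le) (sub_add_cancel 1 (x / α))
    simp only [smul_eq_mul, mul_zero, sin_zero, zero_add] at h1
    rwa [div_mul_cancel₀ _ hα.ne'] at h1
  have h1 := key ((α + v) / 2) (by linarith) (by linarith)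
  have h2 := key ((α - v) / 2) (by linarith) (by linarith)
  have h3 : cos v - cos α = 2 * (sin ((α + v) / 2) * sin ((α - v) / 2)) := by
    rw [cos_sub_cos]
    have e1 : (v + α) / 2 = (α + v) / 2 := by ring
    have e2 : (v - α) / 2 = -((α - v) / 2) := by ring
    rw [e1, e2, sin_neg]; ring
  rw [h3]
  have h4 := mul_le_mul h1 h2 (mul_nonneg (div_nonneg (by linarith) hα.le) hs.le)
    (le_trans (mul_nonneg (div_nonneg (by linarith) hα.le) hs.le) h1)
  calc sin α ^ 2 / (2 * α ^ 2) * (α ^ 2 - v ^ 2)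
      = 2 * ((α + v) / 2 / α * sin α * ((α - v) / 2 / α * sin α)) := by field_simp; ring
    _ ≤ _ := by linarith

/-- `v ↦ α² v - v³ / 3` grows quadratically on `[-α, α]`. -/
theorem cubic_sub_ge {α a b : ℝ} (ha : -α ≤ a) (hab : a ≤ b) (hb : b ≤ α) :
    α / 3 * (b - a) ^ 2 ≤ (α ^ 2 * b - b ^ 3 / 3) - (α ^ 2 * a - a ^ 3 / 3) := by
  have h1 : 0 ≤ (b - a) * (α ^ 2 - (a ^ 2 + a * b + b ^ 2) / 3 - α / 3 * (b - a)) := by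
    refine mul_nonneg (by linarith) ?_
    nlinarith [mul_nonneg (sub_nonneg.2 hb) (neg_le_iff_add_nonneg'.1 ha),
      mul_nonneg (sub_nonneg.2 hab) (sub_nonneg.2 hb),
      mul_nonneg (sub_nonneg.2 hab) (neg_le_iff_add_nonneg'.1 ha)]
  linarith

open Real in
-- The integral of `cos_sub_cos_ge`: the phase grows at least as a multiple of the cubic of the line
-- model, for which `cubic_sub_ge` gives the quadratic gain.
theorem sin_sub_sin_ge {α a b : ℝ} (hα : 0 < α) (hα' : α < π) (ha : -α ≤ a) (hab : a ≤ b)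
    (hb : b ≤ α) : sin α ^ 2 / (6 * π) * (b - a) ^ 2 ≤ sin b - sin a - (b - a) * cos α := by
  set q := sin α ^ 2 / (2 * α ^ 2)
  let F : ℝ → ℝ := fun v => sin v - v * cos α - q * (α ^ 2 * v - v ^ 3 / 3)
  have hF : ∀ v, HasDerivAt F (cos v - cos α - q * (α ^ 2 - v ^ 2)) v := by
    intro v
    have h1 := ((hasDerivAt_sin v).sub ((hasDerivAt_id v).mul_const (cos α))).sub
      ((((hasDerivAt_id v).const_mul (α ^ 2)).sub (((hasDerivAt_id v).pow 3).div_const 3)).const_mul q)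
    refine h1.congr_deriv ?_
    simp only [id]
    push_cast; ring
  have hmono : MonotoneOn F (Icc (-α) α) := by
    refine monotoneOn_of_deriv_nonneg (convex_Icc _ _)
      (fun v _ => (hF v).continuousAt.continuousWithinAt)
      (fun v _ => (hF v).differentiableAt.differentiableWithinAt) fun v hv => ?_
    rw [interior_Icc] at hv
    rw [(hF v).deriv]
    linarith [cos_sub_cos_ge hα hα' hv.1.le hv.2.le]
  have h2 : F a ≤ F b := hmono ⟨ha, by linarith⟩ ⟨by linarith, hb⟩ hab
  have h3 : q * (α / 3 * (b - a) ^ 2)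
      ≤ q * ((α ^ 2 * b - b ^ 3 / 3) - (α ^ 2 * a - a ^ 3 / 3)) :=
    mul_le_mul_of_nonneg_left (cubic_sub_ge ha hab hb) (by positivity)
  have h4 : sin α ^ 2 / (6 * π) * (b - a) ^ 2 ≤ q * (α / 3 * (b - a) ^ 2) := by
    have : q * (α / 3 * (b - a) ^ 2) = sin α ^ 2 / (6 * α) * (b - a) ^ 2 := by
      simp only [q]; field_simp; ring
    rw [this]
    gcongr
  simp only [F] at h2
  linarith

open Real in
/-- A lower bound for the excess of the action of the loop of half length `x` over the minimal
action. -/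
theorem excess_ge {θ x : ℝ} (hθ : 0 < θ) (hθ' : θ ≤ π / 2) (hx : 0 ≤ x) (hx' : x ≤ π) :
    sin θ * (x - θ) ^ 2 / π ^ 2 ≤ (x - θ) * cos θ - sin x + sin θ := by
  have hs : 0 < sin θ := sin_pos_of_pos_of_lt_pi hθ (by linarith [pi_pos])
  have hc : 0 ≤ cos θ := cos_nonneg_of_neg_pi_div_two_le_of_le (by linarith) hθ'
  set e := x - θ
  have hxe : x = θ + e := by simp [e]
  -- The first term alone is at least `2 sin θ e²/π²`, twice what is needed. The second is harmless
  -- for `e ≥ 0`; for `e < 0` it is negative, and half of the first term is spent on it.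
  have h1 : e * cos θ - sin x + sin θ = sin θ * (1 - cos e) + cos θ * (e - sin e) := by
    rw [hxe, sin_add]; ring
  have he : |e| ≤ π := abs_le.2 ⟨by linarith, by linarith⟩
  have h2 : 2 * e ^ 2 / π ^ 2 ≤ 1 - cos e := by
    have := cos_le_one_sub_mul_cos_sq he
    have e1 : 2 / π ^ 2 * e ^ 2 = 2 * e ^ 2 / π ^ 2 := by ring
    linarith
  rw [h1]
  rcases le_total 0 e with h0 | h0
  · have h3 := sin_le h0
    have h4 := mul_le_mul_of_nonneg_left h2 hs.le
    have h5 := mul_nonneg hc (sub_nonneg.2 h3)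
    have h6 : sin θ * e ^ 2 / π ^ 2 ≤ sin θ * (2 * e ^ 2 / π ^ 2) := by
      rw [mul_div_assoc]
      gcongr
      nlinarith [sq_nonneg e]
    linarith
  · -- `e = -2 g` with `0 ≤ 2 g ≤ θ`
    obtain ⟨g, hg⟩ : ∃ g, e = -(2 * g) := ⟨-e / 2, by ring⟩
    have hg0 : 0 ≤ g := by linarith
    have hgθ : 2 * g ≤ θ := by linarith
    have hcg : 0 < cos g := cos_pos_of_mem_Ioo ⟨by linarith [pi_pos], by linarith [pi_pos]⟩
    have hsg : 0 ≤ sin g := sin_nonneg_of_nonneg_of_le_pi hg0 (by linarith [pi_pos])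
    have hgs : g * cos g ≤ sin g := by
      rcases hg0.eq_or_lt with h | h
      · rw [← h]; simp
      · have := lt_tan h (by linarith [pi_pos])
        rw [tan_eq_sin_div_cos, lt_div_iff₀ hcg] at this
        exact this.le
    have hc2 : 0 ≤ cos (2 * g) :=
      cos_nonneg_of_neg_pi_div_two_le_of_le (by linarith [pi_pos]) (by linarith)
    have hsc := sin_sq_add_cos_sq g
    -- A sharpened form of `x ≤ tan x`, obtained from `g cos g ≤ sin g` and `cos 2g ≤ cos⁴ g`.
    -- Combined with `tan 2g ≤ tan θ`, which is `h8` cleared of denominators, it yields `h9` after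
    -- multiplication by `cos 2g`.
    have h7 : 2 * (2 * g) * cos (2 * g) ≤ sin (2 * g) * (1 + cos (2 * g)) := by
      have a1 : cos (2 * g) ≤ cos g ^ 4 := by
        rw [cos_two_mul]; nlinarith [sq_nonneg (cos g ^ 2 - 1)]
      have a2 : sin (2 * g) * (1 + cos (2 * g)) = 4 * (sin g * cos g ^ 3) := by
        rw [sin_two_mul, cos_two_mul]; ring
      have a3 : g * cos g * cos (2 * g) ≤ sin g * cos g ^ 4 := mul_le_mul hgs a1 hc2 hsg
      have a4 : g * cos (2 * g) ≤ sin g * cos g ^ 3 := by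
        by_contra hn
        have := mul_lt_mul_of_pos_right (not_le.1 hn) hcg
        nlinarith
      rw [a2]; linarith
    have h8 : cos θ * sin (2 * g) ≤ sin θ * cos (2 * g) := by
      have := sin_nonneg_of_nonneg_of_le_pi (sub_nonneg.2 hgθ) (by linarith [pi_pos])
      rw [sin_sub] at this
      linarith
    -- `cos θ (2g - sin 2g) ≤ (1/2) sin θ (1 - cos 2g)`
    have h9 : cos θ * (2 * g - sin (2 * g)) ≤ sin θ * (1 - cos (2 * g)) / 2 := by
      rcases hc2.eq_or_lt with h | h
      · have hθe : cos θ = 0 := by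
          rcases hgθ.eq_or_lt with h' | h'
          · rw [← h', ← h]
          · exfalso
            have := cos_pos_of_mem_Ioo (x := 2 * g) ⟨by linarith [pi_pos], by linarith⟩
            linarith
        rw [hθe, zero_mul]
        have := cos_le_one (2 * g)
        exact div_nonneg (mul_nonneg hs.le (by linarith)) zero_le_two
      · by_contra hn
        have b1 := mul_lt_mul_of_pos_right (not_le.1 hn) h
        have b2 : 0 ≤ cos θ * (sin (2 * g) * (1 + cos (2 * g)) - 2 * (2 * g) * cos (2 * g)) :=
          mul_nonneg hc (by linarith)
        have b3 : 0 ≤ (sin θ * cos (2 * g) - cos θ * sin (2 * g)) * (1 - cos (2 * g)) :=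
          mul_nonneg (by linarith) (by linarith [cos_le_one (2 * g)])
        nlinarith
    have hce : cos e = cos (2 * g) := by rw [hg, cos_neg]
    have hse : cos θ * (e - sin e) = -(cos θ * (2 * g - sin (2 * g))) := by
      rw [hg, sin_neg]; ring
    have h10 := mul_le_mul_of_nonneg_left h2 hs.le
    have h11 : sin θ * (2 * e ^ 2 / π ^ 2) = 2 * (sin θ * e ^ 2 / π ^ 2) := by ring
    rw [hce] at h10 ⊢
    rw [hse]
    linarith

open Real in
-- Second-order Taylor bounds for cosine and sine at `e`, inserted in the addition formula.
theorem abs_sin_add_sub_le {θ e : ℝ} (he : |e| ≤ 1) : |sin (θ + e) - sin θ - e * cos θ| ≤ e ^ 2 := by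
  have h1 : |cos e - 1| ≤ e ^ 2 / 2 := by
    rw [abs_le]
    constructor
    · linarith [one_sub_sq_div_two_le_cos (x := e)]
    · linarith [cos_le_one e, sq_nonneg e]
  have h2 : |sin e - e| ≤ e ^ 2 / 2 := by
    have key : ∀ x, 0 ≤ x → x ≤ 1 → |sin x - x| ≤ x ^ 2 / 2 := by
      intro x hx hx'
      rw [abs_le]
      constructor
      · rcases hx.eq_or_lt with h | h
        · rw [← h]; simp
        · have := sin_gt_sub_cube h
          nlinarith [sq_nonneg x]
      · linarith [sin_le hx, sq_nonneg x]
    rcases le_total 0 e with h | h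
    · exact key e h (by rwa [abs_of_nonneg h] at he)
    · have := key (-e) (by linarith) (by rwa [abs_of_nonpos h] at he)
      rw [sin_neg, ← abs_neg] at this
      have e1 : -(-sin e - -e) = sin e - e := by ring
      rwa [e1, neg_sq] at this
  have h3 : sin (θ + e) - sin θ - e * cos θ = sin θ * (cos e - 1) + cos θ * (sin e - e) := by
    rw [sin_add]; ring
  rw [h3]
  calc |sin θ * (cos e - 1) + cos θ * (sin e - e)|
      ≤ |sin θ| * |cos e - 1| + |cos θ| * |sin e - e| := by
        rw [← abs_mul, ← abs_mul]; exact abs_add_le _ _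
    _ ≤ 1 * (e ^ 2 / 2) + 1 * (e ^ 2 / 2) := by
        gcongr
        · exact abs_sin_le_one _
        · exact abs_cos_le_one _
    _ = e ^ 2 := by ring

theorem circleModel_phase (ξ s : ℝ) : circleModel.phase ξ s = ξ * s + Real.sin s := by
  rw [Model.phase]
  congr 1

open Real in
-- The well is `y₊ = π + θ`, between the lifts `π - θ` and `3π - θ` of the barrier. From the well
-- the phase climbs monotonically to either side, along arcs of half length `θ` and `π - θ`, and
-- `sin_sub_sin_ge` gives the quadratic gain on both.
theorem circleModel_two_dim {h θ : ℝ} (hh : 0 < h) (hθ : 0 < θ) (hθ' : θ < π) {k : ℤ}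
    (hk : h * k = cos θ) :
    ∀ p ∈ fiberGraph (circleModel.graphP h) (tensor S1) k,
    ∀ q ∈ fiberGraph (circleModel.graphP h) (tensor S1) k, ∃ c d : ℂ, (c ≠ 0 ∨ d ≠ 0) ∧
      sin θ ^ 2 / (6 * π) * h / (4 * π) * ‖c • p.1 + d • q.1‖ ^ 2 ≤ ‖c • p.2 + d • q.2‖ ^ 2 := by
  have hs : 0 < sin θ := sin_pos_of_pos_of_lt_pi hθ hθ'
  refine Model.exists_comb_norm_sq_le isRegular_circleModel hh (toS1 (π + θ))
    fun f g U hfU hU h0 => ?_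
  rw [hk] at hU
  have := hU.norm_sq_le isRegular_circleModel hh (κ := sin θ ^ 2 / (6 * π)) (S := 0) (d₀ := 0)
    (by positivity) hfU fun s ε hε => ?_
  · simpa using this
  -- A translation by periods brings `s` between two consecutive barriers, so that the nearest lift
  -- of the well can be reached without crossing one.
  obtain ⟨n, hn, -⟩ := existsUnique_add_zsmul_mem_Ico two_pi_pos s (π - θ)
  simp only [zsmul_eq_mul] at hn
  have hz : U (circleModel.cover (π + θ - n * (2 * π))) = 0 := by
    rw [← h0]
    congr 1
    have := toS1_add_int_mul (π + θ) (-n)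
    rw [Int.cast_neg, neg_mul] at this
    exact this
  refine ⟨π + θ - n * (2 * π), ?_, fun r hr => ?_⟩
  · rw [hz, norm_zero, mul_zero]; positivity
  · obtain ⟨s', rfl⟩ : ∃ s', s = s' - n * (2 * π) := ⟨s + n * (2 * π), by ring⟩
    obtain ⟨r', rfl⟩ : ∃ r', r = r' - n * (2 * π) := ⟨r + n * (2 * π), by ring⟩
    rw [sub_add_cancel] at hn
    rw [circleModel_phase, circleModel_phase, sin_sub_int_mul_two_pi, sin_sub_int_mul_two_pi]
    rcases le_total (π + θ) s' with h1 | h1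
    · rw [uIoc_of_le (by linarith)] at hr
      have h2 := sin_sub_sin_ge (α := π - θ) (a := r' - 2 * π) (b := s' - 2 * π) (by linarith)
        (by linarith) (by linarith [hr.1]) (by linarith [hr.2]) (by linarith [hn.2])
      rw [sin_sub_two_pi, sin_sub_two_pi, sin_pi_sub, cos_pi_sub] at h2
      linarith
    · rw [uIoc_of_ge (by linarith)] at hr
      have h2 := sin_sub_sin_ge (α := θ) (a := s' - π) (b := r' - π) hθ hθ'
        (by linarith [hn.1]) (by linarith [hr.1]) (by linarith [hr.2])
      rw [sin_sub_pi, sin_sub_pi] at h2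
      linarith

open Real in
-- One integrates once around the circle, in the direction in which `U(t) = U(s)` is multiplied by
-- `e^{-2π|k|} ≤ 1/2`. This requires `k ≠ 0`: for `k = 0` the function `e^{-φ/h}` is in the kernel.
-- Over a distance `d` the phase exceeds `Φ(s)` by at most `2 sin(d/2) - d cos θ`, whose maximum on
-- `[0, 2π]` is at `d = 2θ`; `excess_ge` supplies the Gaussian decay around it.
theorem circleModel_lower {h θ : ℝ} (hh : 0 < h) (hθ : 0 < θ) (hθ' : θ ≤ π / 2) {k : ℤ}
    (hk0 : k ≠ 0) (hk : cos θ ≤ |h * k|) :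
    ∀ p ∈ fiberGraph (circleModel.graphP h) (tensor S1) k,
      sin θ / (2 * π ^ 2) * h / (4 * π) * exp (-2 * (2 * (sin θ - θ * cos θ)) / h) * ‖p.1‖ ^ 2
        ≤ ‖p.2‖ ^ 2 := by
  intro p hp
  have hs : 0 < sin θ := sin_pos_of_pos_of_lt_pi hθ (by linarith [pi_pos])
  have hM := isRegular_circleModel
  obtain ⟨U, hfU, hU⟩ := (Model.isFiberPair_of_mem_fiberGraph hM hp).exists_isSolution hM hh
  have hexp : exp (-(2 * π)) ≤ 1 / 2 := by
    rw [exp_neg, one_div]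
    exact inv_anti₀ two_pos (by linarith [add_one_le_exp (2 * π), pi_gt_three])
  have hbound : ∀ d s r : ℝ, 0 ≤ d → d ≤ 2 * π → |r - s| = d →
      sin r - sin s - cos θ * d
        ≤ 2 * (sin θ - θ * cos θ) - sin θ / (2 * π ^ 2) * (d - 2 * θ) ^ 2 := by
    intro d s r hd hd' hrs
    have h1 := excess_ge hθ hθ' (x := d / 2) (by linarith) (by linarith)
    have h2 : sin r - sin s ≤ 2 * sin (d / 2) := by
      rw [sin_sub_sin]
      have h3 : |sin ((r - s) / 2)| = sin (d / 2) := by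
        rw [← hrs]
        rcases le_total 0 (r - s) with h | h
        · rw [abs_of_nonneg h] at hrs ⊢
          exact abs_of_nonneg (sin_nonneg_of_nonneg_of_le_pi (by linarith) (by linarith))
        · rw [abs_of_nonpos h] at hrs ⊢
          rw [neg_div, sin_neg]
          refine abs_of_nonpos ?_
          rw [← neg_nonneg, ← sin_neg]
          exact sin_nonneg_of_nonneg_of_le_pi (by linarith) (by linarith)
      have h4 : |sin ((r - s) / 2) * cos ((r + s) / 2)| ≤ sin (d / 2) * 1 := by
        rw [abs_mul, h3]
        refine mul_le_mul_of_nonneg_left (abs_cos_le_one _) ?_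
        exact sin_nonneg_of_nonneg_of_le_pi (by linarith) (by linarith)
      have := le_of_abs_le h4
      linarith
    have e1 : sin θ / (2 * π ^ 2) * (d - 2 * θ) ^ 2 = 2 * (sin θ * (d / 2 - θ) ^ 2 / π ^ 2) := by
      field_simp
    linarith
  have hper : ∀ s : ℝ, U (circleModel.cover (s + 2 * π)) = U (circleModel.cover s) := fun s => by
    congr 1
    have := toS1_add_int_mul s 1
    rwa [Int.cast_one, one_mul] at this
  have hfin : ∀ (s x ε : ℝ), 0 < ε → x ≤ -(2 * π) → exp x * ‖U (circleModel.cover s)‖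
      ≤ ‖U (circleModel.cover s)‖ / 2 + ε := by
    intro s x ε hε hx
    have h1 := (exp_le_exp.2 hx).trans hexp
    have h2 := mul_le_mul_of_nonneg_right h1 (norm_nonneg (U (circleModel.cover s)))
    linarith
  rcases lt_or_gt_of_ne hk0 with hneg | hpos
  · have hk1 : (k : ℝ) ≤ -1 := by exact_mod_cast Int.le_sub_one_of_lt hneg
    have hξ : h * k ≤ -cos θ := by
      rw [abs_of_nonpos (by nlinarith)] at hk; linarith
    refine hU.norm_sq_le hM hh (κ := sin θ / (2 * π ^ 2)) (d₀ := 2 * θ) (by positivity) hfU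
      fun s ε hε => ⟨s + 2 * π, ?_, fun r hr => ?_⟩
    · rw [hper]
      refine hfin _ _ _ hε ?_
      rw [circleModel_phase, circleModel_phase, sin_add_two_pi, div_le_iff₀ hh]
      nlinarith [mul_nonneg (mul_nonneg hh.le (by linarith : 0 ≤ -1 - (k : ℝ))) pi_pos.le]
    · rw [uIoc_of_ge (by linarith [pi_pos])] at hr
      have h1 := hbound (r - s) s r (by linarith [hr.1]) (by linarith [hr.2])
        (abs_of_nonneg (by linarith [hr.1]))
      rw [circleModel_phase, circleModel_phase]
      nlinarith [hr.1]
  · have hk1 : (1 : ℝ) ≤ k := by exact_mod_cast hpos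
    have hξ : cos θ ≤ h * k := by
      rwa [abs_of_nonneg (by positivity)] at hk
    refine hU.norm_sq_le hM hh (κ := sin θ / (2 * π ^ 2)) (d₀ := -(2 * θ)) (by positivity) hfU
      fun s ε hε => ⟨s - 2 * π, ?_, fun r hr => ?_⟩
    · have hp' := hper (s - 2 * π)
      rw [sub_add_cancel] at hp'
      rw [← hp']
      refine hfin _ _ _ hε ?_
      rw [circleModel_phase, circleModel_phase, sin_sub_two_pi, div_le_iff₀ hh]
      nlinarith [mul_nonneg (mul_nonneg hh.le (by linarith : 0 ≤ (k : ℝ) - 1)) pi_pos.le]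
    · rw [uIoc_of_le (by linarith [pi_pos])] at hr
      have h1 := hbound (s - r) s r (by linarith [hr.2]) (by linarith [hr.1])
        (by rw [abs_sub_comm]; exact abs_of_nonneg (by linarith [hr.2]))
      rw [circleModel_phase, circleModel_phase]
      nlinarith [hr.2]

open Real in
-- The circle is cut at the barrier `y₋`, and the quasimode fills the whole period around the well
-- `y₊`. The end nearer to the well has height exactly `S₀` above it; the other is higher by `2π
-- |ξ|`. The two signs of `ξ` mirror each other. The width `√h` is not adapted to small `θ`, but a
-- bound of order `h` suffices.
theorem circleModel_upper : ∃ C > 0, ∀ {h θ : ℝ}, 0 < h → 0 < θ → θ ≤ π / 2 → h ≤ 1 → h ≤ θ ^ 2 →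
    ∀ {k : ℤ}, |h * k| = cos θ → ∃ p ∈ fiberGraph (circleModel.graphP h) (tensor S1) k, p.1 ≠ 0 ∧
      ‖p.2‖ ^ 2 ≤ C * h * exp (-2 * (2 * (sin θ - θ * cos θ)) / h) * ‖p.1‖ ^ 2 := by
  obtain ⟨C, hC, H⟩ := Model.exists_quasimode
  refine ⟨C, hC, fun {h θ} hh hθ hθ' hh1 hhθ {k} hk => ?_⟩
  have hc : 0 ≤ cos θ := cos_nonneg_of_neg_pi_div_two_le_of_le (by linarith) hθ'
  have hpi := pi_gt_three
  set w := sqrt h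
  have hw : 0 < w := sqrt_pos.2 hh
  have hw2 : w ^ 2 = h := sq_sqrt hh.le
  have hwθ : w ≤ θ := sqrt_le_iff.2 ⟨hθ.le, hhθ⟩
  have hw1 : w ≤ 1 := sqrt_le_iff.2 ⟨zero_le_one, by linarith⟩
  have hhw : (h / w) ^ 2 = h := by
    rw [div_pow, div_eq_iff (by positivity), hw2]; ring
  suffices ∃ p ∈ fiberGraph (circleModel.graphP h) (tensor S1) k, p.1 ≠ 0 ∧
      ‖p.2‖ ^ 2 ≤ C * (h / w) ^ 2 * exp (-2 * (2 * (sin θ - θ * cos θ)) / h) * ‖p.1‖ ^ 2 by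
    rwa [hhw] at this
  have taylor : ∀ e, 0 ≤ e → e ≤ w → |sin (θ + e) - sin θ - e * cos θ| ≤ h ∧
      |sin (θ - e) - sin θ + e * cos θ| ≤ h := by
    intro e he he'
    have e2 : e ^ 2 ≤ h := by rw [← hw2]; gcongr
    constructor
    · exact (abs_sin_add_sub_le (by rw [abs_of_nonneg he]; linarith)).trans e2
    · have := abs_sin_add_sub_le (θ := θ) (e := -e) (by rw [abs_neg, abs_of_nonneg he]; linarith)
      rw [neg_sq, neg_mul, sub_neg_eq_add] at this
      exact this.trans e2
  rcases le_total 0 (h * (k : ℝ)) with hk0 | hk0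
  · rw [abs_of_nonneg hk0] at hk
    refine H (M := circleModel) (k := k) (α := π - θ) (β := π - θ + 2 * π)
      (S := 2 * (sin θ - θ * cos θ)) isRegular_circleModel (descends_circleModel _) hw hh
      (s₀ := π + θ) (by linarith) (by linarith) ?_ ?_ ?_ <;> intro s hs <;>
      rw [circleModel_phase, circleModel_phase, hk, add_comm π θ, sin_add_pi]
    · obtain ⟨e, rfl⟩ : ∃ e, s = π - (θ - e) := ⟨s - π + θ, by ring⟩
      have h1 := abs_le.1 (taylor e (by linarith [hs.1]) (by linarith [hs.2])).2
      rw [sin_pi_sub]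
      linarith
    · obtain ⟨e, rfl⟩ : ∃ e, s = π - (θ + e) + 2 * π := ⟨π - θ + 2 * π - s, by ring⟩
      have h1 := abs_le.1 (taylor e (by linarith [hs.2]) (by linarith [hs.1])).1
      have h2 := mul_nonneg hc pi_pos.le
      rw [sin_add_two_pi, sin_pi_sub]
      linarith
    · obtain ⟨e, rfl⟩ : ∃ e, s = (θ + e) + π := ⟨s - π - θ, by ring⟩
      have h1 := abs_le.1 (taylor e (by linarith [hs.1]) (by linarith [hs.2])).1
      rw [sin_add_pi]
      linarith
  · rw [abs_of_nonpos hk0] at hk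
    have hk' : h * (k : ℝ) = -cos θ := by linarith
    refine H (M := circleModel) (k := k) (α := θ - 2 * π) (β := θ - 2 * π + 2 * π)
      (S := 2 * (sin θ - θ * cos θ)) isRegular_circleModel (descends_circleModel _) hw hh
      (s₀ := -θ) (by linarith) (by linarith) ?_ ?_ ?_ <;> intro s hs <;>
      rw [circleModel_phase, circleModel_phase, hk', sin_neg]
    · obtain ⟨e, rfl⟩ : ∃ e, s = (θ + e) - 2 * π := ⟨s + 2 * π - θ, by ring⟩
      have h1 := abs_le.1 (taylor e (by linarith [hs.1]) (by linarith [hs.2])).1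
      have h2 := mul_nonneg hc pi_pos.le
      rw [sin_sub_two_pi]
      linarith
    · obtain ⟨e, rfl⟩ : ∃ e, s = θ - e := ⟨θ - s, by ring⟩
      have h1 := abs_le.1 (taylor e (by linarith [hs.2]) (by linarith [hs.1])).2
      linarith
    · obtain ⟨e, rfl⟩ : ∃ e, s = -(θ - e) := ⟨s + θ, by ring⟩
      have h1 := abs_le.1 (taylor e (by linarith [hs.1]) (by linarith [hs.2])).2
      rw [sin_neg]
      linarith

end

noncomputable section

/-! ## The action and the symplectic area -/

theorem repS1_toS1 {s : ℝ} (hs : s ∈ Ioc (-Real.pi) Real.pi) : repS1 (toS1 s) = s := by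
  have hs' : s ∈ Ioc (-Real.pi) (-Real.pi + 2 * Real.pi) := ⟨hs.1, by linarith [hs.2]⟩
  exact congrArg Subtype.val
    ((AddCircle.equivIoc (2 * Real.pi) (-Real.pi)).apply_symm_apply ⟨s, hs'⟩)

theorem deriv_repS1 : deriv (fun s : ℝ => repS1 (toS1 s)) 0 = 1 := by
  have : (fun s : ℝ => repS1 (toS1 s)) =ᶠ[nhds 0] fun s => s := by
    filter_upwards [Ioo_mem_nhds (neg_lt_zero.2 Real.pi_pos) Real.pi_pos] with s hs
    exact repS1_toS1 ⟨hs.1, hs.2.le⟩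
  rw [this.deriv_eq]
  exact deriv_id 0

namespace Model

variable {Y : Type} [AddCommGroup Y]

theorem poisson_symbol (M : Model Y) (ρ : Phase Y) :
    M.poisson M.symbol (fun ρ' => (starRingEnd ℂ) (M.symbol ρ')) ρ
      = 2 * Complex.I * M.dY (fun y => (M.dphi y : ℂ)) ρ.1.2 := by
  have hconj : ∀ ρ' : Phase Y, (starRingEnd ℂ) (M.symbol ρ')
      = (ρ'.2.1 : ℂ) - Complex.I * (ρ'.2.2 : ℂ) + (M.dphi ρ'.1.2 : ℂ) := by
    intro ρ'
    simp only [symbol, map_add, map_mul, Complex.conj_ofReal, Complex.conj_I]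
    ring
  have hI : ∀ x : ℝ, HasDerivAt (fun η : ℝ => Complex.I * (η : ℂ)) Complex.I x := fun x => by
    simpa using (Complex.ofRealCLM.hasDerivAt (x := x)).const_mul Complex.I
  simp only [poisson, hconj]
  have e1 : deriv (fun ξ : ℝ => M.symbol (ρ.1, (ξ, ρ.2.2))) ρ.2.1 = 1 := by
    have : HasDerivAt (fun ξ : ℝ => M.symbol (ρ.1, (ξ, ρ.2.2))) 1 ρ.2.1 :=
      ((Complex.ofRealCLM.hasDerivAt (x := ρ.2.1)).add_const (Complex.I * (ρ.2.2 : ℂ))).add_const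
        (M.dphi ρ.1.2 : ℂ)
    exact this.deriv
  have e2 : deriv (fun η : ℝ => M.symbol (ρ.1, (ρ.2.1, η))) ρ.2.2 = Complex.I := by
    have : HasDerivAt (fun η : ℝ => M.symbol (ρ.1, (ρ.2.1, η))) Complex.I ρ.2.2 :=
      ((hI ρ.2.2).const_add (ρ.2.1 : ℂ)).add_const (M.dphi ρ.1.2 : ℂ)
    exact this.deriv
  have e3 : deriv (fun η : ℝ => (ρ.2.1 : ℂ) - Complex.I * (η : ℂ) + (M.dphi ρ.1.2 : ℂ)) ρ.2.2
      = -Complex.I := (((hI ρ.2.2).const_sub _).add_const _).deriv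
  have e4 : deriv (fun ξ : ℝ => (ξ : ℂ) - Complex.I * (ρ.2.2 : ℂ) + (M.dphi ρ.1.2 : ℂ)) ρ.2.1
      = 1 := (((Complex.ofRealCLM.hasDerivAt (x := ρ.2.1)).sub_const _).add_const _).deriv
  have e5 : ∀ c : ℂ, dX (fun _ => c) ρ.1.1 = 0 := fun c => by simp [dX]
  have e6 : ∀ c : ℂ, M.dY (fun y => c + (M.dphi y : ℂ)) ρ.1.2
      = M.dY (fun y => (M.dphi y : ℂ)) ρ.1.2 := fun c => by
    simp only [dY]
    exact deriv_const_add _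
  rw [e1, e2, e3, e4]
  simp only [symbol, e5, e6]
  ring

theorem mem_sigmaPlus_iff (M : Model Y) (hM : ∀ y, DifferentiableAt ℝ
    (fun s : ℝ => M.dphi (y + M.cover s)) 0) (ρ : Phase Y) :
    ρ ∈ M.sigmaPlus ↔ ρ.2.2 = 0 ∧ M.dphi ρ.1.2 = -ρ.2.1 ∧ 0 < M.ddphi ρ.1.2 := by
  have h1 : M.dY (fun y => (M.dphi y : ℂ)) ρ.1.2 = (M.ddphi ρ.1.2 : ℂ) :=
    (hM ρ.1.2).hasDerivAt.ofReal_comp.deriv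
  have h2 : (1 / Complex.I * M.poisson M.symbol (fun ρ' => (starRingEnd ℂ) (M.symbol ρ')) ρ).re
      = 2 * M.ddphi ρ.1.2 := by
    rw [poisson_symbol, h1]
    have : 1 / Complex.I * (2 * Complex.I * (M.ddphi ρ.1.2 : ℂ)) = ((2 * M.ddphi ρ.1.2 : ℝ) : ℂ) := by
      push_cast; field_simp
    rw [this, Complex.ofReal_re]
  have h3 : M.symbol ρ = 0 ↔ ρ.2.2 = 0 ∧ M.dphi ρ.1.2 = -ρ.2.1 := by
    rw [Complex.ext_iff]
    simp only [symbol, Complex.add_re, Complex.add_im, Complex.mul_re, Complex.mul_im,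
      Complex.ofReal_re, Complex.ofReal_im, Complex.I_re, Complex.I_im, Complex.zero_re,
      Complex.zero_im]
    constructor
    · rintro ⟨h4, h5⟩
      exact ⟨by linarith, by linarith⟩
    · rintro ⟨h4, h5⟩
      rw [h4, h5]
      constructor <;> ring
  rw [sigmaPlus, mem_ofPred_eq, h2, h3, and_assoc]
  simp

/-- The density `|σ(∂_x κ, ∂_ξ κ)|` is equal to `1`. -/
theorem symplArea_density (M : Model Y) (q : S1 × ℝ) :
    |symplForm (M.velocity (fun s => M.sigmaPlusParam (q.1 + toS1 s, q.2)))
      (M.velocity (fun s => M.sigmaPlusParam (q.1, q.2 + s)))| = 1 := by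
  have h1 : deriv (fun s : ℝ => q.2 + s) 0 = 1 := by
    rw [deriv_const_add]; exact deriv_id 0
  have h2 : (fun s : ℝ => repS1 (q.1 + toS1 s - (q.1 + toS1 0))) = fun s => repS1 (toS1 s) := by
    funext s; rw [map_zero, add_zero, add_sub_cancel_left]
  simp only [symplForm, velocity, sigmaPlusParam, h1, h2, deriv_repS1, sub_self, deriv_const]
  norm_num

theorem symplArea_actionPreimage (M : Model Y) (hM : ∀ y, DifferentiableAt ℝ
    (fun s : ℝ => M.dphi (y + M.cover s)) 0) (a b : ℝ) :
    M.symplArea (M.actionPreimage a b) = 2 * Real.pi * volume.real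
      {ξ : ℝ | (∃ y, M.dphi y = -ξ ∧ 0 < M.ddphi y) ∧ M.action ξ ∈ Icc a b} := by
  have hset : {q : S1 × ℝ | M.sigmaPlusParam q ∈ M.actionPreimage a b} = univ ×ˢ
      {ξ : ℝ | (∃ y, M.dphi y = -ξ ∧ 0 < M.ddphi y) ∧ M.action ξ ∈ Icc a b} := by
    ext q
    simp only [actionPreimage, mem_ofPred_eq, mem_sigmaPlus_iff M hM, sigmaPlusParam, mem_prod,
      mem_univ, true_and]
    refine and_congr_left fun _ => ⟨fun h => ⟨_, h⟩, fun h => ?_⟩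
    -- The parametrization uses the chosen point `y₊(ξ)`, which has the required properties as soon
    -- as some point has them.
    exact @Classical.epsilon_spec_aux Y ⟨0⟩ _ h
  rw [symplArea]
  simp only [symplArea_density]
  rw [hset, setIntegral_const, smul_eq_mul, mul_one, measureReal_def, measureReal_def,
    Measure.volume_eq_prod, Measure.prod_prod, ENNReal.toReal_mul, AddCircle.measure_univ,
    ENNReal.toReal_ofReal Real.two_pi_pos.le]

theorem yPlus_eq (M : Model Y) {ξ : ℝ} {y : Y} (hy : M.dphi y = -ξ ∧ 0 < M.ddphi y)
    (hu : ∀ z, M.dphi z = -ξ → 0 < M.ddphi z → z = y) : M.yPlus ξ = y := by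
  have := @Classical.epsilon_spec_aux Y ⟨0⟩ (fun y => M.dphi y = -ξ ∧ 0 < M.ddphi y) ⟨y, hy⟩
  exact hu _ this.1 this.2

theorem yMinus_eq (M : Model Y) {ξ : ℝ} {y : Y} (hy : M.dphi y = -ξ ∧ M.ddphi y < 0)
    (hu : ∀ z, M.dphi z = -ξ → M.ddphi z < 0 → z = y) : M.yMinus ξ = y := by
  have := @Classical.epsilon_spec_aux Y ⟨0⟩ (fun y => M.dphi y = -ξ ∧ M.ddphi y < 0) ⟨y, hy⟩
  exact hu _ this.1 this.2

variable [TopologicalSpace Y] [IsTopologicalAddGroup Y] [T2Space Y]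
  [LocallyCompactSpace Y] [MeasureSpace Y] [BorelSpace Y] [SecondCountableTopology Y]
  [IsFiniteMeasureOnCompacts (volume : Measure Y)] [SigmaFinite (volume : Measure Y)]

/-- The distance is the variation of the phase along a segment on which the phase is monotone,
when every path meets a point at which the variation of the phase is at least as large. -/
theorem agmonDist_eq {M : Model Y} (hM : M.IsRegular) {ξ y l : ℝ} {y₁ : Y}
    (hend : M.cover y + M.cover l = y₁)
    (hmono : ∀ t ∈ Icc (0 : ℝ) 1, 0 ≤ (ξ + M.dphi (M.cover (y + l * t))) * l)
    (hmin : ∀ x, M.cover y + M.cover x = y₁ → ∃ z ∈ uIcc 0 x,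
      M.phase ξ (y + l) - M.phase ξ y ≤ |M.phase ξ (y + z) - M.phase ξ y|) :
    M.agmonDist ξ (M.cover y) y₁ = M.phase ξ (y + l) - M.phase ξ y := by
  have hdc : Continuous fun s => M.dphi (M.cover s) :=
    hM.continuous_dphi.comp hM.quotient.continuous
  have ftc : ∀ (g : ℝ → ℝ), ContDiff ℝ 1 g → g 0 = 0 → ∀ t,
      ∫ r in (0 : ℝ)..t, (ξ + M.dphi (M.cover (y + g r))) * deriv g r
        = M.phase ξ (y + g t) - M.phase ξ y := by
    intro g hg hg0 t
    have hd : ∀ r, HasDerivAt (fun r => M.phase ξ (y + g r))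
        ((ξ + M.dphi (M.cover (y + g r))) * deriv g r) r := fun r =>
      HasDerivAt.comp (h₂ := M.phase ξ) r (deriv_phase hM ξ (y + g r))
        (((hg.differentiable (by simp)) r).hasDerivAt.const_add y)
    have hc : Continuous fun r => (ξ + M.dphi (M.cover (y + g r))) * deriv g r :=
      (continuous_const.add (hdc.comp (continuous_const.add hg.continuous))).mul
        (hg.continuous_deriv le_rfl)
    rw [intervalIntegral.integral_eq_sub_of_hasDerivAt (fun r _ => hd r)
      (hc.intervalIntegrable _ _), hg0, add_zero]
  refine IsLeast.csInf_eq ⟨⟨fun t => l * t, contDiff_const.mul contDiff_id, mul_zero _,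
    by simpa using hend, ?_⟩, ?_⟩
  · have := ftc (fun t => l * t) (contDiff_const.mul contDiff_id) (mul_zero _) 1
    rw [mul_one] at this
    rw [← this]
    refine intervalIntegral.integral_congr fun t ht => ?_
    rw [uIcc_of_le zero_le_one] at ht
    have hdl : deriv (fun t : ℝ => l * t) t = l := by
      simp
    have h1 := hmono t ht
    simp only [hdl, map_add]
    rw [← abs_mul, ← map_add, abs_of_nonneg h1]
  · rintro _ ⟨g, hg, hg0, hg1, rfl⟩
    obtain ⟨z, hz, hz'⟩ := hmin _ hg1
    -- By the intermediate value theorem every competing path passes through the displacement `z`,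
    -- and up to that moment it is at least as long as the variation of the phase.
    have hiv : z ∈ g '' uIcc 0 1 := by
      have := intermediate_value_uIcc (a := (0 : ℝ)) (b := 1) hg.continuous.continuousOn
      rw [hg0] at this
      exact this hz
    obtain ⟨t, ht, rfl⟩ := hiv
    rw [uIcc_of_le zero_le_one] at ht
    have hc : Continuous fun r => |ξ + M.dphi (M.cover y + M.cover (g r))| * |deriv g r| := by
      simp only [← map_add]
      exact (continuous_const.add (hdc.comp (continuous_const.add hg.continuous))).abs.mul
        (hg.continuous_deriv le_rfl).abs
    calc M.phase ξ (y + l) - M.phase ξ y ≤ |M.phase ξ (y + g t) - M.phase ξ y| := hz'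
      _ = |∫ r in (0 : ℝ)..t, (ξ + M.dphi (M.cover (y + g r))) * deriv g r| := by
          rw [ftc g hg hg0]
      _ ≤ ∫ r in (0 : ℝ)..t, |(ξ + M.dphi (M.cover (y + g r))) * deriv g r| :=
          intervalIntegral.abs_integral_le_integral_abs ht.1
      _ = ∫ r in (0 : ℝ)..t, |ξ + M.dphi (M.cover y + M.cover (g r))| * |deriv g r| := by
          simp only [abs_mul, map_add]
      _ ≤ _ := intervalIntegral.integral_mono_interval le_rfl ht.1 ht.2
          (Filter.Eventually.of_forall fun r => by positivity) (hc.intervalIntegrable _ _)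

end Model

/-! ### The case `Y = ℝ` -/

theorem lineModel_action {m : ℝ} (hm : 0 < m) : lineModel.action (-m ^ 2) = 4 / 3 * m ^ 3 := by
  have h1 : lineModel.yPlus (-m ^ 2) = m := by
    refine lineModel.yPlus_eq ?_ fun z h h' => ?_
    · rw [lineModel_dphi, lineModel_ddphi]; exact ⟨by ring, by linarith⟩
    · rw [lineModel_dphi, neg_neg] at h
      rw [lineModel_ddphi] at h'
      exact (sq_eq_sq₀ (by linarith) hm.le).1 h
  have h2 : lineModel.yMinus (-m ^ 2) = -m := by
    refine lineModel.yMinus_eq ?_ fun z h h' => ?_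
    · rw [lineModel_dphi, lineModel_ddphi]; exact ⟨by ring, by linarith⟩
    · rw [lineModel_dphi, neg_neg] at h
      rw [lineModel_ddphi] at h'
      have := (sq_eq_sq₀ (a := -z) (by linarith) hm.le).1 (by rw [neg_sq]; exact h)
      linarith
  have h3 := Model.agmonDist_eq isRegular_lineModel (ξ := -m ^ 2) (y := m) (l := -(2 * m))
    (y₁ := -m) (by change m + -(2 * m) = -m; ring) (fun t ht => by
      change 0 ≤ (-m ^ 2 + lineModel.dphi (m + -(2 * m) * t)) * _
      rw [lineModel_dphi]
      have : 0 ≤ m * m ^ 2 * (t * (1 - t)) :=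
        mul_nonneg (by positivity) (mul_nonneg ht.1 (by linarith [ht.2]))
      nlinarith) (fun x hx => ⟨x, right_mem_uIcc, by
      have hx' : x = -(2 * m) := by
        have : m + x = -m := hx
        linarith
      rw [hx']
      exact le_abs_self _⟩)
  rw [Model.action, h1, h2]
  refine h3.trans ?_
  rw [lineModel_phase, lineModel_phase]
  ring

theorem lineModel_symplArea (a b : ℝ) :
    lineModel.symplArea (lineModel.actionPreimage a b) = 2 * Real.pi * volume.real
      {ξ : ℝ | ξ < 0 ∧ 4 / 3 * Real.sqrt (-ξ) ^ 3 ∈ Icc a b} := by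
  rw [Model.symplArea_actionPreimage]
  · congr 2
    ext ξ
    simp only [mem_ofPred_eq, lineModel_dphi, lineModel_ddphi]
    have h1 : (∃ y : ℝ, y ^ 2 = -ξ ∧ 0 < 2 * y) ↔ ξ < 0 := by
      constructor
      · rintro ⟨y, hy, hy'⟩
        have : 0 < y ^ 2 := pow_pos (by linarith) 2
        linarith
      · intro h
        exact ⟨Real.sqrt (-ξ), Real.sq_sqrt (by linarith),
          by have := Real.sqrt_pos.2 (neg_pos.2 h); linarith⟩
    rw [h1]
    refine and_congr_right fun h => ?_
    have h2 := lineModel_action (Real.sqrt_pos.2 (neg_pos.2 h))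
    rw [Real.sq_sqrt (by linarith), neg_neg] at h2
    rw [h2]
  · intro y
    simp only [lineModel_dphi]
    exact (((differentiable_const y).add differentiable_id).pow 2) 0

/-! ### The case `Y = S¹` -/

open Real in
-- The paths from `y₊` to `y₋` on the circle have displacement `∓2θ + 2πn`. Either the path runs
-- through the endpoint of the short arc, or its own endpoint is higher by `2π|n| cos θ ≥ 0`. So the
-- short arc is minimal, and the phase is monotone along it.
theorem circleModel_action {θ ξ : ℝ} (hθ : 0 < θ) (hθ' : θ ≤ π / 2) (hξ : |ξ| = cos θ) :
    circleModel.action ξ = 2 * (sin θ - θ * cos θ) := by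
  have hpi := pi_pos
  have hc : 0 ≤ cos θ := cos_nonneg_of_neg_pi_div_two_le_of_le (by linarith) hθ'
  -- `ξ = cos w`
  have crit : ∀ w, 0 < w → w < π → circleModel.yPlus (cos w) = toS1 (π + w) ∧
      circleModel.yMinus (cos w) = toS1 (π - w) := by
    intro w hw hw'
    have hs : 0 < sin w := sin_pos_of_pos_of_lt_pi hw hw'
    have sol : ∀ s, cos s = -cos w → (∃ n : ℤ, s = π + w + n * (2 * π)) ∨
        ∃ n : ℤ, s = π - w + n * (2 * π) := by
      intro s h
      rw [← cos_pi_sub, cos_eq_cos_iff] at h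
      obtain ⟨n, hn | hn⟩ := h
      · exact Or.inr ⟨-n, by push_cast; linarith⟩
      · exact Or.inl ⟨n - 1, by push_cast; linarith⟩
    constructor
    · refine circleModel.yPlus_eq ?_ fun z h h' => ?_
      · rw [circleModel_dphi, circleModel_ddphi, add_comm, cos_add_pi, sin_add_pi]
        exact ⟨rfl, by linarith⟩
      · obtain ⟨s, rfl⟩ := isOpenQuotientMap_toS1.surjective z
        rw [circleModel_dphi] at h
        rw [circleModel_ddphi] at h'
        rcases sol s h with ⟨n, rfl⟩ | ⟨n, rfl⟩
        · exact toS1_add_int_mul _ n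
        · rw [sin_add_int_mul_two_pi, sin_pi_sub] at h'
          linarith
    · refine circleModel.yMinus_eq ?_ fun z h h' => ?_
      · rw [circleModel_dphi, circleModel_ddphi, cos_pi_sub, sin_pi_sub]
        exact ⟨rfl, by linarith⟩
      · obtain ⟨s, rfl⟩ := isOpenQuotientMap_toS1.surjective z
        rw [circleModel_dphi] at h
        rw [circleModel_ddphi] at h'
        rcases sol s h with ⟨n, rfl⟩ | ⟨n, rfl⟩
        · rw [sin_add_int_mul_two_pi, add_comm, sin_add_pi] at h'
          linarith
        · exact toS1_add_int_mul _ n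
  have ends : ∀ x y₀ y₁ : ℝ, toS1 y₀ + toS1 x = toS1 y₁ → ∃ n : ℤ, x = y₁ - y₀ + n * (2 * π) := by
    intro x y₀ y₁ h
    rw [← map_add] at h
    obtain ⟨n, hn⟩ := toS1_eq_iff.1 h
    exact ⟨n, by linarith⟩
  rcases le_total 0 ξ with h0 | h0
  · rw [abs_of_nonneg h0] at hξ
    obtain ⟨h1, h2⟩ := crit θ hθ (by linarith)
    have hS : circleModel.phase (cos θ) (π + θ + -(2 * θ)) - circleModel.phase (cos θ) (π + θ)
        = 2 * (sin θ - θ * cos θ) := by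
      have e1 : π + θ + -(2 * θ) = π - θ := by ring
      rw [e1, circleModel_phase, circleModel_phase, sin_pi_sub, add_comm π θ, sin_add_pi]
      ring
    have h3 := Model.agmonDist_eq isRegular_circleModel (ξ := cos θ) (y := π + θ) (l := -(2 * θ))
      (y₁ := toS1 (π - θ)) (by change toS1 _ + toS1 _ = _; rw [← map_add]; congr 1; ring)
      (fun t ht => by
        change 0 ≤ (cos θ + circleModel.dphi (toS1 (π + θ + -(2 * θ) * t))) * _
        rw [circleModel_dphi]
        have e1 : π + θ + -(2 * θ) * t = (θ * (1 - 2 * t)) + π := by ring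
        rw [e1, cos_add_pi]
        have h4 : |θ * (1 - 2 * t)| ≤ θ := by
          rw [abs_mul, abs_of_pos hθ]
          exact mul_le_of_le_one_right hθ.le (abs_le.2 ⟨by linarith [ht.2], by linarith [ht.1]⟩)
        have h5 := cos_le_cos_of_nonneg_of_le_pi (abs_nonneg _) (by linarith) h4
        rw [cos_abs] at h5
        nlinarith)
      (fun x hx => by
        obtain ⟨n, hn⟩ := ends x _ _ hx
        rcases lt_or_ge n 0 with hn0 | hn0
        · have hn1 : (n : ℝ) ≤ -1 := by exact_mod_cast Int.le_sub_one_of_lt hn0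
          refine ⟨-(2 * θ), ?_, le_abs_self _⟩
          rw [uIcc_of_ge (by nlinarith)]
          exact ⟨by nlinarith, by linarith⟩
        · have hn1 : (0 : ℝ) ≤ n := by exact_mod_cast hn0
          refine ⟨x, right_mem_uIcc, le_trans ?_ (le_abs_self _)⟩
          have e1 : π + θ + x = π + θ + -(2 * θ) + n * (2 * π) := by rw [hn]; ring
          rw [e1, circleModel_phase, circleModel_phase, circleModel_phase, sin_add_int_mul_two_pi]
          have := mul_nonneg hc (mul_nonneg hn1 two_pi_pos.le)
          linarith)
    rw [Model.action, hξ, h1, h2, ← hS]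
    exact h3
  · rw [abs_of_nonpos h0] at hξ
    have hξ' : ξ = cos (π - θ) := by rw [cos_pi_sub]; linarith
    obtain ⟨h1, h2⟩ := crit (π - θ) (by linarith) (by linarith)
    have h1' : circleModel.yPlus (cos (π - θ)) = toS1 (-θ) := by
      rw [h1]; exact toS1_eq_iff.2 ⟨1, by push_cast; ring⟩
    rw [sub_sub_cancel] at h2
    have hS : circleModel.phase (cos (π - θ)) (-θ + 2 * θ) - circleModel.phase (cos (π - θ)) (-θ)
        = 2 * (sin θ - θ * cos θ) := by
      have e1 : -θ + 2 * θ = θ := by ring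
      rw [e1, circleModel_phase, circleModel_phase, sin_neg, cos_pi_sub]
      ring
    have h3 := Model.agmonDist_eq isRegular_circleModel (ξ := cos (π - θ)) (y := -θ) (l := 2 * θ)
      (y₁ := toS1 θ) (by change toS1 _ + toS1 _ = _; rw [← map_add]; congr 1; ring)
      (fun t ht => by
        change 0 ≤ (cos (π - θ) + circleModel.dphi (toS1 (-θ + 2 * θ * t))) * _
        rw [circleModel_dphi, cos_pi_sub]
        have e1 : -θ + 2 * θ * t = θ * (2 * t - 1) := by ring
        have h4 : |θ * (2 * t - 1)| ≤ θ := by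
          rw [abs_mul, abs_of_pos hθ]
          exact mul_le_of_le_one_right hθ.le (abs_le.2 ⟨by linarith [ht.1], by linarith [ht.2]⟩)
        have h5 := cos_le_cos_of_nonneg_of_le_pi (abs_nonneg _) (by linarith) h4
        rw [cos_abs] at h5
        rw [e1]
        nlinarith)
      (fun x hx => by
        obtain ⟨n, hn⟩ := ends x _ _ hx
        rcases lt_or_ge 0 n with hn0 | hn0
        · have hn1 : (1 : ℝ) ≤ n := by exact_mod_cast hn0
          refine ⟨2 * θ, ?_, le_abs_self _⟩
          rw [uIcc_of_le (by nlinarith)]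
          exact ⟨by linarith, by nlinarith⟩
        · have hn1 : (n : ℝ) ≤ 0 := by exact_mod_cast hn0
          refine ⟨x, right_mem_uIcc, le_trans ?_ (le_abs_self _)⟩
          have e1 : -θ + x = -θ + 2 * θ + n * (2 * π) := by rw [hn]; ring
          rw [e1, circleModel_phase, circleModel_phase, circleModel_phase, sin_add_int_mul_two_pi,
            cos_pi_sub]
          have := mul_nonneg hc (mul_nonneg (neg_nonneg.2 hn1) two_pi_pos.le)
          linarith)
    rw [Model.action, hξ', h1', h2, ← hS]
    exact h3

open Real in
theorem circleModel_symplArea (a b : ℝ) :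
    circleModel.symplArea (circleModel.actionPreimage a b) = 2 * π * volume.real
      {ξ : ℝ | |ξ| < 1 ∧ 2 * (sin (arccos |ξ|) - arccos |ξ| * |ξ|) ∈ Icc a b} := by
  rw [Model.symplArea_actionPreimage]
  · congr 2
    ext ξ
    simp only [mem_ofPred_eq]
    have h1 : (∃ y, circleModel.dphi y = -ξ ∧ 0 < circleModel.ddphi y) ↔ |ξ| < 1 := by
      constructor
      · rintro ⟨y, hy, hy'⟩
        obtain ⟨s, rfl⟩ := isOpenQuotientMap_toS1.surjective y
        rw [circleModel_dphi] at hy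
        rw [circleModel_ddphi] at hy'
        have h2 := sin_sq_add_cos_sq s
        rw [hy] at h2
        rw [abs_lt]
        constructor <;> nlinarith
      · intro h
        obtain ⟨h2, h3⟩ := abs_lt.1 h
        refine ⟨toS1 (arccos ξ + π), ?_, ?_⟩
        · rw [circleModel_dphi, cos_add_pi, cos_arccos h2.le h3.le]
        · rw [circleModel_ddphi, sin_add_pi, neg_neg]
          refine sin_pos_of_pos_of_lt_pi (arccos_pos.2 h3) ?_
          refine lt_of_le_of_ne (arccos_le_pi ξ) fun h4 => ?_
          rw [arccos_eq_pi] at h4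
          linarith
    rw [h1]
    refine and_congr_right fun h => ?_
    have hcos : cos (arccos |ξ|) = |ξ| :=
      cos_arccos (by linarith [abs_nonneg ξ]) h.le
    rw [circleModel_action (arccos_pos.2 h) (arccos_le_pi_div_two.2 (abs_nonneg ξ)) hcos.symm, hcos]
  · intro y
    obtain ⟨r, rfl⟩ := isOpenQuotientMap_toS1.surjective y
    have : (fun s : ℝ => circleModel.dphi (toS1 r + circleModel.cover s)) = fun s => cos (r + s) := by
      funext s
      have e1 : toS1 r + circleModel.cover s = toS1 (r + s) := (map_add toS1 r s).symm
      rw [e1, circleModel_dphi]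
    rw [this]
    exact (differentiable_cos.comp ((differentiable_const r).add differentiable_id)) 0

end

noncomputable section

/-! ## Counting integers -/

theorem int_ncard_le {F : Set ℤ} {d : ℝ} (hd : 0 ≤ d) (hF : ∀ k ∈ F, ∀ l ∈ F, (k : ℝ) - l ≤ d) :
    F.Finite ∧ (F.ncard : ℝ) ≤ d + 1 := by
  rcases F.eq_empty_or_nonempty with rfl | ⟨k₀, hk₀⟩
  · simp only [finite_empty, ncard_empty, true_and]
    push_cast
    linarith
  have hb : BddBelow F := ⟨k₀ - ⌊d⌋, fun l hl => by
    have := Int.le_floor.2 (by push_cast; exact hF k₀ hk₀ l hl : (((k₀ - l : ℤ) : ℝ)) ≤ d)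
    omega⟩
  have hm := Int.csInf_mem ⟨k₀, hk₀⟩ hb
  have hsub : F ⊆ (Finset.Icc (sInf F) (sInf F + ⌊d⌋) : Finset ℤ) := fun k hk => by
    have := Int.le_floor.2 (by push_cast; exact hF k hk _ hm : (((k - sInf F : ℤ) : ℝ)) ≤ d)
    rw [Finset.mem_coe, Finset.mem_Icc]
    exact ⟨csInf_le hb hk, by omega⟩
  refine ⟨(Finset.finite_toSet _).subset hsub, ?_⟩
  have h1 := ncard_le_ncard hsub (Finset.finite_toSet _)
  rw [ncard_coe_finset, Int.card_Icc] at h1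
  have h2 : 0 ≤ ⌊d⌋ := Int.floor_nonneg.2 hd
  have h3 : ((F.ncard : ℤ) : ℝ) ≤ ((⌊d⌋ + 1 : ℤ) : ℝ) := by
    exact_mod_cast (by omega : (F.ncard : ℤ) ≤ ⌊d⌋ + 1)
  push_cast at h3
  linarith [Int.floor_le d]

theorem ncard_lattice_le {E : Set ℝ} {h d : ℝ} (hh : 0 < h) (hd : 0 ≤ d)
    (hE : ∀ x ∈ E, ∀ y ∈ E, |x - y| ≤ d) :
    {k : ℤ | h * k ∈ E}.Finite ∧ ({k : ℤ | h * k ∈ E}.ncard : ℝ) ≤ d / h + 1 := by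
  refine int_ncard_le (div_nonneg hd hh.le) fun k hk l hl => ?_
  rw [le_div_iff₀ hh]
  have := (le_abs_self _).trans (hE _ hk _ hl)
  linarith

/-- Order-connectedness places `E` between the open and the closed interval with its infimum and
supremum as endpoints; both contain `(β - α)/h` lattice points up to an error of one. -/
theorem abs_ncard_lattice_sub_le {E : Set ℝ} {h d : ℝ} (hh : 0 < h)
    (hE : ∀ x ∈ E, ∀ y ∈ E, |x - y| ≤ d) (hc : E.OrdConnected) :
    |({k : ℤ | h * k ∈ E}.ncard : ℝ) - volume.real E / h| ≤ 1 := by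
  rcases E.eq_empty_or_nonempty with rfl | ⟨x₀, hx₀⟩
  · simp
  have hbb : BddBelow E := ⟨x₀ - d, fun y hy => by
    linarith [(le_abs_self _).trans (hE _ hx₀ _ hy)]⟩
  have hba : BddAbove E := ⟨x₀ + d, fun y hy => by
    linarith [(le_abs_self _).trans (hE _ hy _ hx₀)]⟩
  set α := sInf E
  set β := sSup E
  have hαβ : α ≤ β := (csInf_le hbb hx₀).trans (le_csSup hba hx₀)
  have hEI : E ⊆ Icc α β := fun x hx => ⟨csInf_le hbb hx, le_csSup hba hx⟩
  have hIE : Ioo α β ⊆ E := fun x hx => by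
    obtain ⟨y, hy, hy'⟩ := exists_lt_of_csInf_lt ⟨x₀, hx₀⟩ hx.1
    obtain ⟨z, hz, hz'⟩ := exists_lt_of_lt_csSup ⟨x₀, hx₀⟩ hx.2
    exact hc.out hy hz ⟨hy'.le, hz'.le⟩
  have hvol : volume.real E = β - α := by
    refine le_antisymm ?_ ?_
    · have := measureReal_mono hEI (μ := volume) (by simp)
      rwa [Real.volume_real_Icc_of_le hαβ] at this
    · have := measureReal_mono hIE (μ := volume)
        ((measure_mono hEI).trans_lt (by simp)).ne
      rwa [Real.volume_real_Ioo_of_le hαβ] at this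
  obtain ⟨hfin, hle⟩ := ncard_lattice_le (d := β - α) hh (by linarith) fun x hx y hy => by
    have h1 := hEI hx
    have h2 := hEI hy
    exact abs_sub_le_iff.2 ⟨by linarith [h1.2, h2.1], by linarith [h2.2, h1.1]⟩
  rw [hvol, abs_le]
  refine ⟨?_, by linarith⟩
  have hsub : ((Finset.Ioo ⌊α / h⌋ ⌈β / h⌉ : Finset ℤ) : Set ℤ) ⊆ {k : ℤ | h * k ∈ E} := by
    intro k hk
    rw [Finset.mem_coe, Finset.mem_Ioo, Int.floor_lt, Int.lt_ceil, div_lt_iff₀ hh,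
      lt_div_iff₀ hh] at hk
    exact hIE ⟨by linarith [hk.1], by linarith [hk.2]⟩
  have h1 := ncard_le_ncard hsub hfin
  rw [ncard_coe_finset, Int.card_Ioo] at h1
  have h2 : ((⌈β / h⌉ - ⌊α / h⌋ - 1 : ℤ) : ℝ) ≤ (({k : ℤ | h * k ∈ E}.ncard : ℤ) : ℝ) := by
    exact_mod_cast (by omega : ⌈β / h⌉ - ⌊α / h⌋ - 1 ≤ ({k : ℤ | h * k ∈ E}.ncard : ℤ))
  push_cast at h2
  have h3 := Int.le_ceil (β / h)
  have h4 := Int.floor_le (α / h)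
  rw [sub_div]
  linarith

/-- A set of integers `k` which is described, up to an error `ε`, by the condition
`S (h k) ∈ [a, b]`. -/
theorem abs_ncard_sub_volume_le {A : Set ℤ} {I : Set ℝ} {S : ℝ → ℝ} {a b ε q h : ℝ} (hh : 0 < h)
    (hε : 0 ≤ ε) (hq : 0 ≤ q) (hab : a ≤ b)
    (hA : ∀ k ∈ A, h * k ∈ I ∧ S (h * k) ∈ Icc (a - ε) (b + ε))
    (hA' : ∀ k : ℤ, h * k ∈ I → S (h * k) ∈ Icc (a + ε) (b - ε) → k ∈ A)
    (hJ : {x | x ∈ I ∧ S x ∈ Icc a b}.OrdConnected)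
    (hS : ∀ x ∈ I, ∀ y ∈ I, a - ε ≤ S x → a - ε ≤ S y → |x - y| ≤ q * |S x - S y|) :
    A.Finite ∧ |(A.ncard : ℝ) - volume.real {x | x ∈ I ∧ S x ∈ Icc a b} / h|
      ≤ 3 + 2 * (q * ε / h) := by
  have hdiam : ∀ α β, a - ε ≤ α → ∀ x ∈ {x | x ∈ I ∧ S x ∈ Icc α β},
      ∀ y ∈ {x | x ∈ I ∧ S x ∈ Icc α β}, |x - y| ≤ q * (β - α) := by
    rintro α β hα x ⟨hx, hx'⟩ y ⟨hy, hy'⟩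
    refine (hS x hx y hy (hα.trans hx'.1) (hα.trans hy'.1)).trans ?_
    refine mul_le_mul_of_nonneg_left ?_ hq
    exact abs_sub_le_iff.2 ⟨by linarith [hx'.2, hy'.1], by linarith [hy'.2, hx'.1]⟩
  -- The modes in dispute have `S` within `ε` of an end of `[a, b]`. Excess modes lie in the cells
  -- starting at `a - ε` and `b`, missing ones in those starting at `a` and `b - ε`. Two cells cost
  -- `2 (q ε/h + 1)`, and the lattice count of `[a, b]` itself costs one more.
  have hcell : ∀ α, a - ε ≤ α → {k : ℤ | h * k ∈ {x | x ∈ I ∧ S x ∈ Icc α (α + ε)}}.Finite ∧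
      ({k : ℤ | h * k ∈ {x | x ∈ I ∧ S x ∈ Icc α (α + ε)}}.ncard : ℝ) ≤ q * ε / h + 1 := by
    intro α hα
    refine ncard_lattice_le hh (by positivity) fun x hx y hy => ?_
    simpa using hdiam α (α + ε) hα x hx y hy
  have hJd := hdiam a b (by linarith)
  have hd0 : 0 ≤ q * (b - a) := mul_nonneg hq (by linarith)
  obtain ⟨hJf, -⟩ := ncard_lattice_le hh hd0 hJd
  have hJc := abs_le.1 (abs_ncard_lattice_sub_le hh hJd hJ)
  set Z := {k : ℤ | h * k ∈ {x | x ∈ I ∧ S x ∈ Icc a b}}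
  have hun : ∀ {X Y₀ Y₁ Y₂ : Set ℤ}, X ⊆ Y₀ ∪ Y₁ ∪ Y₂ → Y₀.Finite → Y₁.Finite → Y₂.Finite →
      X.Finite ∧ (X.ncard : ℝ) ≤ Y₀.ncard + Y₁.ncard + Y₂.ncard := by
    intro X Y₀ Y₁ Y₂ hX h0 h1 h2
    have hf := (h0.union h1).union h2
    refine ⟨hf.subset hX, ?_⟩
    have e1 := ncard_le_ncard hX hf
    have e2 := ncard_union_le (Y₀ ∪ Y₁) Y₂
    have e3 := ncard_union_le Y₀ Y₁
    exact_mod_cast (by omega : X.ncard ≤ Y₀.ncard + Y₁.ncard + Y₂.ncard)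
  obtain ⟨f1, c1⟩ := hcell (a - ε) le_rfl
  obtain ⟨f2, c2⟩ := hcell b (by linarith)
  obtain ⟨f3, c3⟩ := hcell a (by linarith)
  obtain ⟨f4, c4⟩ := hcell (b - ε) (by linarith)
  obtain ⟨hAf, hup⟩ := hun (X := A) (fun k hk => by
    obtain ⟨hk1, hk2, hk3⟩ := hA k hk
    by_cases ha : S (h * k) < a
    · exact Or.inl (Or.inr ⟨hk1, hk2, by linarith⟩)
    · by_cases hb : b < S (h * k)
      · exact Or.inr ⟨hk1, hb.le, hk3⟩
      · exact Or.inl (Or.inl ⟨hk1, not_lt.1 ha, not_lt.1 hb⟩)) hJf f1 f2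
  obtain ⟨-, hlow⟩ := hun (X := Z) (fun k hk => by
    obtain ⟨hk1, hk2, hk3⟩ := hk
    by_cases ha : S (h * k) < a + ε
    · exact Or.inl (Or.inr ⟨hk1, hk2, ha.le⟩)
    · by_cases hb : b - ε < S (h * k)
      · exact Or.inr ⟨hk1, hb.le, by linarith⟩
      · exact Or.inl (Or.inl (hA' k hk1 ⟨not_lt.1 ha, not_lt.1 hb⟩))) hAf f3 f4
  refine ⟨hAf, abs_le.2 ⟨by linarith [hJc.1], by linarith [hJc.2]⟩⟩

/-! ## Localization of the spectrum in a window -/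

section

variable {H : Type} [NormedAddCommGroup H] [InnerProductSpace ℂ H]

/-- `s ‖u‖² ≤ ‖A u‖²` on the graph of `A`. -/
def BoundedBelow (G : Submodule ℂ (H × H)) (s : ℝ) : Prop :=
  ∀ p ∈ G, s * ‖p.1‖ ^ 2 ≤ ‖p.2‖ ^ 2

/-- `s ‖u‖² ≤ ‖A u‖²` for one of the combinations `u` of any two elements of the domain. -/
def TwoBoundedBelow (G : Submodule ℂ (H × H)) (s : ℝ) : Prop :=
  ∀ p ∈ G, ∀ q ∈ G, ∃ c d : ℂ, (c ≠ 0 ∨ d ≠ 0) ∧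
    s * ‖c • p.1 + d • q.1‖ ^ 2 ≤ ‖c • p.2 + d • q.2‖ ^ 2

/-- `‖A u‖² ≤ s ‖u‖²` for some `u ≠ 0`. -/
def HasQuasimode (G : Submodule ℂ (H × H)) (s : ℝ) : Prop :=
  ∃ p ∈ G, p.1 ≠ 0 ∧ ‖p.2‖ ^ 2 ≤ s * ‖p.1‖ ^ 2

variable {G : Submodule ℂ (H × H)} {s t : ℝ}

theorem BoundedBelow.mono (hG : BoundedBelow G t) (hst : s ≤ t) : BoundedBelow G s :=
  fun p hp => (mul_le_mul_of_nonneg_right hst (by positivity)).trans (hG p hp)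

theorem BoundedBelow.two (hG : BoundedBelow G s) : TwoBoundedBelow G s :=
  fun p hp _ _ => ⟨1, 0, Or.inl one_ne_zero, by simpa using hG p hp⟩

theorem TwoBoundedBelow.mono (hG : TwoBoundedBelow G t) (hst : s ≤ t) : TwoBoundedBelow G s :=
  fun p hp q hq => by
    obtain ⟨c, d, hcd, h⟩ := hG p hp q hq
    exact ⟨c, d, hcd, (mul_le_mul_of_nonneg_right hst (by positivity)).trans h⟩

theorem HasQuasimode.mono (hG : HasQuasimode G s) (hst : s ≤ t) : HasQuasimode G t := by
  obtain ⟨p, hp, hp0, h⟩ := hG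
  exact ⟨p, hp, hp0, h.trans (mul_le_mul_of_nonneg_right hst (by positivity))⟩

theorem IsBottom.le_of_quasimode {Q : H →L[ℂ] H} {τ μ : ℝ} {e : H} (hμ : IsBottom G Q τ μ e)
    (hG : HasQuasimode G s) : μ ≤ s := by
  obtain ⟨p, hp, hp0, h⟩ := hG
  have : 0 < ‖p.1‖ ^ 2 := by positivity
  exact le_of_mul_le_mul_right ((hμ.lower p hp).trans h) this

end

namespace Model

variable {Y : Type} [AddCommGroup Y] [TopologicalSpace Y] [IsTopologicalAddGroup Y] [T2Space Y]
  [LocallyCompactSpace Y] [MeasureSpace Y] [BorelSpace Y] [SecondCountableTopology Y]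
  [IsFiniteMeasureOnCompacts (volume : Measure Y)] [SigmaFinite (volume : Measure Y)]
  {M : Model Y}

/-- The eigenvalues in the window belong to the Fourier modes `k` for which `S k ∈ [a, b]`, up to
an error `ε = h log (2 B)`; nothing is claimed about the modes in `E`. -/
theorem exists_modes (hM : M.IsRegular) {h a b B ε : ℝ} (hh : 0 < h) (hB : 1 ≤ B)
    (hε : ε = h * Real.log (2 * B)) (ha : 2 * ε ≤ a) (hab : a < b)
    {Z E : Set ℤ} (hZ : Z.Finite) {S : ℤ → ℝ}
    (h2 : ∀ k ∈ Z, TwoBoundedBelow (fiberGraph (M.graphP h) (tensor Y) k) (h / B))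
    (hl : ∀ k ∈ Z, k ∉ E → BoundedBelow (fiberGraph (M.graphP h) (tensor Y) k)
      (h / B * Real.exp (-2 * S k / h)))
    (hu : ∀ k ∈ Z, k ∉ E → HasQuasimode (fiberGraph (M.graphP h) (tensor Y) k)
      (B * h * Real.exp (-2 * S k / h)))
    (hout : ∀ k ∉ Z, BoundedBelow (fiberGraph (M.graphP h) (tensor Y) k)
        (h / B * Real.exp (-a / h)) ∨
      TwoBoundedBelow (fiberGraph (M.graphP h) (tensor Y) k) (h / B) ∧
        HasQuasimode (fiberGraph (M.graphP h) (tensor Y) k) (h * Real.exp (-2 * b / h) / 2)) :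
    ∃ A : Set ℤ, HasDiscreteSpectrumIn (M.opPstarP h)
        (Icc (h * Real.exp (-2 * b / h)) (h * Real.exp (-2 * a / h))) ∧
      spectrumCount (M.opPstarP h)
        (Icc (h * Real.exp (-2 * b / h)) (h * Real.exp (-2 * a / h))) = A.ncard ∧
      (∀ k ∈ A, k ∈ Z ∧ (k ∉ E → S k ∈ Icc (a - ε) (b + ε))) ∧
      ∀ k ∈ Z, k ∉ E → S k ∈ Icc (a + ε) (b - ε) → k ∈ A := by
  have hB0 : 0 < B := by linarith
  have hεe : Real.exp (ε / h) = 2 * B := by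
    rw [hε, mul_div_cancel_left₀ _ hh.ne', Real.exp_log (by linarith)]
  set t₀ := h * Real.exp (-2 * b / h) with ht₀
  set t₁ := h * Real.exp (-2 * a / h) with ht₁
  have ht₀0 : 0 < t₀ := by positivity
  have ht₁0 : 0 < t₁ := by positivity
  have hle : t₀ ≤ t₁ := mul_le_mul_of_nonneg_left (Real.exp_le_exp.2
    (div_le_div_of_nonneg_right (by linarith) hh.le)) hh.le
  -- From `2ε ≤ a` one has `e^{a/h} ≥ (2B)²`, so the top `t₁ = h e^{-2a/h}` of the window lies well
  -- below both thresholds `h/B` and `(h/B) e^{-a/h}`. This makes room for `τ = 2 t₁` and `s = 3 t₁`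
  -- in all fibers at once.
  have hea : 4 * B ^ 2 * Real.exp (-a / h) ≤ 1 := by
    have h3 : Real.exp (ε / h) ^ 2 ≤ Real.exp (a / h) := by
      rw [← Real.exp_nat_mul]
      refine Real.exp_le_exp.2 ?_
      push_cast
      rw [mul_div_assoc']
      exact div_le_div_of_nonneg_right ha hh.le
    rw [hεe] at h3
    rw [neg_div, Real.exp_neg, ← div_eq_mul_inv, div_le_one (Real.exp_pos _)]
    nlinarith
  have hs : 3 * t₁ ≤ h / B * Real.exp (-a / h) := by
    have h3 : Real.exp (-2 * a / h) = Real.exp (-a / h) * Real.exp (-a / h) := by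
      rw [← Real.exp_add]; congr 1; ring
    rw [ht₁, h3, div_mul_eq_mul_div, le_div_iff₀ hB0]
    have h4 : 3 * B * Real.exp (-a / h) ≤ 1 := by
      refine le_trans (mul_le_mul_of_nonneg_right ?_ (Real.exp_pos _).le) hea
      nlinarith
    have h5 := mul_le_mul_of_nonneg_left h4 (mul_nonneg hh.le (Real.exp_pos (-a / h)).le)
    linarith
  have ha0 : 0 ≤ a := by
    have : 0 ≤ ε := by rw [hε]; exact mul_nonneg hh.le (Real.log_nonneg (by linarith))
    linarith
  have hs' : 3 * t₁ ≤ h / B := hs.trans (mul_le_of_le_one_right (by positivity)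
    (Real.exp_le_one_iff.2 (div_nonpos_of_nonpos_of_nonneg (by linarith) hh.le)))
  obtain ⟨Q, μ, e, hF⟩ := M.exists_isFibered hM h (s := 3 * t₁) (τ := 2 * t₁) (by linarith)
    (by linarith) fun k => by
      by_cases hk : k ∈ Z
      · exact (h2 k hk).mono hs'
      · rcases hout k hk with h3 | ⟨h3, -⟩
        · exact (h3.mono hs).two
        · exact h3.mono hs'
  have hupper : ∀ k r, BoundedBelow (fiberGraph (M.graphP h) (tensor Y) k) r → r ≤ 2 * t₁ →
      r ≤ μ k := fun k r h3 h4 => (hF.bottom k).upper r h4 h3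
  -- Modes outside `Z` miss the window by a definite margin on one side or the other, so the finite
  -- set `Z` alone decides the finiteness near the window. The second alternative serves the line,
  -- where infinitely many modes have tiny eigenvalues.
  have hnot : ∀ k ∉ Z, 2 * t₁ ≤ μ k ∨ μ k ≤ t₀ / 2 := by
    intro k hk
    rcases hout k hk with h3 | ⟨-, h3⟩
    · exact Or.inl (hupper k _ (h3.mono (by linarith)) le_rfl)
    · exact Or.inr ((hF.bottom k).le_of_quasimode h3)
  obtain ⟨hdisc, hcount⟩ := hF.spectrum_and_count (t₀ := t₀) (t₁ := t₁) (r := t₀ / 2) ht₀0.le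
    (by linarith) (by linarith) (hZ.subset fun k hk => by
      by_contra hkZ
      rcases hnot k hkZ with h3 | h3
      · exact absurd hk.2 (not_lt.2 h3)
      · exact absurd hk.1 (not_lt.2 h3))
  refine ⟨{k | μ k ∈ Icc t₀ t₁}, hdisc, hcount, fun k hk => ?_, fun k hk hkE hS => ?_⟩
  · have hkZ : k ∈ Z := by
      by_contra hkZ
      rcases hnot k hkZ with h3 | h3
      · linarith [hk.2]
      · linarith [hk.1]
    refine ⟨hkZ, fun hkE => ⟨?_, ?_⟩⟩
    · by_contra! h3
      -- A shift of `S` by `ε` changes `e^{-2S/h}` by the factor `e^{2ε/h} = 4B²`, which more than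
      -- compensates the loss of `B` in the bounds. The other three comparisons rest on the same
      -- choice of `ε`.
      have h4 : t₁ < h / B * Real.exp (-2 * S k / h) := by
        have h5 : Real.exp (-2 * (a - ε) / h) ≤ Real.exp (-2 * S k / h) :=
          Real.exp_le_exp.2 (div_le_div_of_nonneg_right (by linarith) hh.le)
        have h6 : Real.exp (-2 * (a - ε) / h) = Real.exp (-2 * a / h) * (2 * B) ^ 2 := by
          rw [← hεe, ← Real.exp_nat_mul, ← Real.exp_add]
          congr 1
          push_cast
          ring
        calc t₁ < t₁ * (4 * B) := by nlinarith
          _ = h / B * Real.exp (-2 * (a - ε) / h) := by rw [h6, ht₁]; field_simp; ring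
          _ ≤ _ := mul_le_mul_of_nonneg_left h5 (by positivity)
      -- The bottom `μ k` is truncated at `2 t₁`, so a lower bound transfers to it only after
      -- truncation at the same level.
      have h5 := hupper k (min (h / B * Real.exp (-2 * S k / h)) (2 * t₁))
        ((hl k hkZ hkE).mono (min_le_left _ _)) (min_le_right _ _)
      have h6 : t₁ < min (h / B * Real.exp (-2 * S k / h)) (2 * t₁) := lt_min h4 (by linarith)
      linarith [hk.2]
    · by_contra! h3
      have h4 := (hF.bottom k).le_of_quasimode (hu k hkZ hkE)
      have h5 : B * h * Real.exp (-2 * S k / h) < t₀ := by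
        have h5 : Real.exp (-2 * S k / h) ≤ Real.exp (-2 * (b + ε) / h) :=
          Real.exp_le_exp.2 (div_le_div_of_nonneg_right (by linarith) hh.le)
        have h6 : Real.exp (-2 * b / h) = Real.exp (-2 * (b + ε) / h) * (2 * B) ^ 2 := by
          rw [← hεe, ← Real.exp_nat_mul, ← Real.exp_add]
          congr 1
          push_cast
          ring
        have h7 : B * (h * Real.exp (-2 * (b + ε) / h)) < 4 * B ^ 2 * (h * Real.exp (-2 * (b + ε) / h)) := by
          refine mul_lt_mul_of_pos_right (by nlinarith) (by positivity)
        calc B * h * Real.exp (-2 * S k / h) ≤ B * h * Real.exp (-2 * (b + ε) / h) :=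
              mul_le_mul_of_nonneg_left h5 (by positivity)
          _ < t₀ := by rw [ht₀, h6]; linarith
      linarith [hk.1]
  · constructor
    · refine hupper k t₀ ((hl k hk hkE).mono ?_) (by linarith)
      have h5 : Real.exp (-2 * (b - ε) / h) ≤ Real.exp (-2 * S k / h) :=
        Real.exp_le_exp.2 (div_le_div_of_nonneg_right (by linarith [hS.2]) hh.le)
      have h6 : Real.exp (-2 * (b - ε) / h) = Real.exp (-2 * b / h) * (2 * B) ^ 2 := by
        rw [← hεe, ← Real.exp_nat_mul, ← Real.exp_add]
        congr 1
        push_cast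
        ring
      calc t₀ ≤ t₀ * (4 * B) := by nlinarith
        _ = h / B * Real.exp (-2 * (b - ε) / h) := by rw [h6, ht₀]; field_simp; ring
        _ ≤ _ := mul_le_mul_of_nonneg_left h5 (by positivity)
    · refine ((hF.bottom k).le_of_quasimode (hu k hk hkE)).trans ?_
      have h5 : Real.exp (-2 * S k / h) ≤ Real.exp (-2 * (a + ε) / h) :=
        Real.exp_le_exp.2 (div_le_div_of_nonneg_right (by linarith [hS.1]) hh.le)
      have h6 : Real.exp (-2 * a / h) = Real.exp (-2 * (a + ε) / h) * (2 * B) ^ 2 := by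
        rw [← hεe, ← Real.exp_nat_mul, ← Real.exp_add]
        congr 1
        push_cast
        ring
      have h7 : B * (h * Real.exp (-2 * (a + ε) / h)) ≤ 4 * B ^ 2 * (h * Real.exp (-2 * (a + ε) / h)) :=
        mul_le_mul_of_nonneg_right (by nlinarith) (by positivity)
      calc B * h * Real.exp (-2 * S k / h) ≤ B * h * Real.exp (-2 * (a + ε) / h) :=
            mul_le_mul_of_nonneg_left h5 (by positivity)
        _ ≤ t₁ := by rw [ht₁, h6]; linarith

end Model

end

noncomputable section

/-! ## The two models -/

theorem finite_lattice {h R : ℝ} (hh : 0 < h) {Ω : Set ℝ} (hΩ : ∀ x ∈ Ω, |x| ≤ R) :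
    {k : ℤ | h * k ∈ Ω}.Finite := by
  rcases Ω.eq_empty_or_nonempty with rfl | ⟨x, hx⟩
  · simp
  refine (ncard_lattice_le (d := 2 * R) hh (by linarith [abs_nonneg x, hΩ x hx])
    fun x hx y hy => ?_).1
  linarith [abs_sub x y, hΩ x hx, hΩ y hy]

/-! ### The case `Y = ℝ` -/

set_option maxHeartbeats 1000000 in
-- In terms of `m = √(-ξ)` the action is `4/3 m³`. Modes with `D ≤ m < R` obey the two-sided
-- estimates, with constants absorbed in `B`. For the remaining smaller `m`, and for `ξ ≥ 0`, the
-- lower bound at `D` keeps the eigenvalue above the window since `8/3 D³ < a`; for `m ≥ R` the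
-- quasimode pushes it below.
theorem lineModel_count (c : ℝ) (hc : 1 ≤ c) : ∃ C > 0, ∀ {h a b D B : ℝ}, 0 < h → 0 < D → D ≤ 1 →
    h ≤ D ^ 3 → 8 / 3 * D ^ 3 < a → a < b → b ≤ c → C ≤ B → 6 * Real.pi ^ 4 ≤ B * D ^ 2 →
    2 * (h * Real.log (2 * B)) ≤ a →
    HasDiscreteSpectrumIn (lineModel.opPstarP h)
        (Icc (h * Real.exp (-2 * b / h)) (h * Real.exp (-2 * a / h))) ∧
      |(spectrumCount (lineModel.opPstarP h)
          (Icc (h * Real.exp (-2 * b / h)) (h * Real.exp (-2 * a / h))) : ℝ)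
        - 1 / (2 * Real.pi * h) * lineModel.symplArea (lineModel.actionPreimage a b)|
        ≤ 3 + Real.log (2 * B) / D := by
  obtain ⟨C, hC, hup⟩ := lineModel_upper
  -- Large enough that `b + C m ≤ 4/3 m³` for `m ≥ R`: this beats the factor `C m` of the quasimode
  -- and puts the eigenvalue below half of the lower end of the window.
  set R := 1 + c + C with hR
  have hR1 : 1 ≤ R := by linarith
  refine ⟨1 + C * R, by positivity, ?_⟩
  intro h a b D B hh hD hD1 hhD haD hab hbc hCB hBD hε
  have hpi := Real.pi_gt_three
  have hB1 : 1 ≤ B := by linarith [mul_pos hC (zero_lt_one.trans_le hR1)]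
  have hB0 : 0 < B := by linarith
  have hlog : 0 ≤ Real.log (2 * B) := Real.log_nonneg (by linarith)
  have hh1 : h ≤ 1 := hhD.trans (pow_le_one₀ hD.le hD1)
  set S : ℝ → ℝ := fun x => 4 / 3 * Real.sqrt (-x) ^ 3 with hS
  set Z : Set ℤ := {k | h * k ∈ Ioc (-R ^ 2) (-D ^ 2)} with hZ
  have hroot : ∀ {k : ℤ} {d : ℝ}, 0 ≤ d → h * k ≤ -d ^ 2 →
      d ≤ Real.sqrt (-(h * k)) ∧ h * k = -Real.sqrt (-(h * k)) ^ 2 := by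
    intro k d hd hk
    refine ⟨Real.le_sqrt_of_sq_le (by linarith), ?_⟩
    rw [Real.sq_sqrt (by linarith [sq_nonneg d]), neg_neg]
  have hconst : ∀ {m : ℝ}, D ≤ m → h / B ≤ m / 3 * h / (4 * Real.pi) := by
    intro m hm
    rw [div_le_div_iff₀ hB0 (by positivity)]
    have h1 : 6 * Real.pi ^ 4 ≤ B * D := hBD.trans (mul_le_mul_of_nonneg_left (by nlinarith) hB0.le)
    have h2 : 12 * Real.pi ≤ 6 * Real.pi ^ 4 := by
      have : 2 ≤ Real.pi ^ 3 := by nlinarith [pow_pos Real.pi_pos 2]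
      nlinarith
    have h3 : B * D ≤ B * m := mul_le_mul_of_nonneg_left hm hB0.le
    have h4 : h * (12 * Real.pi) ≤ h * (B * m) := mul_le_mul_of_nonneg_left (by linarith) hh.le
    linarith
  obtain ⟨A, hdisc, hcount, hA, hA'⟩ := Model.exists_modes isRegular_lineModel hh hB1 rfl hε hab
    (Z := Z) (E := ∅) (S := fun k => S (h * k))
    (finite_lattice hh (R := R ^ 2) fun x hx => abs_le.2 ⟨hx.1.le, by
      linarith [hx.2, sq_nonneg D, sq_nonneg R]⟩)
    (fun k hk => by
      obtain ⟨h1, h2⟩ := hroot hD.le hk.2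
      exact TwoBoundedBelow.mono (lineModel_two_dim hh (hD.trans_le h1) h2) (hconst h1))
    (fun k hk _ => by
      obtain ⟨h1, h2⟩ := hroot hD.le hk.2
      exact BoundedBelow.mono (lineModel_lower hh (hD.trans_le h1) h2.ge)
        (mul_le_mul_of_nonneg_right (hconst h1) (Real.exp_pos _).le))
    (fun k hk _ => by
      obtain ⟨h1, h2⟩ := hroot hD.le hk.2
      have h3 : Real.sqrt (-(h * k)) ≤ R :=
        Real.sqrt_le_iff.2 ⟨by linarith, by linarith [hk.1]⟩
      refine HasQuasimode.mono (hup hh (hD.trans_le h1)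
        (hhD.trans (pow_le_pow_left₀ hD.le h1 3)) h2) ?_
      refine mul_le_mul_of_nonneg_right ?_ (Real.exp_pos _).le
      have h4 : C * Real.sqrt (-(h * k)) ≤ B :=
        (mul_le_mul_of_nonneg_left h3 hC.le).trans (by linarith)
      linarith [mul_le_mul_of_nonneg_left h4 hh.le])
    (fun k hk => by
      rcases le_or_gt (h * k) (-D ^ 2) with h0 | h0
      · rcases le_or_gt (h * k) (-R ^ 2) with h0' | h0'
        · right
          obtain ⟨h1, h2⟩ := hroot hD.le h0
          obtain ⟨h3, -⟩ := hroot (zero_le_one.trans hR1) h0'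
          refine ⟨TwoBoundedBelow.mono (lineModel_two_dim hh (hD.trans_le h1) h2) (hconst h1), ?_⟩
          refine HasQuasimode.mono (hup hh (hD.trans_le h1)
            (hhD.trans (pow_le_pow_left₀ hD.le h1 3)) h2) ?_
          set m := Real.sqrt (-(h * k))
          have hm0 : 0 < m := hD.trans_le h1
          have h4 : C * m ≤ 4 / 3 * m ^ 3 - b := by
            have e1 : R * R * m ≤ m ^ 3 := by
              have := mul_le_mul h3 h3 (by linarith) hm0.le
              nlinarith
            have e2 : R * m ≤ R * R * m := by nlinarith [mul_pos (zero_lt_one.trans_le hR1) hm0]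
            have e3 : R * m = m + c * m + C * m := by rw [hR]; ring
            have e4 : c ≤ c * m := by nlinarith
            nlinarith [pow_pos hm0 3]
          have h5 : 2 * (C * m) ≤ Real.exp (2 * (4 / 3 * m ^ 3 - b) / h) := by
            have h6 : 2 * (C * m) ≤ 2 * (4 / 3 * m ^ 3 - b) / h := by
              rw [le_div_iff₀ hh]
              nlinarith [mul_pos hC hm0]
            linarith [Real.add_one_le_exp (2 * (4 / 3 * m ^ 3 - b) / h)]
          have h6 : Real.exp (-2 * b / h)
              = Real.exp (2 * (4 / 3 * m ^ 3 - b) / h) * Real.exp (-2 * (4 / 3 * m ^ 3) / h) := by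
            rw [← Real.exp_add]; congr 1; ring
          rw [h6]
          have h7 := mul_le_mul_of_nonneg_right h5
            (mul_nonneg hh.le (Real.exp_pos (-2 * (4 / 3 * m ^ 3) / h)).le)
          linarith
        · exact absurd ⟨h0', h0⟩ hk
      · left
        refine BoundedBelow.mono (lineModel_lower hh hD h0.le) ?_
        refine mul_le_mul (hconst le_rfl) (Real.exp_le_exp.2 ?_) (Real.exp_pos _).le (by positivity)
        exact div_le_div_of_nonneg_right (by linarith) hh.le)
  have hSD : ∀ x, 4 / 3 * D ^ 3 < S x → D ≤ Real.sqrt (-x) := fun x hx => by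
    by_contra! h1
    have := pow_le_pow_left₀ (Real.sqrt_nonneg (-x)) h1.le 3
    simp only [hS] at hx
    linarith
  have hSneg : ∀ x, 4 / 3 * D ^ 3 < S x → x ≤ -D ^ 2 := fun x hx => by
    have := (Real.le_sqrt' hD).1 (hSD x hx)
    linarith
  -- For `ξ = -m²` and `S = 4/3 m³` one has `|dξ/dS| = 1/(2m)`, whence `q = 1/(2D)` on the region `m
  -- ≥ D`. The condition `2ε ≤ a` keeps `S ≥ a - ε` inside this region.
  obtain ⟨-, hn⟩ := abs_ncard_sub_volume_le (A := A) (I := Iio 0) (S := S) (a := a) (b := b)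
    (ε := h * Real.log (2 * B)) (q := 1 / (2 * D)) hh (by positivity) (by positivity) hab.le
    (fun k hk => by
      obtain ⟨h1, h2⟩ := hA k hk
      exact ⟨lt_of_le_of_lt h1.2 (by simpa using pow_pos hD 2), h2 (notMem_empty k)⟩)
    (fun k hk hk' => by
      have hε0 := mul_nonneg hh.le hlog
      refine hA' k ⟨?_, hSneg _ (by linarith [hk'.1, pow_pos hD 3])⟩ (notMem_empty k) hk'
      by_contra! h1
      obtain ⟨h2, -⟩ := hroot (zero_le_one.trans hR1) h1
      have h3 := pow_le_pow_left₀ (zero_le_one.trans hR1) h2 3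
      have h4 : R ≤ R ^ 3 := le_self_pow₀ hR1 (by norm_num)
      have h5 := hk'.2
      simp only [hS] at h5
      linarith)
    ⟨fun x hx y hy z hz => by
      have anti : ∀ u v : ℝ, u ≤ v → S v ≤ S u := fun u v huv =>
        mul_le_mul_of_nonneg_left (pow_le_pow_left₀ (Real.sqrt_nonneg _)
          (Real.sqrt_le_sqrt (by linarith)) 3) (by norm_num)
      exact ⟨lt_of_le_of_lt hz.2 hy.1, hy.2.1.trans (anti _ _ hz.2),
        (anti _ _ hz.1).trans hx.2.2⟩⟩
    (fun x hx y hy hx' hy' => by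
      have h1 := hSD x (by linarith)
      have h2 := hSD y (by linarith)
      have ex : x = -Real.sqrt (-x) ^ 2 := by
        rw [Real.sq_sqrt (by linarith [mem_Iio.1 hx]), neg_neg]
      have ey : y = -Real.sqrt (-y) ^ 2 := by
        rw [Real.sq_sqrt (by linarith [mem_Iio.1 hy]), neg_neg]
      have e1 : |x - y| = |Real.sqrt (-x) - Real.sqrt (-y)| * (Real.sqrt (-x) + Real.sqrt (-y)) := by
        rw [← abs_of_nonneg (a := Real.sqrt (-x) + Real.sqrt (-y)) (by positivity), ← abs_mul,
          abs_sub_comm]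
        congr 1
        linear_combination ey - ex
      simp only [hS]
      set u := Real.sqrt (-x)
      set v := Real.sqrt (-y)
      have e2 : 4 / 3 * u ^ 3 - 4 / 3 * v ^ 3 = (u - v) * (4 / 3 * (u ^ 2 + u * v + v ^ 2)) := by
        ring
      rw [e1, e2, abs_mul, abs_of_nonneg (a := 4 / 3 * (u ^ 2 + u * v + v ^ 2)) (by positivity),
        mul_left_comm]
      refine mul_le_mul_of_nonneg_left ?_ (abs_nonneg _)
      rw [div_mul_eq_mul_div, one_mul, le_div_iff₀ (by positivity)]
      nlinarith [sq_nonneg (u - v), mul_le_mul_of_nonneg_left h1 (by linarith : 0 ≤ u + v),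
        mul_le_mul_of_nonneg_left h2 (by linarith : 0 ≤ u + v)])
  refine ⟨hdisc, ?_⟩
  have e1 : 1 / (2 * Real.pi * h) * lineModel.symplArea (lineModel.actionPreimage a b)
      = volume.real {x | x ∈ Iio 0 ∧ S x ∈ Icc a b} / h := by
    have e0 : ∀ V : ℝ, 1 / (2 * Real.pi * h) * (2 * Real.pi * V) = V / h := fun V => by field_simp
    rw [lineModel_symplArea]
    exact e0 _
  have e2 : 2 * (1 / (2 * D) * (h * Real.log (2 * B)) / h) = Real.log (2 * B) / D := by
    field_simp
  rw [hcount, e1, ← e2]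
  exact hn

/-! ### The case `Y = S¹` -/

section

open Real

/-- The action is at most `θ³`, by `sin θ ≤ θ` and `cos θ ≥ 1 - θ²/2`; so `S ≥ a - ε` forces `θ ≥
D`. -/
theorem sin_sub_mul_cos_le {θ : ℝ} (hθ : 0 ≤ θ) : 2 * (sin θ - θ * cos θ) ≤ θ ^ 3 := by
  have h1 := sin_le hθ
  have h2 := mul_le_mul_of_nonneg_left (one_sub_sq_div_two_le_cos (x := θ)) hθ
  nlinarith

/-- The action has derivative `2θ sin θ`, and `-cos θ` has derivative `sin θ`; the ratio is `2θ ≥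
2D`. This is the bound `|dξ/dS| ≤ 1/(2D)` for the circle. -/
theorem sub_cos_le {D θ₁ θ₂ : ℝ} (hD : 0 ≤ D) (h1 : D ≤ θ₁) (h12 : θ₁ ≤ θ₂) (h2 : θ₂ ≤ π) :
    2 * D * (cos θ₁ - cos θ₂)
      ≤ 2 * (sin θ₂ - θ₂ * cos θ₂) - 2 * (sin θ₁ - θ₁ * cos θ₁) := by
  have hd : ∀ θ, HasDerivAt (fun θ => 2 * (sin θ - θ * cos θ) + 2 * D * cos θ)
      (2 * (θ - D) * sin θ) θ := fun θ => by
    have := (((hasDerivAt_sin θ).sub ((hasDerivAt_id θ).mul (hasDerivAt_cos θ))).const_mul 2).add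
      ((hasDerivAt_cos θ).const_mul (2 * D))
    refine this.congr_deriv ?_
    simp only [id_eq]
    ring
  have hm : MonotoneOn (fun θ => 2 * (sin θ - θ * cos θ) + 2 * D * cos θ) (Icc D π) :=
    monotoneOn_of_hasDerivWithinAt_nonneg (convex_Icc D π)
      (fun θ _ => (hd θ).continuousAt.continuousWithinAt) (fun θ _ => (hd θ).hasDerivWithinAt)
      fun θ hθ => by
        rw [interior_Icc] at hθ
        exact mul_nonneg (by linarith [hθ.1]) (sin_nonneg_of_nonneg_of_le_pi (by linarith [hθ.1])
          hθ.2.le)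
  have := hm ⟨h1, h12.trans h2⟩ ⟨h1.trans h12, h2⟩ h12
  simp only at this
  linarith

/-- Only modes with `|h k| ≤ cos D` matter: beyond them, including `|h k| ≥ 1`, the lower bound at
`D` places the eigenvalue above the window. The action is even in `ξ`, so its preimage of `[a, b]`
is covered, up to the point `0`, by one interval in each half-line; two counts with error `3 + log
(2B)/D` and one unit for the mode `0` add up to the bound. -/
theorem circleModel_count : ∃ C > 0, ∀ {h a b D B : ℝ}, 0 < h → 0 < D → D ≤ 1 →
    h ≤ D ^ 3 → 8 / 3 * D ^ 3 < a → a < b → C ≤ B → 6 * π ^ 4 ≤ B * D ^ 2 →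
    2 * (h * log (2 * B)) ≤ a →
    HasDiscreteSpectrumIn (circleModel.opPstarP h)
        (Icc (h * exp (-2 * b / h)) (h * exp (-2 * a / h))) ∧
      |(spectrumCount (circleModel.opPstarP h)
          (Icc (h * exp (-2 * b / h)) (h * exp (-2 * a / h))) : ℝ)
        - 1 / (2 * π * h) * circleModel.symplArea (circleModel.actionPreimage a b)|
        ≤ 7 + 2 * (log (2 * B) / D) := by
  obtain ⟨C, hC, hup⟩ := circleModel_upper
  refine ⟨1 + C, by positivity, ?_⟩
  intro h a b D B hh hD hD1 hhD haD hab hCB hBD hε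
  have hpi := pi_gt_three
  have hB1 : 1 ≤ B := by linarith
  have hB0 : 0 < B := by linarith
  have hlog : 0 ≤ log (2 * B) := log_nonneg (by linarith)
  have hh1 : h ≤ 1 := hhD.trans (pow_le_one₀ hD.le hD1)
  have hh2 : h ≤ D ^ 2 := hhD.trans (pow_le_pow_of_le_one hD.le hD1 (by norm_num))
  have hcD : 0 < cos D := cos_pos_of_mem_Ioo ⟨by linarith, by linarith⟩
  set S : ℝ → ℝ := fun x => 2 * (sin (arccos |x|) - arccos |x| * |x|) with hS
  set Z : Set ℤ := {k | h * k ∈ {x : ℝ | |x| ≤ cos D}} with hZ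
  have hsin : ∀ {θ : ℝ}, D ≤ θ → θ ≤ π / 2 → 2 * D / π ≤ sin θ := fun {θ} h1 h2 =>
    (by rw [div_mul_eq_mul_div] ; gcongr : 2 * D / π ≤ 2 / π * θ).trans
      (mul_le_sin (by linarith) h2)
  have hconst : h / B ≤ (2 * D / π) ^ 2 / (6 * π) * h / (4 * π) := by
    have e1 : (2 * D / π) ^ 2 / (6 * π) * h / (4 * π) = D ^ 2 * h / (6 * π ^ 4) := by
      field_simp; ring
    rw [e1, div_le_div_iff₀ hB0 (by positivity)]
    linarith [mul_le_mul_of_nonneg_left hBD hh.le]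
  have hconst1 : ∀ {s : ℝ}, 2 * D / π ≤ s → h / B ≤ s ^ 2 / (6 * π) * h / (4 * π) := by
    intro s hs
    refine hconst.trans ?_
    gcongr
  have hconst2 : ∀ {s : ℝ}, 2 * D / π ≤ s → h / B ≤ s / (2 * π ^ 2) * h / (4 * π) := by
    intro s hs
    refine hconst.trans ?_
    have e1 : (2 * D / π) ^ 2 / (6 * π) ≤ s / (2 * π ^ 2) := by
      have e2 : 2 * D / π ≤ 1 := by rw [div_le_one (by linarith)]; linarith
      have e3 : (2 * D / π) ^ 2 ≤ s := by nlinarith [div_pos (by linarith : 0 < 2 * D) pi_pos]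
      rw [div_le_div_iff₀ (by positivity) (by positivity)]
      have e4 : 2 * π ^ 2 * (2 * D / π) ^ 2 ≤ 6 * π * s := by
        have e5 : 2 * π ^ 2 * (2 * D / π) ^ 2 = 4 * π * D * (2 * D / π) := by
          field_simp; ring
        rw [e5]
        have e6 : 0 ≤ 2 * D / π := by positivity
        have e7 : 4 * π * D ≤ 6 * π := by nlinarith
        exact mul_le_mul e7 hs e6 (by positivity)
      linarith
    gcongr
  have harc : ∀ {x : ℝ}, |x| ≤ cos D → D ≤ arccos |x| ∧ arccos |x| ≤ π / 2 ∧
      |x| = cos (arccos |x|) := fun {x} hx => by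
    refine ⟨?_, arccos_le_pi_div_two.2 (abs_nonneg x), (cos_arccos (by linarith [abs_nonneg x])
      (hx.trans (cos_le_one D))).symm⟩
    rw [← arccos_cos hD.le (by linarith)]
    exact arccos_le_arccos hx
  -- The mode `0` stays in `Z`, since its spectrum still has the gap above a simple bottom, but
  -- nothing is claimed about where this bottom lies.
  obtain ⟨A, hdisc, hcount, hA, hA'⟩ := Model.exists_modes isRegular_circleModel hh hB1 rfl hε hab
    (Z := Z) (E := {0}) (S := fun k => S (h * k))
    (finite_lattice hh (R := 1) fun x hx => (show |x| ≤ cos D from hx).trans (cos_le_one D))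
    (fun k hk => by
      obtain ⟨h1, h2, h3⟩ := harc hk
      have h4 : h * k ∈ Icc (-1 : ℝ) 1 := abs_le.1 ((show |h * k| ≤ cos D from hk).trans (cos_le_one D))
      have h5 : sin (arccos (h * k)) = sin (arccos |h * k|) := by
        rw [sin_arccos, sin_arccos, sq_abs]
      have h6 : 0 < sin (arccos (h * k)) := by
        rw [h5]; exact sin_pos_of_pos_of_lt_pi (hD.trans_le h1) (by linarith)
      have h7 : arccos (h * k) < π := lt_of_le_of_ne (arccos_le_pi _) fun h8 => by
        rw [h8, sin_pi] at h6; exact h6.ne rfl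
      have h8 : 0 < arccos (h * k) := lt_of_le_of_ne (arccos_nonneg _) fun h8 => by
        rw [← h8, sin_zero] at h6; exact h6.ne rfl
      refine TwoBoundedBelow.mono (circleModel_two_dim hh h8 h7 (cos_arccos h4.1 h4.2).symm) ?_
      rw [h5]
      exact hconst1 (hsin h1 h2))
    (fun k hk hk0 => by
      obtain ⟨h1, h2, h3⟩ := harc hk
      have h4 := circleModel_lower hh (hD.trans_le h1) h2 hk0 h3.ge
      rw [← h3] at h4
      exact BoundedBelow.mono h4 (mul_le_mul_of_nonneg_right (hconst2 (hsin h1 h2)) (exp_pos _).le))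
    (fun k hk _ => by
      obtain ⟨h1, h2, h3⟩ := harc hk
      have h4 := hup hh (hD.trans_le h1) h2 hh1 (hh2.trans (pow_le_pow_left₀ hD.le h1 2)) h3
      rw [← h3] at h4
      refine HasQuasimode.mono h4 ?_
      refine mul_le_mul_of_nonneg_right ?_ (exp_pos _).le
      exact mul_le_mul_of_nonneg_right (by linarith) hh.le)
    (fun k hk => by
      left
      have h0 : cos D < |h * k| := not_le.1 hk
      refine BoundedBelow.mono (circleModel_lower hh hD (by linarith) ?_ h0.le) ?_
      · rintro rfl
        simp at h0
        linarith
      · refine mul_le_mul (hconst2 (hsin le_rfl (by linarith))) (exp_le_exp.2 ?_) (exp_pos _).le ?_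
        · refine div_le_div_of_nonneg_right ?_ hh.le
          have := sin_sub_mul_cos_le hD.le
          linarith [pow_pos hD 3]
        · have := sin_nonneg_of_nonneg_of_le_pi hD.le (by linarith)
          positivity)
  have hε0 := mul_nonneg hh.le hlog
  have hSD : ∀ {x : ℝ}, |x| < 1 → a - h * log (2 * B) ≤ S x → |x| ≤ cos D := by
    intro x hx hx'
    by_contra! h1
    have h2 : arccos |x| ≤ D := by
      rw [← arccos_cos hD.le (by linarith)]
      exact arccos_le_arccos h1.le
    have h3 := sin_sub_mul_cos_le (arccos_nonneg |x|)
    rw [cos_arccos (by linarith [abs_nonneg x]) hx.le] at h3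
    have h4 := pow_le_pow_left₀ (arccos_nonneg |x|) h2 3
    simp only [hS] at hx'
    linarith
  have hSle : ∀ {x y : ℝ}, |x| ≤ |y| → |y| ≤ cos D → 2 * D * (|y| - |x|) ≤ S x - S y := by
    intro x y hxy hy
    obtain ⟨h1, h2, h3⟩ := harc (hxy.trans hy)
    obtain ⟨h1', h2', h3'⟩ := harc hy
    have := sub_cos_le hD.le h1' (arccos_le_arccos hxy) (by linarith)
    rwa [← h3, ← h3'] at this
  have anti : ∀ {x y : ℝ}, |x| ≤ |y| → |y| < 1 → S y ≤ S x := by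
    intro x y hxy hy
    have h1 := sub_cos_le (D := 0) le_rfl (arccos_nonneg |y|) (arccos_le_arccos hxy) (arccos_le_pi _)
    rw [cos_arccos (by linarith [abs_nonneg y]) hy.le,
      cos_arccos (by linarith [abs_nonneg x]) (hxy.trans hy.le)] at h1
    simp only [hS]
    linarith
  -- The half-lines are treated separately: on each, the action is monotone in `ξ`, and `|x| ↦ x` is
  -- an isometry.
  have half : ∀ (I : Set ℝ) (P : Set ℤ), (∀ x ∈ I, x ≠ 0 ∧ |x| < 1) →
      (∀ k : ℤ, h * k ∈ I ↔ k ∈ P ∧ |h * k| < 1) →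
      (∀ x ∈ I, ∀ y ∈ I, |(|x| - |y|)| = |x - y|) →
      {x | x ∈ I ∧ S x ∈ Icc a b}.OrdConnected →
      (A ∩ P).Finite ∧ |((A ∩ P).ncard : ℝ) - volume.real {x | x ∈ I ∧ S x ∈ Icc a b} / h|
        ≤ 3 + log (2 * B) / D := by
    intro I P hI1 hIP hIs hIJ
    have := abs_ncard_sub_volume_le (A := A ∩ P) (I := I) (S := S) (a := a) (b := b)
      (ε := h * log (2 * B)) (q := 1 / (2 * D)) hh hε0 (by positivity) hab.le
      (fun k hk => by
        obtain ⟨h1, h2⟩ := hA k hk.1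
        have h3 : |h * k| < 1 := lt_of_le_of_lt h1 (by
          rw [← cos_zero]; exact cos_lt_cos_of_nonneg_of_le_pi le_rfl (by linarith) hD)
        have h4 := (hIP k).2 ⟨hk.2, h3⟩
        refine ⟨h4, h2 ?_⟩
        rintro rfl
        exact (hI1 _ h4).1 (by simp))
      (fun k hk hk' => by
        obtain ⟨h1, h2⟩ := hI1 _ hk
        refine ⟨hA' k (hSD h2 (by linarith [hk'.1])) ?_ hk', ((hIP k).1 hk).1⟩
        rintro rfl
        exact h1 (by simp))
      hIJ
      (fun x hx y hy hx' hy' => by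
        have h1 := hSD (hI1 x hx).2 hx'
        have h2 := hSD (hI1 y hy).2 hy'
        rw [← hIs x hx y hy, div_mul_eq_mul_div, one_mul, le_div_iff₀ (by positivity)]
        rcases le_total |x| |y| with h3 | h3
        · rw [abs_of_nonpos (by linarith)]
          linarith [hSle h3 h2, le_abs_self (S x - S y)]
        · rw [abs_of_nonneg (by linarith)]
          linarith [hSle h3 h1, neg_abs_le (S x - S y)])
    have e2 : 2 * (1 / (2 * D) * (h * log (2 * B)) / h) = log (2 * B) / D := by
      field_simp
    rwa [e2] at this
  have hO1 : {x | x ∈ Ioo (0 : ℝ) 1 ∧ S x ∈ Icc a b}.OrdConnected :=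
    ⟨fun x hx y hy z hz => by
      have h1 : 0 < z := hx.1.1.trans_le hz.1
      have h2 : z < 1 := hz.2.trans_lt hy.1.2
      refine ⟨⟨h1, h2⟩, hy.2.1.trans (anti ?_ ?_), (anti ?_ ?_).trans hx.2.2⟩
      · rw [abs_of_pos h1, abs_of_pos hy.1.1]; exact hz.2
      · rw [abs_of_pos hy.1.1]; exact hy.1.2
      · rw [abs_of_pos h1, abs_of_pos hx.1.1]; exact hz.1
      · rw [abs_of_pos h1]; exact h2⟩
  have hO2 : {x | x ∈ Ioo (-1 : ℝ) 0 ∧ S x ∈ Icc a b}.OrdConnected :=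
    ⟨fun x hx y hy z hz => by
      have h1 : z < 0 := hz.2.trans_lt hy.1.2
      have h2 : -1 < z := hx.1.1.trans_le hz.1
      refine ⟨⟨h2, h1⟩, hx.2.1.trans (anti ?_ ?_), (anti ?_ ?_).trans hy.2.2⟩
      · rw [abs_of_neg h1, abs_of_neg hx.1.2]; linarith [hz.1]
      · rw [abs_of_neg hx.1.2]; linarith [hx.1.1]
      · rw [abs_of_neg h1, abs_of_neg hy.1.2]; linarith [hz.2]
      · rw [abs_of_neg h1]; linarith⟩
  obtain ⟨f1, n1⟩ := half (Ioo 0 1) (Ioi 0)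
    (fun x hx => ⟨hx.1.ne', by rw [abs_of_pos hx.1]; exact hx.2⟩)
    (fun k => by
      simp only [mem_Ioo, mem_Ioi, mul_pos_iff_of_pos_left hh, Int.cast_pos]
      refine and_congr_right fun hk => ?_
      rw [abs_of_pos (mul_pos hh (Int.cast_pos.2 hk))])
    (fun x hx y hy => by rw [abs_of_pos hx.1, abs_of_pos hy.1])
    hO1
  obtain ⟨f2, n2⟩ := half (Ioo (-1) 0) (Iio 0)
    (fun x hx => ⟨hx.2.ne, by rw [abs_of_neg hx.2]; linarith [hx.1]⟩)
    (fun k => by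
      have h1 : h * (k : ℝ) < 0 ↔ k < 0 := by
        rw [← Int.cast_lt_zero (R := ℝ)]
        exact ⟨fun h2 => by by_contra! h3; linarith [mul_nonneg hh.le h3],
          fun h2 => mul_neg_of_pos_of_neg hh h2⟩
      rw [mem_Ioo, mem_Iio, h1, and_comm]
      refine and_congr_right fun hk => ?_
      rw [abs_of_neg (h1.2 hk), neg_lt])
    (fun x hx y hy => by
      rw [abs_of_neg hx.2, abs_of_neg hy.2, neg_sub_neg, abs_sub_comm])
    hO2
  refine ⟨hdisc, ?_⟩
  set J := {ξ : ℝ | |ξ| < 1 ∧ 2 * (sin (arccos |ξ|) - arccos |ξ| * |ξ|) ∈ Icc a b} with hJ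
  set J₁ := {x | x ∈ Ioo 0 1 ∧ S x ∈ Icc a b}
  set J₂ := {x | x ∈ Ioo (-1) 0 ∧ S x ∈ Icc a b}
  have hvol : volume.real J = volume.real J₁ + volume.real J₂ := by
    have hd : Disjoint J₁ J₂ := Set.disjoint_left.2 fun x h1 h2 => lt_asymm h1.1.1 h2.1.2
    have hf1 : volume J₁ ≠ ⊤ := ((measure_mono (t := Ioo 0 1) fun x hx => hx.1).trans_lt
      (by simp)).ne
    have hf2 : volume J₂ ≠ ⊤ := ((measure_mono (t := Ioo (-1) 0) fun x hx => hx.1).trans_lt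
      (by simp)).ne
    rw [← measureReal_union hd hO2.measurableSet hf1 hf2]
    refine measureReal_congr ?_
    have h0 : ∀ᵐ x : ℝ, x ≠ 0 := compl_mem_ae_iff.2 (measure_singleton 0)
    filter_upwards [h0] with x hx
    refine propext ⟨fun ⟨h1, h2⟩ => ?_, ?_⟩
    · rw [abs_lt] at h1
      rcases lt_or_gt_of_ne hx with h3 | h3
      · exact Or.inr ⟨⟨h1.1, h3⟩, h2⟩
      · exact Or.inl ⟨⟨h3, h1.2⟩, h2⟩
    · rintro (⟨h1, h2⟩ | ⟨h1, h2⟩)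
      · exact ⟨abs_lt.2 ⟨by linarith [h1.1], h1.2⟩, h2⟩
      · exact ⟨abs_lt.2 ⟨h1.1, by linarith [h1.2]⟩, h2⟩
  have hsplit : A.ncard ≤ (A ∩ Ioi 0).ncard + (A ∩ Iio 0).ncard + 1 ∧
      (A ∩ Ioi 0).ncard + (A ∩ Iio 0).ncard ≤ A.ncard := by
    have hsub : A ⊆ A ∩ Ioi 0 ∪ A ∩ Iio 0 ∪ {0} := fun k hk => by
      rcases lt_trichotomy k 0 with h1 | h1 | h1
      · exact Or.inl (Or.inr ⟨hk, h1⟩)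
      · exact Or.inr h1
      · exact Or.inl (Or.inl ⟨hk, h1⟩)
    have hfin := (f1.union f2).union (finite_singleton (0 : ℤ))
    have hdisj : Disjoint (A ∩ Ioi 0) (A ∩ Iio 0) := Set.disjoint_left.2 fun k h1 h2 =>
      lt_asymm (mem_Ioi.1 h1.2) (mem_Iio.1 h2.2)
    have h1 := ncard_union_eq hdisj f1 f2
    have h2 := ncard_union_le (A ∩ Ioi 0 ∪ A ∩ Iio 0) {0}
    have h3 := ncard_le_ncard hsub hfin
    rw [ncard_singleton] at h2
    refine ⟨by omega, ?_⟩
    rw [← h1]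
    exact ncard_le_ncard (union_subset inter_subset_left inter_subset_left) (hfin.subset hsub)
  have e1 : 1 / (2 * π * h) * circleModel.symplArea (circleModel.actionPreimage a b)
      = volume.real J₁ / h + volume.real J₂ / h := by
    rw [circleModel_symplArea, ← hJ, hvol]
    field_simp
  rw [hcount, e1]
  have h1 : (A.ncard : ℝ) ≤ (A ∩ Ioi 0).ncard + (A ∩ Iio 0).ncard + 1 := by exact_mod_cast hsplit.1
  have h2 : ((A ∩ Ioi 0).ncard : ℝ) + (A ∩ Iio 0).ncard ≤ A.ncard := by exact_mod_cast hsplit.2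
  rw [abs_le] at n1 n2 ⊢
  constructor <;> linarith [n1.1, n1.2, n2.1, n2.2]

end

end

/-! ### The choice of the parameters `D` and `B`, and the theorem. -/

noncomputable section

theorem theorem2p6 (c : ℝ) (hc : 1 ≤ c) (δ₀ : ℝ) (hδ₀ : 0 < δ₀) (hδ₀' : δ₀ < 1) :
    ∃ C₀ : ℝ, 0 < C₀ ∧ ∃ K : ℝ, 0 < K ∧
      ∀ h δ a b : ℝ, 0 < h → 0 < δ → δ ≤ δ₀ →
        C₀ * h ≤ δ ^ (3 / 2 : ℝ) / Real.log δ⁻¹ →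
        δ ^ (3 / 2 : ℝ) / c ≤ a → a ≤ c * δ ^ (3 / 2 : ℝ) →
        1 / c ≤ b → b ≤ c → a < b →
        (HasDiscreteSpectrumIn (lineModel.opPstarP h)
            (Set.Icc (h * Real.exp (-2 * b / h)) (h * Real.exp (-2 * a / h))) ∧
          |(spectrumCount (lineModel.opPstarP h)
              (Set.Icc (h * Real.exp (-2 * b / h)) (h * Real.exp (-2 * a / h))) : ℝ)
            - 1 / (2 * Real.pi * h) * lineModel.symplArea (lineModel.actionPreimage a b)|
            ≤ K * (Real.log δ⁻¹ / Real.sqrt δ)) ∧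
        (HasDiscreteSpectrumIn (circleModel.opPstarP h)
            (Set.Icc (h * Real.exp (-2 * b / h)) (h * Real.exp (-2 * a / h))) ∧
          |(spectrumCount (circleModel.opPstarP h)
              (Set.Icc (h * Real.exp (-2 * b / h)) (h * Real.exp (-2 * a / h))) : ℝ)
            - 1 / (2 * Real.pi * h) * circleModel.symplArea (circleModel.actionPreimage a b)|
            ≤ K * (Real.log δ⁻¹ / Real.sqrt δ)) := by
  obtain ⟨C₁, hC₁, hline⟩ := lineModel_count c hc
  obtain ⟨C₂, hC₂, hcircle⟩ := circleModel_count
  have hpi := Real.pi_pos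
  set A := 54 * Real.pi ^ 4 * c ^ 2 + C₁ + C₂ + 1 with hA
  have hA1 : 1 ≤ A := by
    have : 0 ≤ 54 * Real.pi ^ 4 * c ^ 2 := by positivity
    linarith
  set L₀ := Real.log δ₀⁻¹
  have hL₀ : 0 < L₀ := Real.log_pos ((one_lt_inv₀ hδ₀).2 hδ₀')
  have hlogA : 0 ≤ Real.log (2 * A) := Real.log_nonneg (by linarith)
  set C₃ := Real.log (2 * A) / L₀ + 1
  have hC₃ : 1 ≤ C₃ := by
    have : 0 ≤ Real.log (2 * A) / L₀ := by positivity
    linarith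
  -- The first summand of `C₀` yields `2ε ≤ a`, the second `h ≤ D³`. In `K`, the term `7/L₀` absorbs
  -- the bounded part of the error, because `log δ⁻¹ ≥ L₀ > 0` and `√δ ≤ 1`; the other term comes
  -- from `2 log (2B)/D` with `1/D = 3c/√δ`.
  refine ⟨2 * C₃ * c + 27 * c ^ 3 / L₀, by positivity, 7 / L₀ + 6 * c * C₃, by positivity, ?_⟩
  intro h δ a b hh hδ hδδ hCh hca _ _ hbc hab
  set σ := Real.sqrt δ with hσ
  have hσ0 : 0 < σ := Real.sqrt_pos.2 hδ
  have hσ2 : σ ^ 2 = δ := Real.sq_sqrt hδ.le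
  have hσ1 : σ ≤ 1 := Real.sqrt_le_one.2 (by linarith)
  have hσ3 : δ ^ (3 / 2 : ℝ) = σ ^ 3 := by
    rw [hσ, Real.sqrt_eq_rpow, ← Real.rpow_natCast, ← Real.rpow_mul hδ.le]
    norm_num
  set L := Real.log δ⁻¹ with hL
  have hL₀L : L₀ ≤ L := Real.log_le_log (by positivity) (inv_anti₀ hδ hδδ)
  have hL0 : 0 < L := hL₀.trans_le hL₀L
  rw [hσ3] at hCh hca
  rw [le_div_iff₀ hL0] at hCh
  rw [div_le_iff₀ (by positivity)] at hca
  -- Comparable to `√δ` and small enough for the action at `D` to lie safely below `a`: from `a ≥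
  -- σ³/c` one gets `a ≥ 27 c² D³`, more than `8/3 D³`.
  set D := σ / (3 * c) with hD
  have hDσ : D * (3 * c) = σ := div_mul_cancel₀ _ (by positivity)
  have hD0 : 0 < D := by positivity
  have hD1 : D ≤ 1 := by rw [hD, div_le_one (by positivity)]; linarith
  have hD3 : 27 * c ^ 3 * D ^ 3 = σ ^ 3 := by rw [← hDσ]; ring
  have hhL : 27 * c ^ 3 / L₀ * h * L ≤ σ ^ 3 := by
    refine le_trans ?_ hCh
    have : 0 ≤ 2 * C₃ * c * h * L := by positivity
    linarith
  have hhC : 2 * C₃ * c * h * L ≤ σ ^ 3 := by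
    refine le_trans ?_ hCh
    have : 0 ≤ 27 * c ^ 3 / L₀ * h * L := by positivity
    linarith
  have hhD : h ≤ D ^ 3 := by
    have h1 : 27 * c ^ 3 * h ≤ 27 * c ^ 3 / L₀ * h * L := by
      have e1 : 27 * c ^ 3 / L₀ * h * L = 27 * c ^ 3 * h * (L / L₀) := by field_simp
      rw [e1]
      exact le_mul_of_one_le_right (by positivity) ((one_le_div hL₀).2 hL₀L)
    rw [← hD3] at hhL
    exact le_of_mul_le_mul_left (h1.trans hhL) (by positivity)
  have haD : 8 / 3 * D ^ 3 < a := by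
    rw [← hD3] at hca
    have h1 : c ≤ c ^ 3 := le_self_pow₀ hc (by norm_num)
    have h2 : c * (8 / 3 * D ^ 3) < c * a := by
      have := mul_le_mul_of_nonneg_right h1 (pow_pos hD0 3).le
      have h3 : 0 < c * D ^ 3 := by positivity
      linarith
    exact lt_of_mul_lt_mul_left h2 (by linarith)
  -- Then `B D² = A/(9c²)`, which explains the term `54 π⁴ c²` in `A`. The logarithm of `2B` is `log
  -- δ⁻¹` plus a constant, hence at most `C₃ log δ⁻¹` because `δ ≤ δ₀ < 1`.
  set B := A / δ with hB
  have hAB : A ≤ B := by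
    rw [hB, le_div_iff₀ hδ]
    exact mul_le_of_le_one_right (by linarith) (by linarith)
  have hBD : 6 * Real.pi ^ 4 ≤ B * D ^ 2 := by
    have e1 : B * D ^ 2 = A / (9 * c ^ 2) := by
      rw [hB, hD, ← hσ2]; field_simp; ring
    rw [e1, le_div_iff₀ (by positivity), hA]
    linarith
  have hΛ : Real.log (2 * B) ≤ C₃ * L := by
    have e1 : Real.log (2 * B) = Real.log (2 * A) + L := by
      rw [hL, ← Real.log_mul (by positivity) (by positivity)]
      congr 1
      rw [hB]; ring
    have e2 : Real.log (2 * A) ≤ Real.log (2 * A) / L₀ * L := by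
      rw [div_mul_eq_mul_div, le_div_iff₀ hL₀]
      exact mul_le_mul_of_nonneg_left hL₀L hlogA
    rw [e1]
    linarith
  have hε : 2 * (h * Real.log (2 * B)) ≤ a := by
    have h1 := mul_le_mul_of_nonneg_left hΛ (by positivity : 0 ≤ 2 * c * h)
    have h2 : c * (2 * (h * Real.log (2 * B))) ≤ c * a := by linarith
    exact le_of_mul_le_mul_left h2 (by linarith)
  have herr : 7 + 2 * (Real.log (2 * B) / D) ≤ (7 / L₀ + 6 * c * C₃) * (L / σ) := by
    have h1 : 7 ≤ 7 / L₀ * (L / σ) := by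
      rw [div_mul_div_comm, le_div_iff₀ (by positivity)]
      nlinarith [mul_le_of_le_one_right hL₀.le hσ1]
    have h2 : Real.log (2 * B) / D ≤ 3 * c * C₃ * (L / σ) := by
      have e1 : 3 * c * C₃ * (L / σ) = C₃ * L / D := by rw [hD]; field_simp
      rw [e1]
      exact div_le_div_of_nonneg_right hΛ hD0.le
    linarith
  have hpos : 0 ≤ Real.log (2 * B) / D :=
    div_nonneg (Real.log_nonneg (by linarith)) hD0.le
  have hA54 : 0 ≤ 54 * Real.pi ^ 4 * c ^ 2 := by positivity
  obtain ⟨d1, n1⟩ := hline hh hD0 hD1 hhD haD hab hbc (by linarith) hBD hε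
  obtain ⟨d2, n2⟩ := hcircle hh hD0 hD1 hhD haD hab (by linarith) hBD hε
  exact ⟨⟨d1, n1.trans (by linarith)⟩, ⟨d2, n2.trans herr⟩⟩

end
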